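/- Let $n\ge 2$, let $M$ be a smooth manifold of dimension $n+1$, let $L$ be a compact Lie group with Lie algebra $\mathfrak l$ and an $\mathrm{Ad}$-invariant inner product $q$ on $\mathfrak l$, and let $P\to M$ be a smooth principal $L$-bundle. **Notation.** For a metric $g$ let $\delta_g h_j=-\nabla^i h_{ij}$, let $\delta_g^*\eta$ be the symmetrization of $\nabla\eta$, let $\mathcal B_g=\delta_g+\frac12 d\,\mathrm{tr}_g$ be the Bianchi map, and let $$(\Delta_L h)_{jl}=(\nabla^*\nabla h)_{jl}+\mathrm{Ric}_{jk}h^k{}_l+\mathrm{Ric}_{lk}h^k{}_j-2\,\mathrm{Riem}_{ijkl}h^{ik}\qquad(g^{ik}\mathrm{Riem}_{ijkl}=\mathrm{Ric}_{jl})$$ be the Lichnerowicz Laplacian. Put $$\mathscr L_g h:=\Delta_L h+2n\,h-\mathbb L_{(\mathcal B_g h)^\sharp}g ,$$ where $\mathbb L$ is the Lie derivative. For a connection $\omega$ on $P$ with curvature $\Omega_\omega$ let $d_\omega$ be the exterior covariant derivative on forms with values in $\mathrm{Ad}\,\mathfrak l$, $d^*_{g,\omega}$ its formal adjoint, and $\Delta^1_{\omega}=d_\omega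 d^*_{g,\omega}+d^*_{g,\omega}d_\omega$ on 1-forms. Put $$Q=-\tfrac14 g^{ik}g^{jm}q(\Omega_{ij},\Omega_{km}),\quad K_{ij}=\tfrac12 g^{km}q(\Omega_{ik},\Omega_{jm})+\tfrac12 Q\,g_{ij},\quad \widetilde K_{g,\omega}=K-\tfrac{\mathrm{tr}_gK}{n-1}\,g .$$ Let $(g_0,\omega_0)$ be a trivial configuration: $g_0$ is a smooth metric with $\mathrm{Ric}_{g_0}=-n g_0$ (for instance a Poincaré–Einstein metric) and $\omega_0$ is a smooth connection with $\Omega_{\omega_0}=0$. Let $\Theta,A$ be symmetric 2-tensors on $M$ and $\epsilon,a$ be 1-forms on $M$ with values in $\mathrm{Ad}\,\mathfrak l$, all of class $C^2$; if $M$ is the interior of a compact manifold with boundary $Y$ and boundary defining function $x$, one may take in particular the extensions $\Theta=e_x(\Gamma)=x^{-2}e(\Gamma)$ and $\epsilon=\mathfrak e(\gamma)$ of boundary data $(\Gamma,\gamma)$ on $Y$. With $g=g_0+\Theta+A$ and $\omega=\omega_0+\epsilon+a$ the gauged Einstein–Yang–Mills operator is $$\mathscr P(\Theta,A;\epsilon,a)=\begin{pmatrix}\mathrm{Ric}_g+n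 g-\widetilde K_{g,\omega}+\delta_g^*\,\mathcal B_{g_0+\Theta}A\\[2pt] d^*_{g,\omega}\Omega_\omega+d_\omega\, d^*_{g_0+\Theta,\,\omega_0+\epsilon}\,a\end{pmatrix}.$$ **Claim.** $\mathscr P(0)=0$, and the linearization of $\mathscr P$ at $(g_0,\omega_0)$ is block-diagonal, with all geometric operators taken with respect to $g_0$: $$D\mathscr P_{(g_0,\omega_0)}(\Theta,A;\epsilon,a)=\begin{pmatrix}\tfrac12\big(\mathscr L_{g_0}\Theta+(\Delta_L+2n)A\big)\\[2pt] d^*_{\omega_0}d_{\omega_0}\epsilon+\Delta^1_{\omega_0}a\end{pmatrix}.$$ This holds in the following sense, in every chart of $M$ and every local smooth section of $P$ over its domain. 1. At every point, the $t$-derivative at $t=0$ of each component of $\mathscr P(t\Theta,tA;t\epsilon,ta)$ exists and is the corresponding component of the right-hand side; the $t$-derivative at $t=0$ of $\widetilde K_{g_0+t\Theta+tA,\;\omega_0+t\epsilon+ta}$ is $0$. 2. For every compact subset of the chart there are $C$ and $\rho>0$ such that, for all $(\Theta,A;\epsilon,a)$ as above, every point $y$ of the subset and every $r\le\rho$: if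 the components of $\Theta,A,\epsilon,a$ and their partial derivatives of order at most two are bounded by $r$ at $y$, then the components at $y$ of $\mathscr P(\Theta,A;\epsilon,a)$ and of the right-hand side differ by at most $Cr^2$. -/

import Mathlib

open scoped Manifold ContDiff

noncomputable section

namespace EYM

/-! ### Tensor calculus in local coordinates

Coordinates take values in `ℝ^(n+1)`; the index set is `Fin (n+1)`.  A covariant tensor field with
values in a vector space `F` is given by its components. -/

section Local

/-- The coordinate space `ℝ^(n+1)`. -/
abbrev Vec (n : ℕ) : Type := EuclideanSpace ℝ (Fin (n + 1))

/-- Components of a 1-tensor field. -/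
abbrev Cov1 (n : ℕ) (F : Type*) : Type _ := Vec n → Fin (n + 1) → F

/-- Components of a covariant 2-tensor field. -/
abbrev Cov2 (n : ℕ) (F : Type*) : Type _ := Vec n → Fin (n + 1) → Fin (n + 1) → F

/-- Components of a covariant 3-tensor field. -/
abbrev Cov3 (n : ℕ) (F : Type*) : Type _ :=
  Vec n → Fin (n + 1) → Fin (n + 1) → Fin (n + 1) → F

variable {n : ℕ} {F : Type*} [NormedAddCommGroup F] [NormedSpace ℝ F]

/-- The partial derivative `∂_i f`. -/
def pd (i : Fin (n + 1)) (f : Vec n → F) (y : Vec n) : F :=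
  fderiv ℝ f y (EuclideanSpace.single i 1)

/-- The components `g^{ij}` of the inverse of `(g_{ij})`. -/
def inv (g : Cov2 n ℝ) : Cov2 n ℝ := fun y i j => (Matrix.of (g y))⁻¹ i j

/-- The Christoffel symbols `Γ^k_{ij}` of the Levi-Civita connection (arguments `k i j`). -/
def christoffel (g : Cov2 n ℝ) : Cov3 n ℝ := fun y k i j =>
  (1 / 2 : ℝ) * ∑ l, inv g y k l *
    (pd i (fun z => g z j l) y + pd j (fun z => g z i l) y - pd l (fun z => g z i j) y)

/-- `∇_i a_j` (arguments `i j`). -/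
def cov1 (g : Cov2 n ℝ) (a : Cov1 n F) : Cov2 n F := fun y i j =>
  pd i (fun z => a z j) y - ∑ m, christoffel g y m i j • a y m

/-- `∇_i h_{jk}` (arguments `i j k`). -/
def cov2 (g : Cov2 n ℝ) (h : Cov2 n F) : Cov3 n F := fun y i j k =>
  pd i (fun z => h z j k) y
    - ∑ m, christoffel g y m i j • h y m k - ∑ m, christoffel g y m i k • h y j m

/-- `∇_i T_{jkl}` (arguments `i j k l`). -/
def cov3 (g : Cov2 n ℝ) (T : Cov3 n ℝ) (y : Vec n) (i j k l : Fin (n + 1)) : ℝ :=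
  pd i (fun z => T z j k l) y - ∑ m, christoffel g y m i j * T y m k l
    - ∑ m, christoffel g y m i k * T y j m l - ∑ m, christoffel g y m i l * T y j k m

/-- `R^i_{jkl}`, where `R(∂_k, ∂_l) ∂_j = R^i_{jkl} ∂_i` and
`R(X, Y) = [∇_X, ∇_Y] - ∇_{[X, Y]}` (arguments `i j k l`). -/
def curv (g : Cov2 n ℝ) (y : Vec n) (i j k l : Fin (n + 1)) : ℝ :=
  pd k (fun z => christoffel g z i l j) y - pd l (fun z => christoffel g z i k j) y
    + ∑ m, (christoffel g y i k m * christoffel g y m l j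
      - christoffel g y i l m * christoffel g y m k j)

/-- `Riem_{ijkl}`, normalized so that `g^{ik} Riem_{ijkl} = Ric_{jl}`. -/
def riem (g : Cov2 n ℝ) (y : Vec n) (i j k l : Fin (n + 1)) : ℝ :=
  ∑ m, g y i m * curv g y m j k l

/-- The Ricci tensor `Ric_{jl} = R^i_{jil}`. -/
def ricci (g : Cov2 n ℝ) : Cov2 n ℝ := fun y j l => ∑ i, curv g y i j i l

/-- The trace `g^{ij} h_{ij}`. -/
def trace (g h : Cov2 n ℝ) (y : Vec n) : ℝ := ∑ i, ∑ j, inv g y i j * h y i j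

/-- The divergence `(δh)_j = -∇^i h_{ij}`. -/
def divergence (g h : Cov2 n ℝ) : Cov1 n ℝ := fun y j =>
  -∑ i, ∑ k, inv g y i k * cov2 g h y k i j

/-- The Bianchi map `B = δ + (1/2) d tr`. -/
def bianchi (g h : Cov2 n ℝ) : Cov1 n ℝ := fun y j =>
  divergence g h y j + (1 / 2 : ℝ) * pd j (trace g h) y

/-- `δ^*`, the symmetrization of `∇` on 1-forms. -/
def deltaStar (g : Cov2 n ℝ) (η : Cov1 n ℝ) : Cov2 n ℝ := fun y i j =>
  (1 / 2 : ℝ) * (cov1 g η y i j + cov1 g η y j i)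

/-- The vector field `η^♯` dual to a 1-form `η`. -/
def sharp (g : Cov2 n ℝ) (η : Cov1 n ℝ) : Cov1 n ℝ := fun y k => ∑ l, inv g y k l * η y l

/-- The Lie derivative of the 2-tensor `h` along the vector field `X`. -/
def lieDeriv (X : Cov1 n ℝ) (h : Cov2 n ℝ) : Cov2 n ℝ := fun y i j =>
  ∑ k, (X y k * pd k (fun z => h z i j) y + h y k j * pd i (fun z => X z k) y
    + h y i k * pd j (fun z => X z k) y)

/-- The Bochner Laplacian `∇^*∇` on 2-tensors. -/
def bochner (g h : Cov2 n ℝ) : Cov2 n ℝ := fun y j l =>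
  -∑ i, ∑ m, inv g y i m * cov3 g (cov2 g h) y i m j l

/-- `(Ric~ h)_{jl} = (1/2) (Ric_{jk} h^k_l + Ric_{lk} h^k_j)`. -/
def ricAct (g h : Cov2 n ℝ) : Cov2 n ℝ := fun y j l =>
  (1 / 2 : ℝ) * ∑ k, ∑ m, inv g y k m * (ricci g y j k * h y m l + ricci g y l k * h y m j)

/-- `(Riem~ h)_{jl} = Riem_{ijkl} h^{ik}`. -/
def riemAct (g h : Cov2 n ℝ) : Cov2 n ℝ := fun y j l =>
  ∑ i, ∑ k, riem g y i j k l * ∑ a, ∑ b, inv g y i a * inv g y k b * h y a b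

/-- The Lichnerowicz Laplacian `Δ_L = ∇^*∇ + 2 (Ric~ - Riem~)`. -/
def lichnerowicz (g h : Cov2 n ℝ) : Cov2 n ℝ := fun y j l =>
  bochner g h y j l + 2 * (ricAct g h y j l - riemAct g h y j l)

/-- `Δ_(n) = Δ_L + 2n`. -/
def lichN (g h : Cov2 n ℝ) : Cov2 n ℝ := fun y j l =>
  lichnerowicz g h y j l + 2 * (n : ℝ) * h y j l

/-- `𝓛 h = Δ_L h + 2n h - L_{(B h)^♯} g`. -/
def einsteinLin (g h : Cov2 n ℝ) : Cov2 n ℝ := fun y j l =>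
  lichN g h y j l - lieDeriv (sharp g (bianchi g h)) g y j l

/-! Gauge theory in a local gauge.  `br` is the bracket of the Lie algebra `𝔩`, `q` an inner
product on it, and `ϖ` the gauge potential, i.e. the pull-back of the connection form by a local
section of the principal bundle.  Forms with values in the adjoint bundle are pulled back by the
same section. -/

variable {𝔩 : Type*} [NormedAddCommGroup 𝔩] [NormedSpace ℝ 𝔩]

/-- The curvature `Ω = dϖ + (1/2) [ϖ ∧ ϖ]`. -/
def ymCurv (br : 𝔩 → 𝔩 → 𝔩) (ϖ : Cov1 n 𝔩) : Cov2 n 𝔩 := fun y i j =>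
  pd i (fun z => ϖ z j) y - pd j (fun z => ϖ z i) y + br (ϖ y i) (ϖ y j)

/-- `d_ϖ` on 0-forms. -/
def dCov0 (br : 𝔩 → 𝔩 → 𝔩) (ϖ : Cov1 n 𝔩) (f : Vec n → 𝔩) : Cov1 n 𝔩 := fun y i =>
  pd i f y + br (ϖ y i) (f y)

/-- `d_ϖ` on 1-forms. -/
def dCov1 (br : 𝔩 → 𝔩 → 𝔩) (ϖ a : Cov1 n 𝔩) : Cov2 n 𝔩 := fun y i j =>
  pd i (fun z => a z j) y - pd j (fun z => a z i) y + br (ϖ y i) (a y j) - br (ϖ y j) (a y i)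

/-- The formal adjoint `d_ϖ^*` on 1-forms, `-g^{ij} ∇^ϖ_i a_j`. -/
def dStar1 (br : 𝔩 → 𝔩 → 𝔩) (g : Cov2 n ℝ) (ϖ a : Cov1 n 𝔩) (y : Vec n) : 𝔩 :=
  -∑ i, ∑ j, inv g y i j • (cov1 g a y i j + br (ϖ y i) (a y j))

/-- The formal adjoint `d_ϖ^*` on 2-forms, `-g^{ik} ∇^ϖ_i Φ_{kj}`. -/
def dStar2 (br : 𝔩 → 𝔩 → 𝔩) (g : Cov2 n ℝ) (ϖ : Cov1 n 𝔩) (Φ : Cov2 n 𝔩) : Cov1 n 𝔩 :=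
  fun y j => -∑ i, ∑ k, inv g y i k • (cov2 g Φ y i k j + br (ϖ y i) (Φ y k j))

/-- The twisted Hodge Laplacian `Δ^1_ϖ = d_ϖ d_ϖ^* + d_ϖ^* d_ϖ` on 1-forms. -/
def hodge1 (br : 𝔩 → 𝔩 → 𝔩) (g : Cov2 n ℝ) (ϖ a : Cov1 n 𝔩) : Cov1 n 𝔩 := fun y i =>
  dCov0 br ϖ (dStar1 br g ϖ a) y i + dStar2 br g ϖ (dCov1 br ϖ a) y i

/-- The self-action density `Q = -(1/4) g^{ik} g^{jm} q(Ω_{ij}, Ω_{km})`. -/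
def selfAction (br : 𝔩 → 𝔩 → 𝔩) (q : 𝔩 →L[ℝ] 𝔩 →L[ℝ] ℝ) (g : Cov2 n ℝ) (ϖ : Cov1 n 𝔩)
    (y : Vec n) : ℝ :=
  -(1 / 4 : ℝ) * ∑ i, ∑ j, ∑ k, ∑ m,
    inv g y i k * inv g y j m * q (ymCurv br ϖ y i j) (ymCurv br ϖ y k m)

/-- The stress-energy tensor `K_{ij} = (1/2) g^{km} q(Ω_{ik}, Ω_{jm}) + (1/2) Q g_{ij}`. -/
def stress (br : 𝔩 → 𝔩 → 𝔩) (q : 𝔩 →L[ℝ] 𝔩 →L[ℝ] ℝ) (g : Cov2 n ℝ) (ϖ : Cov1 n 𝔩) :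
    Cov2 n ℝ := fun y i j =>
  (1 / 2 : ℝ) * (∑ k, ∑ m, inv g y k m * q (ymCurv br ϖ y i k) (ymCurv br ϖ y j m))
    + (1 / 2 : ℝ) * selfAction br q g ϖ y * g y i j

/-- The modified stress-energy tensor `K~ = K - (tr K / (n - 1)) g`. -/
def stressMod (br : 𝔩 → 𝔩 → 𝔩) (q : 𝔩 →L[ℝ] 𝔩 →L[ℝ] ℝ) (g : Cov2 n ℝ) (ϖ : Cov1 n 𝔩) :
    Cov2 n ℝ := fun y i j =>
  stress br q g ϖ y i j - trace g (stress br q g ϖ) y / ((n : ℝ) - 1) * g y i j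

/-- The metric component of the gauged operator at
`(g, ϖ) = (g₀ + Θ + A, ϖ₀ + ε + a)`:
`Ric_g + n g - K~_{g,ϖ} + δ^*_g B_{g₀ + Θ} A`. -/
def opQ (br : 𝔩 → 𝔩 → 𝔩) (q : 𝔩 →L[ℝ] 𝔩 →L[ℝ] ℝ) (g₀ Θ A : Cov2 n ℝ) (ϖ₀ ε a : Cov1 n 𝔩) :
    Cov2 n ℝ := fun y i j =>
  ricci (g₀ + Θ + A) y i j + (n : ℝ) * (g₀ + Θ + A) y i j
    - stressMod br q (g₀ + Θ + A) (ϖ₀ + ε + a) y i j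
    + deltaStar (g₀ + Θ + A) (bianchi (g₀ + Θ) A) y i j

/-- The connection component of the gauged operator at
`(g, ϖ) = (g₀ + Θ + A, ϖ₀ + ε + a)`:
`d^*_{g,ϖ} Ω_ϖ + d_ϖ d^*_{g₀ + Θ, ϖ₀ + ε} a`. -/
def opR (br : 𝔩 → 𝔩 → 𝔩) (g₀ Θ A : Cov2 n ℝ) (ϖ₀ ε a : Cov1 n 𝔩) : Cov1 n 𝔩 := fun y i =>
  dStar2 br (g₀ + Θ + A) (ϖ₀ + ε + a) (ymCurv br (ϖ₀ + ε + a)) y i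
    + dCov0 br (ϖ₀ + ε + a) (dStar1 br (g₀ + Θ) (ϖ₀ + ε) a) y i

/-- All components of `h`, and their partial derivatives of order at most two, are bounded by `r`
at the point `y`. -/
def JetBound2 (h : Cov2 n ℝ) (y : Vec n) (r : ℝ) : Prop :=
  ∀ i j, |h y i j| ≤ r ∧ (∀ k, |pd k (fun z => h z i j) y| ≤ r) ∧
    ∀ k l, |pd k (pd l (fun z => h z i j)) y| ≤ r

/-- All components of `a`, and their partial derivatives of order at most two, are bounded by `r`
at the point `y`. -/
def JetBound1 (a : Cov1 n 𝔩) (y : Vec n) (r : ℝ) : Prop :=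
  ∀ i, ‖a y i‖ ≤ r ∧ (∀ k, ‖pd k (fun z => a z i) y‖ ≤ r) ∧
    ∀ k l, ‖pd k (pd l (fun z => a z i)) y‖ ≤ r

end Local

/-! ### Lie groups, principal bundles and connections -/

section Global

/-- The bracket of the Lie algebra `𝔩 = T_1 L`, which is identified with the model space. -/
def lieBr {EL : Type*} [NormedAddCommGroup EL] [NormedSpace ℝ EL] (L : Type*)
    [TopologicalSpace L] [ChartedSpace EL L] [Group L] (X Y : EL) : EL :=
  (Bracket.bracket : GroupLieAlgebra 𝓘(ℝ, EL) L → GroupLieAlgebra 𝓘(ℝ, EL) L →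
    GroupLieAlgebra 𝓘(ℝ, EL) L) X Y

/-- The adjoint representation of `L` on `𝔩 = T_1 L`. -/
def Ad {EL : Type*} [NormedAddCommGroup EL] [NormedSpace ℝ EL] {L : Type*}
    [TopologicalSpace L] [ChartedSpace EL L] [Group L] (l : L) : EL →L[ℝ] EL :=
  mfderiv 𝓘(ℝ, EL) 𝓘(ℝ, EL) (fun x : L => l * x * l⁻¹) 1

/-- `q` is an `Ad`-invariant inner product on the Lie algebra of `L`. -/
structure IsAdInvariantInner {EL : Type*} [NormedAddCommGroup EL] [NormedSpace ℝ EL] (L : Type*)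
    [TopologicalSpace L] [ChartedSpace EL L] [Group L] (q : EL →L[ℝ] EL →L[ℝ] ℝ) : Prop where
  symm : ∀ X Y, q X Y = q Y X
  pos : ∀ X, X ≠ 0 → 0 < q X X
  invariant : ∀ (l : L) (X Y : EL), q (Ad l X) (Ad l Y) = q X Y

/-- `π : P → M` is a smooth principal bundle with structure group `L`, which acts on `P` from the
right (i.e. `Lᵐᵒᵖ` acts from the left).  Over `U`, the map `(p, l) ↦ s(p) l` is an equivariant
diffeomorphism `U × L → π⁻¹(U)` with inverse `(π, τ)`. -/
structure IsPrincipalBundle (n : ℕ) {M : Type*} [TopologicalSpace M] [ChartedSpace (Vec n) M]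
    (EL : Type*) [NormedAddCommGroup EL] [NormedSpace ℝ EL] (L : Type*) [TopologicalSpace L]
    [ChartedSpace EL L] [Group L] (EP : Type*) [NormedAddCommGroup EP] [NormedSpace ℝ EP]
    {P : Type*} [TopologicalSpace P] [ChartedSpace EP P] [MulAction Lᵐᵒᵖ P] (π : P → M) :
    Prop where
  smooth_proj : ContMDiff 𝓘(ℝ, EP) (𝓡 (n + 1)) ∞ π
  smooth_act : ContMDiff (𝓘(ℝ, EP).prod 𝓘(ℝ, EL)) 𝓘(ℝ, EP) ∞
    (fun z : P × L => MulOpposite.op z.2 • z.1)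
  proj_act : ∀ (u : P) (l : L), π (MulOpposite.op l • u) = π u
  free : ∀ (u : P) (l : L), MulOpposite.op l • u = u → l = 1
  locally_trivial : ∀ p : M, ∃ U : Set M, IsOpen U ∧ p ∈ U ∧ ∃ (s : M → P) (τ : P → L),
    ContMDiffOn (𝓡 (n + 1)) 𝓘(ℝ, EP) ∞ s U ∧ (∀ p' ∈ U, π (s p') = p') ∧
    ContMDiffOn 𝓘(ℝ, EP) 𝓘(ℝ, EL) ∞ τ (π ⁻¹' U) ∧
    ∀ u ∈ π ⁻¹' U, u = MulOpposite.op (τ u) • s (π u)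

/-- `s` restricts to a smooth local section of `π` over the set `U`. -/
def IsLocalSection (n : ℕ) {M : Type*} [TopologicalSpace M] [ChartedSpace (Vec n) M]
    (EP : Type*) [NormedAddCommGroup EP] [NormedSpace ℝ EP] {P : Type*} [TopologicalSpace P]
    [ChartedSpace EP P] (π : P → M) (U : Set M) (s : M → P) : Prop :=
  ContMDiffOn (𝓡 (n + 1)) 𝓘(ℝ, EP) ∞ s U ∧ ∀ p ∈ U, π (s p) = p

/-- Covariant 2-tensor fields on `M`. -/
abbrev Tensor2 (n : ℕ) (M : Type*) [TopologicalSpace M] [ChartedSpace (Vec n) M] : Type _ :=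
  ∀ p : M, TangentSpace (𝓡 (n + 1)) p →L[ℝ] TangentSpace (𝓡 (n + 1)) p →L[ℝ] ℝ

/-- 1-forms on `P` with values in the vector space `𝔩`. -/
abbrev Form1 (EP : Type*) [NormedAddCommGroup EP] [NormedSpace ℝ EP] (P : Type*)
    [TopologicalSpace P] [ChartedSpace EP P] (𝔩 : Type*) [NormedAddCommGroup 𝔩]
    [NormedSpace ℝ 𝔩] : Type _ :=
  ∀ u : P, TangentSpace 𝓘(ℝ, EP) u →L[ℝ] 𝔩

/-- `h` is a symmetric 2-tensor field of class `C^r` on `M`. -/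
structure IsSymTensor {n : ℕ} {M : Type*} [TopologicalSpace M] [ChartedSpace (Vec n) M]
    [IsManifold (𝓡 (n + 1)) ∞ M] (r : WithTop ℕ∞) (h : Tensor2 n M) : Prop where
  symm : ∀ p v w, h p v w = h p w v
  contMDiff : ContMDiff (𝓡 (n + 1)) ((𝓡 (n + 1)).prod 𝓘(ℝ, Vec n →L[ℝ] Vec n →L[ℝ] ℝ)) r
    (fun p => Bundle.TotalSpace.mk' (Vec n →L[ℝ] Vec n →L[ℝ] ℝ)
      (E := fun p : M => TangentSpace (𝓡 (n + 1)) p →L[ℝ] TangentSpace (𝓡 (n + 1)) p →L[ℝ] ℝ)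
      p (h p))

/-- The 1-form `α` on `P` is of class `C^r`. -/
def IsCForm {EP : Type*} [NormedAddCommGroup EP] [NormedSpace ℝ EP] {P : Type*}
    [TopologicalSpace P] [ChartedSpace EP P] [IsManifold 𝓘(ℝ, EP) ∞ P] {𝔩 : Type*}
    [NormedAddCommGroup 𝔩] [NormedSpace ℝ 𝔩] (r : WithTop ℕ∞) (α : Form1 EP P 𝔩) : Prop :=
  ContMDiff 𝓘(ℝ, EP) (𝓘(ℝ, EP).prod 𝓘(ℝ, EP →L[ℝ] 𝔩)) r
    (fun u => Bundle.TotalSpace.mk' (EP →L[ℝ] 𝔩)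
      (E := fun u : P => TangentSpace 𝓘(ℝ, EP) u →L[ℝ] Bundle.Trivial P 𝔩 u) u (α u))

section Forms

variable {EL : Type*} [NormedAddCommGroup EL] [NormedSpace ℝ EL] (L : Type*) [TopologicalSpace L]
  [ChartedSpace EL L] [Group L] {EP : Type*} [NormedAddCommGroup EP] [NormedSpace ℝ EP]
  {P : Type*} [TopologicalSpace P] [ChartedSpace EP P] [MulAction Lᵐᵒᵖ P]

/-- `R_l^* α = Ad_{l⁻¹} α` for all `l ∈ L`. -/
def IsEquivariant (α : Form1 EP P EL) : Prop :=
  ∀ (l : L) (u : P) (v : TangentSpace 𝓘(ℝ, EP) u),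
    α (MulOpposite.op l • u)
      (mfderiv 𝓘(ℝ, EP) 𝓘(ℝ, EP) (fun u' : P => MulOpposite.op l • u') u v)
      = Ad l⁻¹ (α u v)

/-- The value at `u` of the fundamental vector field `X^*` of `X ∈ 𝔩`. -/
def fundamental (u : P) (X : EL) : EP :=
  (mfderiv 𝓘(ℝ, EL) 𝓘(ℝ, EP) (fun l : L => MulOpposite.op l • u) 1 : EL →L[ℝ] EP) X

/-- `ϖ` is a smooth connection form. -/
structure IsConnection [IsManifold 𝓘(ℝ, EP) ∞ P] (ϖ : Form1 EP P EL) : Prop where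
  smooth : IsCForm ∞ ϖ
  equivariant : IsEquivariant L ϖ
  vertical : ∀ (u : P) (X : EL), ϖ u (fundamental L u X : EP) = X

/-- `α` is an equivariant horizontal 1-form of class `C^r`, i.e. a 1-form on the base with values
in the adjoint bundle. -/
structure IsAdForm [IsManifold 𝓘(ℝ, EP) ∞ P] (r : WithTop ℕ∞) (α : Form1 EP P EL) : Prop where
  contMDiff : IsCForm r α
  equivariant : IsEquivariant L α
  horizontal : ∀ (u : P) (X : EL), α u (fundamental L u X : EP) = 0

end Forms

/-- The components of the 2-tensor `h` in the chart `φ`. -/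
def rep2 {n : ℕ} {M : Type*} [TopologicalSpace M] [ChartedSpace (Vec n) M]
    (φ : OpenPartialHomeomorph M (Vec n)) (h : Tensor2 n M) : Cov2 n ℝ := fun y i j =>
  h (φ.symm y)
    (mfderiv (𝓡 (n + 1)) (𝓡 (n + 1)) φ.symm y (EuclideanSpace.single i (1 : ℝ) : Vec n))
    (mfderiv (𝓡 (n + 1)) (𝓡 (n + 1)) φ.symm y (EuclideanSpace.single j (1 : ℝ) : Vec n))

/-- The components in the chart `φ` of the pull-back `s^* α` of a 1-form on `P`. -/
def rep1 {n : ℕ} {M : Type*} [TopologicalSpace M] [ChartedSpace (Vec n) M]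
    {EP : Type*} [NormedAddCommGroup EP] [NormedSpace ℝ EP] {P : Type*} [TopologicalSpace P]
    [ChartedSpace EP P] {𝔩 : Type*} [NormedAddCommGroup 𝔩] [NormedSpace ℝ 𝔩]
    (φ : OpenPartialHomeomorph M (Vec n)) (s : M → P) (α : Form1 EP P 𝔩) : Cov1 n 𝔩 := fun y i =>
  α (s (φ.symm y))
    (mfderiv (𝓡 (n + 1)) 𝓘(ℝ, EP) (fun z => s (φ.symm z)) y
      (EuclideanSpace.single i (1 : ℝ) : Vec n))

/-- `Ric_g = -n g`. -/
def IsEinstein (n : ℕ) {M : Type*} [TopologicalSpace M] [ChartedSpace (Vec n) M]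
    (g : Tensor2 n M) : Prop :=
  ∀ φ ∈ IsManifold.maximalAtlas (𝓡 (n + 1)) ∞ M, ∀ y ∈ φ.target, ∀ i j,
    ricci (rep2 φ g) y i j = -(n : ℝ) * rep2 φ g y i j

/-- The connection form `ϖ` is flat: its curvature vanishes in all charts and local gauges. -/
def IsFlat (n : ℕ) {M : Type*} [TopologicalSpace M] [ChartedSpace (Vec n) M]
    {EL : Type*} [NormedAddCommGroup EL] [NormedSpace ℝ EL] (L : Type*) [TopologicalSpace L]
    [ChartedSpace EL L] [Group L]
    {EP : Type*} [NormedAddCommGroup EP] [NormedSpace ℝ EP] {P : Type*} [TopologicalSpace P]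
    [ChartedSpace EP P] (π : P → M) (ϖ : Form1 EP P EL) : Prop :=
  ∀ φ ∈ IsManifold.maximalAtlas (𝓡 (n + 1)) ∞ M, ∀ s, IsLocalSection n EP π φ.source s →
    ∀ y ∈ φ.target, ∀ i j, ymCurv (lieBr L) (rep1 φ s ϖ) y i j = 0

/-! The gauged operator and the two blocks, in a chart `φ` of `M` and a local gauge `s`. -/

section Operator

variable {n : ℕ} {M : Type*} [TopologicalSpace M] [ChartedSpace (Vec n) M]
  {EL : Type*} [NormedAddCommGroup EL] [NormedSpace ℝ EL] (L : Type*) [TopologicalSpace L]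
  [ChartedSpace EL L] [Group L]
  {EP : Type*} [NormedAddCommGroup EP] [NormedSpace ℝ EP] {P : Type*} [TopologicalSpace P]
  [ChartedSpace EP P]

/-- Components of `Ric_g + n g - K~_{g,ϖ} + δ^*_g B_{g₀ + Θ} A`, where
`(g, ϖ) = (g₀ + Θ + A, ϖ₀ + ε + a)`. -/
def gaugedQ (q : EL →L[ℝ] EL →L[ℝ] ℝ) (φ : OpenPartialHomeomorph M (Vec n)) (s : M → P)
    (g₀ : Tensor2 n M) (ϖ₀ : Form1 EP P EL) (Θ A : Tensor2 n M) (ε a : Form1 EP P EL) :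
    Cov2 n ℝ :=
  opQ (lieBr L) q (rep2 φ g₀) (rep2 φ Θ) (rep2 φ A) (rep1 φ s ϖ₀) (rep1 φ s ε) (rep1 φ s a)

/-- Components of `d^*_{g,ϖ} Ω_ϖ + d_ϖ d^*_{g₀ + Θ, ϖ₀ + ε} a`, where
`(g, ϖ) = (g₀ + Θ + A, ϖ₀ + ε + a)`. -/
def gaugedR (φ : OpenPartialHomeomorph M (Vec n)) (s : M → P)
    (g₀ : Tensor2 n M) (ϖ₀ : Form1 EP P EL) (Θ A : Tensor2 n M) (ε a : Form1 EP P EL) :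
    Cov1 n EL :=
  opR (lieBr L) (rep2 φ g₀) (rep2 φ Θ) (rep2 φ A) (rep1 φ s ϖ₀) (rep1 φ s ε) (rep1 φ s a)

/-- Components of the modified stress-energy tensor `K~_{g,ϖ}`. -/
def stressModRep (q : EL →L[ℝ] EL →L[ℝ] ℝ) (φ : OpenPartialHomeomorph M (Vec n)) (s : M → P)
    (g : Tensor2 n M) (ϖ : Form1 EP P EL) : Cov2 n ℝ :=
  stressMod (lieBr L) q (rep2 φ g) (rep1 φ s ϖ)

/-- Components of the metric block `(1/2) (𝓛 Θ + Δ_(n) A)`. -/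
def metricBlock (φ : OpenPartialHomeomorph M (Vec n)) (g₀ Θ A : Tensor2 n M) : Cov2 n ℝ :=
  fun y i j => (1 / 2 : ℝ) *
    (einsteinLin (rep2 φ g₀) (rep2 φ Θ) y i j + lichN (rep2 φ g₀) (rep2 φ A) y i j)

/-- Components of the connection block `d^*_{ϖ₀} d_{ϖ₀} ε + Δ^1_{ϖ₀} a`. -/
def connectionBlock (φ : OpenPartialHomeomorph M (Vec n)) (s : M → P)
    (g₀ : Tensor2 n M) (ϖ₀ ε a : Form1 EP P EL) : Cov1 n EL :=
  fun y i =>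
    dStar2 (lieBr L) (rep2 φ g₀) (rep1 φ s ϖ₀) (dCov1 (lieBr L) (rep1 φ s ϖ₀) (rep1 φ s ε)) y i
      + hodge1 (lieBr L) (rep2 φ g₀) (rep1 φ s ϖ₀) (rep1 φ s a) y i

end Operator

end Global

end EYM

end

/-!
Everything is computed in a chart, by expanding in 2-jets. A perturbation whose 2-jet is `O(r)`
changes the inverse metric and the Christoffel symbols by `O(r)`, and changes the Ricci tensor by a
linear expression in its 2-jet up to `O(r²)`, uniformly on compact sets. Commuting covariant
derivatives identifies this linear expression, for `h = Θ + A`, with `(1/2) Δ_L h - δ^* B h`. The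
gauge term cancels `-δ^* B A`, and the identity `2 δ^* η = L_{η^♯} g` turns the terms in `Θ` into
`(1/2) 𝓛 Θ`.

Since the background connection is flat, the perturbed curvature is `d_ω (ε + a) + O(r²)`. The
stress-energy tensor is quadratic in it, hence `O(r²)`, and `d^* Ω` linearizes to
`d^* d (ε + a)`, to which the gauge term adds the missing `d d^* a` of the Hodge Laplacian.

Both operators thus agree with their linearizations up to `C r²`. Along the ray `t (Θ, A; ε, a)`
this bound is `O(t²)`, which gives the derivatives.
-/

namespace EYM

open Filter Topology Asymptotics

section Calculus

variable {n : ℕ} {F : Type*} [NormedAddCommGroup F] [NormedSpace ℝ F]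
  {G : Type*} [NormedAddCommGroup G] [NormedSpace ℝ G]
  {H : Type*} [NormedAddCommGroup H] [NormedSpace ℝ H] {y : Vec n}

theorem pd_congr {f f' : Vec n → F} (h : f =ᶠ[𝓝 y] f') (i : Fin (n + 1)) :
    pd i f y = pd i f' y := by
  simp only [pd, h.fderiv_eq]

theorem pd_eventuallyEq {f f' : Vec n → F} (h : f =ᶠ[𝓝 y] f') (i : Fin (n + 1)) :
    pd i f =ᶠ[𝓝 y] pd i f' :=
  h.eventuallyEq_nhds.mono fun _ hz => pd_congr hz i

theorem pd_add {f f' : Vec n → F} (hf : DifferentiableAt ℝ f y) (hf' : DifferentiableAt ℝ f' y)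
    (i : Fin (n + 1)) : pd i (fun z => f z + f' z) y = pd i f y + pd i f' y := by
  simp only [pd, fderiv_fun_add hf hf', add_apply]

theorem pd_sub {f f' : Vec n → F} (hf : DifferentiableAt ℝ f y) (hf' : DifferentiableAt ℝ f' y)
    (i : Fin (n + 1)) : pd i (fun z => f z - f' z) y = pd i f y - pd i f' y := by
  simp only [pd, fderiv_fun_sub hf hf', sub_apply]

theorem pd_sum {ι : Type*} (s : Finset ι) {f : ι → Vec n → F}
    (hf : ∀ a ∈ s, DifferentiableAt ℝ (f a) y) (i : Fin (n + 1)) :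
    pd i (fun z => ∑ a ∈ s, f a z) y = ∑ a ∈ s, pd i (f a) y := by
  simp only [pd, fderiv_fun_sum hf, sum_apply]

theorem pd_bilin (B : F →L[ℝ] G →L[ℝ] H) {f : Vec n → F} {f' : Vec n → G}
    (hf : DifferentiableAt ℝ f y) (hf' : DifferentiableAt ℝ f' y) (i : Fin (n + 1)) :
    pd i (fun z => B (f z) (f' z)) y = B (pd i f y) (f' y) + B (f y) (pd i f' y) := by
  have h := (B.hasFDerivAt_of_bilinear hf.hasFDerivAt hf'.hasFDerivAt).fderiv
  simp only [pd, h]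
  simp [add_comm]

theorem pd_sum_mul {ι : Type*} (s : Finset ι) {f f' : ι → Vec n → ℝ}
    (hf : ∀ a, DifferentiableAt ℝ (f a) y) (hf' : ∀ a, DifferentiableAt ℝ (f' a) y)
    (i : Fin (n + 1)) : pd i (fun z => ∑ a ∈ s, f a z * f' a z) y =
      ∑ a ∈ s, pd i (f a) y * f' a y + ∑ a ∈ s, f a y * pd i (f' a) y := by
  rw [pd_sum s fun a _ => (hf a).fun_mul (hf' a), ← Finset.sum_add_distrib]
  exact Finset.sum_congr rfl fun a _ =>
    pd_bilin (ContinuousLinearMap.mul ℝ ℝ) (hf a) (hf' a) i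

theorem pd_const_smul (c : ℝ) (f : Vec n → F) (i : Fin (n + 1)) :
    pd i (fun z => c • f z) y = c • pd i f y :=
  congrArg (· (EuclideanSpace.single i 1))
    (congrFun (fderiv_const_smul_field (𝕜 := ℝ) (f := f) c) y)

theorem pd_const_mul (c : ℝ) (f : Vec n → ℝ) (i : Fin (n + 1)) :
    pd i (fun z => c * f z) y = c * pd i f y :=
  pd_const_smul c f i

theorem pd_const (c : F) (i : Fin (n + 1)) : pd i (fun _ : Vec n => c) y = 0 := by
  simp [pd]

theorem contDiffAt_pd {k m : ℕ∞ω} {f : Vec n → F} (hf : ContDiffAt ℝ m f y) (hkm : k + 1 ≤ m)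
    (i : Fin (n + 1)) : ContDiffAt ℝ k (pd i f) y :=
  (hf.fderiv_right hkm).clm_apply contDiffAt_const

theorem differentiableAt_pd {f : Vec n → F} (hf : ContDiffAt ℝ 2 f y) (i : Fin (n + 1)) :
    DifferentiableAt ℝ (pd i f) y :=
  (contDiffAt_pd hf (k := 1) (by norm_num) i).differentiableAt one_ne_zero

theorem pd_pd_eq_fderiv_fderiv {f : Vec n → F} (hf : ContDiffAt ℝ 2 f y) (i j : Fin (n + 1)) :
    pd i (pd j f) y =
      fderiv ℝ (fderiv ℝ f) y (EuclideanSpace.single i 1) (EuclideanSpace.single j 1) := by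
  have hd : DifferentiableAt ℝ (fderiv ℝ f) y :=
    (hf.fderiv_right (m := 1) (by norm_num)).differentiableAt one_ne_zero
  change fderiv ℝ (fun z => fderiv ℝ f z (EuclideanSpace.single j 1)) y _ = _
  rw [fderiv_clm_apply hd (differentiableAt_const _)]
  simp

theorem pd_comm {f : Vec n → F} (hf : ContDiffAt ℝ 2 f y) (i j : Fin (n + 1)) :
    pd i (pd j f) y = pd j (pd i f) y := by
  rw [pd_pd_eq_fderiv_fderiv hf, pd_pd_eq_fderiv_fderiv hf]
  exact (hf.isSymmSndFDerivAt (by simp)).eq _ _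

end Calculus

section Matrix

variable {n : ℕ} {g : Cov2 n ℝ} {y : Vec n}

theorem contDiffAt_det {E : Type*} [NormedAddCommGroup E] [NormedSpace ℝ E] {ι : Type*}
    [Fintype ι] [DecidableEq ι] {k : ℕ∞ω} {A : E → Matrix ι ι ℝ} {x : E}
    (hA : ∀ i j, ContDiffAt ℝ k (fun z => A z i j) x) : ContDiffAt ℝ k (fun z => (A z).det) x := by
  simp only [Matrix.det_apply]
  exact ContDiffAt.sum fun σ _ => (contDiffAt_prod fun i _ => hA _ _).const_smul _

theorem eventually_det_ne_zero {k : ℕ∞ω} (hg : ∀ i j, ContDiffAt ℝ k (fun z => g z i j) y)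
    (hdet : (Matrix.of (g y)).det ≠ 0) : ∀ᶠ z in 𝓝 y, (Matrix.of (g z)).det ≠ 0 :=
  (contDiffAt_det (A := fun z => Matrix.of (g z)) hg).continuousAt.eventually_ne hdet

theorem contDiffAt_inv {k : ℕ∞ω} (hg : ∀ i j, ContDiffAt ℝ k (fun z => g z i j) y)
    (hdet : (Matrix.of (g y)).det ≠ 0) (i j : Fin (n + 1)) :
    ContDiffAt ℝ k (fun z => inv g z i j) y := by
  simp only [inv, Matrix.inv_def, Ring.inverse_eq_inv', Matrix.smul_apply, smul_eq_mul,
    Matrix.adjugate_apply]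
  refine ((contDiffAt_det (A := fun z => Matrix.of (g z)) hg).inv hdet).mul
    (contDiffAt_det fun a b => ?_)
  rcases eq_or_ne a j with rfl | ha
  · simp only [Matrix.updateRow_self]
    exact contDiffAt_const
  · simp only [Matrix.updateRow_ne ha]
    exact hg a b

theorem inv_symm (hs : ∀ i j, g y i j = g y j i) (i j : Fin (n + 1)) :
    inv g y i j = inv g y j i := by
  have hT : (Matrix.of (g y)).transpose = Matrix.of (g y) := Matrix.ext fun a b => hs b a
  have hinv := Matrix.transpose_nonsing_inv (Matrix.of (g y))
  rw [hT] at hinv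
  exact (congrFun (congrFun hinv i) j).symm

theorem sum_mul_sum_inv_mul (hdet : (Matrix.of (g y)).det ≠ 0) (w : Fin (n + 1) → ℝ)
    (i : Fin (n + 1)) : ∑ j, g y i j * ∑ l, inv g y j l * w l = w i := by
  have h := Matrix.mulVec_mulVec w (Matrix.of (g y)) (Matrix.of (g y))⁻¹
  rw [Matrix.mul_nonsing_inv _ (isUnit_iff_ne_zero.2 hdet), Matrix.one_mulVec] at h
  exact congrFun h i

theorem sum_inv_mul_sum_mul (hdet : (Matrix.of (g y)).det ≠ 0) (w : Fin (n + 1) → ℝ)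
    (i : Fin (n + 1)) : ∑ j, inv g y i j * ∑ l, g y j l * w l = w i := by
  have h := Matrix.mulVec_mulVec w (Matrix.of (g y))⁻¹ (Matrix.of (g y))
  rw [Matrix.nonsing_inv_mul _ (isUnit_iff_ne_zero.2 hdet), Matrix.one_mulVec] at h
  exact congrFun h i

/-- The matrix `(∂_i h_{jl})_{jl}`. -/
noncomputable def pdMatrix (i : Fin (n + 1)) (h : Cov2 n ℝ) (y : Vec n) :
    Matrix (Fin (n + 1)) (Fin (n + 1)) ℝ :=
  Matrix.of fun j l => pd i (fun z => h z j l) y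

theorem pdMatrix_inv (hg : ∀ i j, ContDiffAt ℝ 1 (fun z => g z i j) y)
    (hdet : (Matrix.of (g y)).det ≠ 0) (m : Fin (n + 1)) :
    pdMatrix m (inv g) y = -((Matrix.of (g y))⁻¹ * pdMatrix m g y * (Matrix.of (g y))⁻¹) := by
  have hG := contDiffAt_inv hg hdet
  have product_rule : pdMatrix m (inv g) y * Matrix.of (g y)
      + (Matrix.of (g y))⁻¹ * pdMatrix m g y = 0 := by
    ext a b
    have h0 : pd m (fun z => ∑ c, inv g z a c * g z c b) y = 0 := by
      rw [pd_congr (f' := fun _ => (1 : Matrix (Fin (n + 1)) (Fin (n + 1)) ℝ) a b), pd_const]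
      filter_upwards [eventually_det_ne_zero hg hdet] with z hz
      exact congrFun (congrFun (Matrix.nonsing_inv_mul _ (isUnit_iff_ne_zero.2 hz)) a) b
    rwa [pd_sum_mul _ (fun c => (hG a c).differentiableAt one_ne_zero)
      (fun c => (hg c b).differentiableAt one_ne_zero)] at h0
  have h := congrArg (· * (Matrix.of (g y))⁻¹) product_rule
  simp only [add_mul, zero_mul] at h
  rw [Matrix.mul_nonsing_inv_cancel_right _ _ (isUnit_iff_ne_zero.2 hdet)] at h
  exact eq_neg_of_add_eq_zero_left h

theorem pd_inv_eq (hg : ∀ i j, ContDiffAt ℝ 1 (fun z => g z i j) y)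
    (hdet : (Matrix.of (g y)).det ≠ 0) (m i j : Fin (n + 1)) :
    pd m (fun z => inv g z i j) y =
      -∑ b, ∑ a, inv g y i a * pd m (fun z => g z a b) y * inv g y b j := by
  have h := congrFun (congrFun (pdMatrix_inv hg hdet m) i) j
  simp only [Matrix.neg_apply, Matrix.mul_apply, Finset.sum_mul] at h
  exact h

end Matrix

section Metric

variable {n : ℕ} {g h : Cov2 n ℝ} {y : Vec n}

/-- `g` is a pseudo-Riemannian metric of class `C^k` near `y`: its components are symmetric
(everywhere), of class `C^k` near `y`, and form an invertible matrix at `y`. -/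
structure IsMetricAt (k : ℕ∞ω) (g : Cov2 n ℝ) (y : Vec n) : Prop where
  symm : ∀ z i j, g z i j = g z j i
  smooth : ∀ i j, ContDiffAt ℝ k (fun z => g z i j) y
  det_ne : (Matrix.of (g y)).det ≠ 0

/-- The matrix `(Γ^m_{ij})_{mj}`. -/
noncomputable def christoffelMatrix (g : Cov2 n ℝ) (y : Vec n) (i : Fin (n + 1)) :
    Matrix (Fin (n + 1)) (Fin (n + 1)) ℝ := Matrix.of fun m j => christoffel g y m i j

theorem christoffel_symm (hs : ∀ z i j, g z i j = g z j i) (y : Vec n) (a i j : Fin (n + 1)) :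
    christoffel g y a i j = christoffel g y a j i := by
  simp only [christoffel, fun z => hs z i j]
  congr 1
  exact Finset.sum_congr rfl fun l _ => by ring

theorem cov2_symm (hs : ∀ z i j, h z i j = h z j i) (g : Cov2 n ℝ) (y : Vec n)
    (i j l : Fin (n + 1)) : cov2 g h y i j l = cov2 g h y i l j := by
  simp only [cov2, fun z => hs z l j, fun m => hs y m j, fun m => hs y l m]
  abel

theorem cov3_symm {T : Cov3 n ℝ} (hs : ∀ z i j l, T z i j l = T z i l j) (g : Cov2 n ℝ)
    (y : Vec n) (i a j l : Fin (n + 1)) : cov3 g T y i a j l = cov3 g T y i a l j := by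
  simp only [cov3, fun z => hs z a j l, fun m => hs y m l j, fun m => hs y a m j,
    fun m => hs y a l m]
  ring

namespace IsMetricAt

variable {k : ℕ∞ω}

theorem of_le {m : ℕ∞ω} (hg : IsMetricAt k g y) (hm : m ≤ k) : IsMetricAt m g y :=
  ⟨hg.symm, fun i j => (hg.smooth i j).of_le hm, hg.det_ne⟩

theorem eventually (hg : IsMetricAt k g y) (hk : k ≠ ∞) : ∀ᶠ z in 𝓝 y, IsMetricAt k g z := by
  have hsmooth : ∀ᶠ z in 𝓝 y, ∀ i j, ContDiffAt ℝ k (fun z => g z i j) z :=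
    eventually_all.2 fun i => eventually_all.2 fun j => (hg.smooth i j).eventually hk
  filter_upwards [hsmooth, eventually_det_ne_zero hg.smooth hg.det_ne] with z hz hdet
  exact ⟨hg.symm, hz, hdet⟩

theorem contDiffAt_inv (hg : IsMetricAt k g y) (i j : Fin (n + 1)) :
    ContDiffAt ℝ k (fun z => inv g z i j) y :=
  EYM.contDiffAt_inv hg.smooth hg.det_ne i j

theorem differentiableAt_inv (hg : IsMetricAt k g y) (hk : 1 ≤ k) (i j : Fin (n + 1)) :
    DifferentiableAt ℝ (fun z => inv g z i j) y :=
  ((hg.contDiffAt_inv i j).of_le hk).differentiableAt one_ne_zero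

theorem contDiffAt_christoffel {m : ℕ∞ω} (hg : IsMetricAt k g y) (hm : m + 1 ≤ k)
    (a i j : Fin (n + 1)) : ContDiffAt ℝ m (fun z => christoffel g z a i j) y :=
  contDiffAt_const.mul <| ContDiffAt.sum fun l _ =>
    ((hg.contDiffAt_inv a l).of_le (le_self_add.trans hm)).mul <|
      ((contDiffAt_pd (hg.smooth _ _) hm i).add (contDiffAt_pd (hg.smooth _ _) hm j)).sub
        (contDiffAt_pd (hg.smooth _ _) hm l)

theorem differentiableAt_christoffel (hg : IsMetricAt 2 g y) (m i j : Fin (n + 1)) :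
    DifferentiableAt ℝ (fun z => christoffel g z m i j) y :=
  (hg.contDiffAt_christoffel (m := 1) le_rfl m i j).differentiableAt one_ne_zero

theorem sum_mul_christoffel (hg : IsMetricAt k g y) (l i j : Fin (n + 1)) :
    ∑ m, g y l m * christoffel g y m i j = (1 / 2 : ℝ) *
      (pd i (fun z => g z j l) y + pd j (fun z => g z i l) y - pd l (fun z => g z i j) y) := by
  simp only [christoffel, mul_left_comm _ (1 / 2 : ℝ), ← Finset.mul_sum]
  rw [sum_mul_sum_inv_mul hg.det_ne]

theorem pd_metric (hg : IsMetricAt k g y) (i j l : Fin (n + 1)) :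
    pd i (fun z => g z j l) y = ∑ m, christoffel g y m i j * g y m l
      + ∑ m, christoffel g y m i l * g y j m := by
  simp only [mul_comm (christoffel _ _ _ _ _), hg.symm y _ l, hg.sum_mul_christoffel,
    fun z => hg.symm z l j]
  ring

theorem cov2_self (hg : IsMetricAt k g y) (i j l : Fin (n + 1)) : cov2 g g y i j l = 0 := by
  simp only [cov2, smul_eq_mul, hg.pd_metric i j l]
  ring

theorem pdMatrix_eq (hg : IsMetricAt k g y) (i : Fin (n + 1)) :
    pdMatrix i g y = (christoffelMatrix g y i).transpose * Matrix.of (g y)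
      + Matrix.of (g y) * christoffelMatrix g y i := by
  ext j l
  simp only [pdMatrix, christoffelMatrix, Matrix.of_apply, hg.pd_metric i j l, Matrix.add_apply,
    Matrix.mul_apply, Matrix.transpose_apply, mul_comm]

theorem pd_inv (hg : IsMetricAt k g y) (hk : 1 ≤ k) (i a b : Fin (n + 1)) :
    pd i (fun z => inv g z a b) y = -∑ m, christoffel g y a i m * inv g y m b
      - ∑ m, christoffel g y b i m * inv g y a m := by
  have hu := isUnit_iff_ne_zero.2 hg.det_ne
  have hM := pdMatrix_inv (fun i j => (hg.smooth i j).of_le hk) hg.det_ne i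
  rw [hg.pdMatrix_eq, mul_add, add_mul, ← mul_assoc, Matrix.mul_nonsing_inv_cancel_right _ _ hu,
    Matrix.nonsing_inv_mul_cancel_left _ _ hu, neg_add_rev, ← sub_eq_add_neg] at hM
  have h := congrFun (congrFun hM a) b
  simp only [pdMatrix, christoffelMatrix, Matrix.of_apply, Matrix.neg_apply, Matrix.sub_apply,
    Matrix.mul_apply, Matrix.transpose_apply] at h
  rw [h]
  simp only [inv, mul_comm]

end IsMetricAt

end Metric

section Identities

variable {n : ℕ} {F : Type*} [NormedAddCommGroup F] [NormedSpace ℝ F] {g h : Cov2 n ℝ} {y : Vec n}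

theorem cov1_add {a b : Cov1 n F} (ha : ∀ i, DifferentiableAt ℝ (fun z => a z i) y)
    (hb : ∀ i, DifferentiableAt ℝ (fun z => b z i) y) (i j : Fin (n + 1)) :
    cov1 g (a + b) y i j = cov1 g a y i j + cov1 g b y i j := by
  simp only [cov1, Pi.add_apply, pd_add (ha j) (hb j), smul_add, Finset.sum_add_distrib]
  abel

theorem cov1_smul (g : Cov2 n ℝ) (c : ℝ) (a : Cov1 n F) : cov1 g (c • a) = c • cov1 g a := by
  funext y i j
  simp only [cov1, Pi.smul_apply, pd_const_smul, smul_sub, Finset.smul_sum, smul_comm c]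

theorem cov1_congr {a b : Cov1 n F} (hab : ∀ᶠ z in 𝓝 y, a z = b z) (i j : Fin (n + 1)) :
    cov1 g a y i j = cov1 g b y i j := by
  simp only [cov1, pd_congr (hab.mono fun _ hz => congrFun hz j), hab.self_of_nhds]

theorem cov1_pd_comm (hs : ∀ z i j, g z i j = g z j i) {f : Vec n → F} (hf : ContDiffAt ℝ 2 f y)
    (i j : Fin (n + 1)) :
    cov1 g (fun z m => pd m f z) y i j = cov1 g (fun z m => pd m f z) y j i := by
  simp only [cov1, fun m => christoffel_symm hs y m i j]
  rw [pd_comm hf]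

namespace IsMetricAt

variable {k : ℕ∞ω}

theorem pd_sharp (hg : IsMetricAt k g y) (hk : 1 ≤ k) {v : Cov1 n ℝ}
    (hv : ∀ a, DifferentiableAt ℝ (fun z => v z a) y) (i b : Fin (n + 1)) :
    pd i (fun z => sharp g v z b) y = ∑ a, inv g y b a * cov1 g v y i a
      - ∑ m, christoffel g y b i m * sharp g v y m := by
  simp only [sharp]
  rw [pd_sum_mul _ (hg.differentiableAt_inv hk b) hv]
  simp only [hg.pd_inv hk, cov1, smul_eq_mul, sub_mul, neg_mul, mul_sub,
    Finset.sum_sub_distrib, Finset.sum_neg_distrib, Finset.sum_mul, Finset.mul_sum]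
  have upper : ∑ a, ∑ m, christoffel g y b i m * inv g y m a * v y a
      = ∑ m, ∑ a, christoffel g y b i m * (inv g y m a * v y a) := by
    rw [Finset.sum_comm]
    simp only [mul_assoc]
  have lower : ∑ a, ∑ m, christoffel g y a i m * inv g y b m * v y a
      = ∑ a, ∑ m, inv g y b a * (christoffel g y m i a * v y m) := by
    rw [Finset.sum_comm]
    exact Finset.sum_congr rfl fun _ _ => Finset.sum_congr rfl fun _ _ => by ring
  rw [upper, lower]
  ring

theorem pd_trace (hg : IsMetricAt k g y) (hk : 1 ≤ k)
    (hh : ∀ a b, DifferentiableAt ℝ (fun z => h z a b) y) (i : Fin (n + 1)) :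
    pd i (trace g h) y = ∑ a, ∑ b, inv g y a b * cov2 g h y i a b := by
  have hG := hg.differentiableAt_inv hk
  rw [show trace g h = fun z => ∑ a, ∑ b, inv g z a b * h z a b from rfl,
    pd_sum _ fun a _ => DifferentiableAt.fun_sum fun b _ => (hG a b).fun_mul (hh a b)]
  simp only [fun a => pd_sum_mul Finset.univ (hG a) (hh a) i, hg.pd_inv hk, cov2, smul_eq_mul,
    sub_mul, neg_mul, mul_sub, Finset.sum_sub_distrib, Finset.sum_neg_distrib,
    Finset.sum_add_distrib, Finset.sum_mul, Finset.mul_sum]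
  have first : ∑ a, ∑ b, ∑ m, christoffel g y a i m * inv g y m b * h y a b
      = ∑ a, ∑ b, ∑ m, inv g y a b * (christoffel g y m i a * h y m b) := by
    rw [Finset.sum_comm]
    conv_rhs => rw [Finset.sum_comm]
    refine Finset.sum_congr rfl fun b _ => ?_
    rw [Finset.sum_comm]
    exact Finset.sum_congr rfl fun _ _ => Finset.sum_congr rfl fun _ _ => by ring
  have second : ∑ a, ∑ b, ∑ m, christoffel g y b i m * inv g y a m * h y a b
      = ∑ a, ∑ b, ∑ m, inv g y a b * (christoffel g y m i b * h y a m) := by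
    refine Finset.sum_congr rfl fun a _ => ?_
    rw [Finset.sum_comm]
    exact Finset.sum_congr rfl fun _ _ => Finset.sum_congr rfl fun _ _ => by ring
  rw [first, second]
  ring

theorem lieDeriv_sharp (hg : IsMetricAt k g y) (hk : 1 ≤ k) {v : Cov1 n ℝ}
    (hv : ∀ a, DifferentiableAt ℝ (fun z => v z a) y) (i j : Fin (n + 1)) :
    lieDeriv (sharp g v) g y i j = 2 * deltaStar g v y i j := by
  have swap : ∀ i j, ∑ b, ∑ m, sharp g v y b * (christoffel g y m b i * g y j m)
      = ∑ b, ∑ m, g y j b * (christoffel g y b i m * sharp g v y m) := fun i j => by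
    rw [Finset.sum_comm]
    exact Finset.sum_congr rfl fun b _ => Finset.sum_congr rfl fun m _ => by
      rw [christoffel_symm hg.symm y b m i]; ring
  simp only [lieDeriv, deltaStar, hg.pd_sharp hk hv, hg.pd_metric, Finset.sum_add_distrib, mul_sub,
    Finset.sum_sub_distrib]
  simp only [fun b => hg.symm y b j, sum_mul_sum_inv_mul hg.det_ne]
  simp only [mul_add, Finset.sum_add_distrib, Finset.mul_sum, swap]
  ring

theorem contDiffAt_cov2 (hg : IsMetricAt k g y) {m : ℕ∞ω} (hm : m + 1 ≤ k)
    (hh : ∀ i j, ContDiffAt ℝ (m + 1) (fun z => h z i j) y) (i j l : Fin (n + 1)) :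
    ContDiffAt ℝ m (fun z => cov2 g h z i j l) y := by
  have hh' : ∀ i j, ContDiffAt ℝ m (fun z => h z i j) y := fun i j => (hh i j).of_le le_self_add
  exact ((contDiffAt_pd (hh _ _) le_rfl i).sub (ContDiffAt.sum fun a _ =>
    (hg.contDiffAt_christoffel hm _ _ _).smul (hh' _ _))).sub (ContDiffAt.sum fun a _ =>
    (hg.contDiffAt_christoffel hm _ _ _).smul (hh' _ _))

theorem differentiableAt_cov2 (hg : IsMetricAt 2 g y)
    (hh : ∀ i j, ContDiffAt ℝ 2 (fun z => h z i j) y) (i j l : Fin (n + 1)) :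
    DifferentiableAt ℝ (fun z => cov2 g h z i j l) y :=
  (hg.contDiffAt_cov2 (m := 1) le_rfl hh i j l).differentiableAt one_ne_zero

theorem contDiffAt_trace (hg : IsMetricAt k g y)
    (hh : ∀ i j, ContDiffAt ℝ k (fun z => h z i j) y) : ContDiffAt ℝ k (trace g h) y :=
  ContDiffAt.sum fun _ _ => ContDiffAt.sum fun _ _ => (hg.contDiffAt_inv _ _).mul (hh _ _)

end IsMetricAt

end Identities

section Riemann

variable {n : ℕ} {g h : Cov2 n ℝ} {y : Vec n}

theorem of_cov2 (g h : Cov2 n ℝ) (y : Vec n) (i : Fin (n + 1)) :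
    Matrix.of (cov2 g h y i) = pdMatrix i h y
      - (christoffelMatrix g y i).transpose * Matrix.of (h y)
      - Matrix.of (h y) * christoffelMatrix g y i := by
  ext j l
  simp only [pdMatrix, Matrix.of_apply, cov2, Matrix.sub_apply, Matrix.mul_apply,
    Matrix.transpose_apply, christoffelMatrix, smul_eq_mul]
  simp only [mul_comm]

theorem of_cov3 (g : Cov2 n ℝ) (T : Cov3 n ℝ) (y : Vec n) (i l : Fin (n + 1)) :
    Matrix.of (cov3 g T y i l) = pdMatrix i (fun z => T z l) y
      - ∑ m, christoffel g y m i l • Matrix.of (T y m)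
      - (christoffelMatrix g y i).transpose * Matrix.of (T y l)
      - Matrix.of (T y l) * christoffelMatrix g y i := by
  ext j a
  simp only [pdMatrix, Matrix.of_apply, cov3, Matrix.sub_apply, Matrix.mul_apply,
    Matrix.transpose_apply, christoffelMatrix, Matrix.sum_apply, Matrix.smul_apply, smul_eq_mul]
  congr 1
  exact Finset.sum_congr rfl fun _ _ => mul_comm _ _

theorem of_curv (g : Cov2 n ℝ) (y : Vec n) (i l : Fin (n + 1)) :
    Matrix.of (fun m j => curv g y m j i l) =
      pdMatrix i (fun z => christoffelMatrix g z l) y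
      - pdMatrix l (fun z => christoffelMatrix g z i) y
      + christoffelMatrix g y i * christoffelMatrix g y l
      - christoffelMatrix g y l * christoffelMatrix g y i := by
  ext m j
  simp only [pdMatrix, Matrix.of_apply, curv, Matrix.sub_apply, Matrix.add_apply,
    Matrix.mul_apply, christoffelMatrix, Finset.sum_sub_distrib]
  ring

theorem pdMatrix_cov2 (hg : IsMetricAt 2 g y) (hh : ∀ i j, ContDiffAt ℝ 2 (fun z => h z i j) y)
    (i l : Fin (n + 1)) :
    pdMatrix i (fun z => cov2 g h z l) y =
      pdMatrix i (fun z => pdMatrix l h z) y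
      - (pdMatrix i (fun z => christoffelMatrix g z l) y).transpose * Matrix.of (h y)
      - (christoffelMatrix g y l).transpose * pdMatrix i h y
      - Matrix.of (h y) * pdMatrix i (fun z => christoffelMatrix g z l) y
      - pdMatrix i h y * christoffelMatrix g y l := by
  ext j a
  have hΓ := hg.differentiableAt_christoffel
  have hd : ∀ i j, DifferentiableAt ℝ (fun z => h z i j) y := fun i j =>
    (hh i j).differentiableAt two_ne_zero
  have hp : DifferentiableAt ℝ (fun z => pd l (fun w => h w j a) z) y :=
    differentiableAt_pd (hh j a) l
  have h1 : DifferentiableAt ℝ (fun z => ∑ m, christoffel g z m l j * h z m a) y :=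
    DifferentiableAt.fun_sum fun m _ => (hΓ _ _ _).fun_mul (hd _ _)
  have h2 : DifferentiableAt ℝ (fun z => ∑ m, christoffel g z m l a * h z j m) y :=
    DifferentiableAt.fun_sum fun m _ => (hΓ _ _ _).fun_mul (hd _ _)
  simp only [pdMatrix, Matrix.of_apply, cov2, smul_eq_mul]
  rw [pd_sub (hp.fun_sub h1) h2, pd_sub hp h1,
    pd_sum_mul _ (fun m => hΓ m l j) (fun m => hd m a),
    pd_sum_mul _ (fun m => hΓ m l a) (fun m => hd j m)]
  simp only [Matrix.sub_apply, Matrix.mul_apply, Matrix.transpose_apply, christoffelMatrix,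
    Matrix.of_apply]
  simp only [mul_comm]
  ring

theorem riem_swap_right (g : Cov2 n ℝ) (y : Vec n) (i j k l : Fin (n + 1)) :
    riem g y i j k l = -riem g y i j l k := by
  simp only [riem, curv, Finset.sum_sub_distrib, ← Finset.sum_neg_distrib]
  exact Finset.sum_congr rfl fun _ _ => by ring

theorem riem_bianchi (hs : ∀ z i j, g z i j = g z j i) (y : Vec n) (a j b l : Fin (n + 1)) :
    riem g y a j b l + riem g y a b l j + riem g y a l j b = 0 := by
  have hΓ := christoffel_symm hs
  simp only [riem, ← Finset.sum_add_distrib, ← mul_add]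
  refine Finset.sum_eq_zero fun m _ => ?_
  have : curv g y m j b l + curv g y m b l j + curv g y m l j b = 0 := by
    simp only [curv, Finset.sum_sub_distrib, fun z => hΓ z m l j, fun z => hΓ z m b j,
      fun z => hΓ z m l b, fun c => hΓ y c l j, fun c => hΓ y c b j, fun c => hΓ y c l b]
    ring
  rw [this, mul_zero]

namespace IsMetricAt

theorem ricci_identity (hg : IsMetricAt 2 g y) (hh : ∀ i j, ContDiffAt ℝ 2 (fun z => h z i j) y)
    (i l j a : Fin (n + 1)) :
    cov3 g (cov2 g h) y i l j a - cov3 g (cov2 g h) y l i j a =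
      -∑ m, curv g y m j i l * h y m a - ∑ m, curv g y m a i l * h y j m := by
  have hcomm : pdMatrix i (fun z => pdMatrix l h z) y = pdMatrix l (fun z => pdMatrix i h z) y :=
    Matrix.ext fun j a => pd_comm (hh j a) i l
  have hM : Matrix.of (cov3 g (cov2 g h) y i l) - Matrix.of (cov3 g (cov2 g h) y l i) =
      -((Matrix.of (fun m j => curv g y m j i l)).transpose * Matrix.of (h y))
        - Matrix.of (h y) * Matrix.of (fun m j => curv g y m j i l) := by
    rw [of_cov3, of_cov3, pdMatrix_cov2 hg hh i l, pdMatrix_cov2 hg hh l i, of_curv, of_cov2,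
      of_cov2, hcomm]
    simp only [fun m => christoffel_symm hg.symm y m l i, Matrix.transpose_sub,
      Matrix.transpose_add, Matrix.transpose_mul]
    noncomm_ring
  have hja := congrFun (congrFun hM j) a
  simp only [Matrix.of_apply, Matrix.neg_apply, Matrix.sub_apply, Matrix.mul_apply,
    Matrix.transpose_apply] at hja
  rw [hja]
  simp only [mul_comm]

theorem riem_swap_left (hg : IsMetricAt 2 g y) (a j b l : Fin (n + 1)) :
    riem g y a j b l = -riem g y j a b l := by
  have hcov2 : ∀ i j l, (fun z => cov2 g g z i j l) =ᶠ[𝓝 y] fun _ => 0 := fun i j l => by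
    filter_upwards [hg.eventually (by simp)] with z hz using hz.cov2_self i j l
  have hcov3 : ∀ i l j a, cov3 g (cov2 g g) y i l j a = 0 := fun i l j a => by
    simp only [cov3, hg.cov2_self, pd_congr (hcov2 l j a), pd_const]
    simp
  have h := hg.ricci_identity hg.smooth b l j a
  rw [hcov3, hcov3] at h
  simp only [riem]
  simp only [mul_comm (curv _ _ _ _ _ _), hg.symm y _ a] at h
  linarith

/-- The octahedron argument: the four Bianchi identities on the indices `a j b l` combine, by the
antisymmetries in each pair, to the pair symmetry. -/
theorem riem_pair (hg : IsMetricAt 2 g y) (a j b l : Fin (n + 1)) :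
    riem g y a j b l = riem g y b l a j := by
  have hL := hg.riem_swap_left
  have hR := riem_swap_right g y
  have hB := riem_bianchi hg.symm y
  linarith [hB a j b l, hB j b l a, hB b l a j, hB l a j b,
    hL a j b l, hL a b l j, hL a l j b, hL j b l a, hL j l a b, hL j a b l, hL b l a j,
    hL b a j l, hL b j l a, hL l a j b, hL l j b a, hL l b a j, hR a j b l, hR a b l j, hR a l j b,
    hR j b l a, hR j l a b, hR j a b l, hR b l a j, hR b a j l, hR b j l a, hR l a j b, hR l j b a,
    hR l b a j]

theorem curv_eq_sum_riem {k : ℕ∞ω} (hg : IsMetricAt k g y) (a j b l : Fin (n + 1)) :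
    curv g y a j b l = ∑ p, inv g y a p * riem g y p j b l :=
  (sum_inv_mul_sum_mul hg.det_ne (fun m => curv g y m j b l) a).symm

theorem ricci_eq_sum_riem {k : ℕ∞ω} (hg : IsMetricAt k g y) (j l : Fin (n + 1)) :
    ricci g y j l = ∑ i, ∑ p, inv g y i p * riem g y p j i l := by
  simp only [ricci, hg.curv_eq_sum_riem]

theorem ricci_symm (hg : IsMetricAt 2 g y) (j l : Fin (n + 1)) :
    ricci g y j l = ricci g y l j := by
  rw [hg.ricci_eq_sum_riem, hg.ricci_eq_sum_riem, Finset.sum_comm]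
  exact Finset.sum_congr rfl fun i _ => Finset.sum_congr rfl fun p _ => by
    rw [inv_symm (hg.symm y) p i, hg.riem_pair i j p l]

theorem riemAct_symm (hg : IsMetricAt 2 g y) (hs : ∀ i j, h y i j = h y j i)
    (j l : Fin (n + 1)) : riemAct g h y j l = riemAct g h y l j := by
  simp only [riemAct]
  rw [Finset.sum_comm]
  refine Finset.sum_congr rfl fun i _ => Finset.sum_congr rfl fun p _ => ?_
  rw [hg.riem_pair p j i l]
  congr 1
  rw [Finset.sum_comm]
  exact Finset.sum_congr rfl fun a _ => Finset.sum_congr rfl fun b _ => by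
    rw [hs b a]; ring

theorem sum_inv_mul_curv (hg : IsMetricAt 2 g y) (m l : Fin (n + 1)) :
    ∑ i, ∑ b, inv g y i b * curv g y m b i l = -∑ p, inv g y m p * ricci g y p l := by
  calc ∑ i, ∑ b, inv g y i b * curv g y m b i l
      = ∑ i, ∑ b, ∑ p, -(inv g y m p * (inv g y i b * riem g y b p i l)) := by
        refine Finset.sum_congr rfl fun i _ => Finset.sum_congr rfl fun b _ => ?_
        rw [hg.curv_eq_sum_riem, Finset.mul_sum]
        exact Finset.sum_congr rfl fun p _ => by rw [hg.riem_swap_left p b]; ring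
    _ = ∑ i, ∑ p, ∑ b, -(inv g y m p * (inv g y i b * riem g y b p i l)) :=
        Finset.sum_congr rfl fun i _ => Finset.sum_comm
    _ = ∑ p, ∑ i, ∑ b, -(inv g y m p * (inv g y i b * riem g y b p i l)) := Finset.sum_comm
    _ = -∑ p, inv g y m p * ricci g y p l := by
        simp only [hg.ricci_eq_sum_riem, Finset.mul_sum, Finset.sum_neg_distrib]

theorem sum_inv_mul_curv_mul {k : ℕ∞ω} (hg : IsMetricAt k g y) (h : Cov2 n ℝ)
    (j l : Fin (n + 1)) :
    ∑ i, ∑ b, inv g y i b * ∑ m, curv g y m j i l * h y m b = riemAct g h y j l := by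
  simp only [riemAct, hg.curv_eq_sum_riem, Finset.mul_sum, Finset.sum_mul]
  rw [Finset.sum_comm (s := Finset.univ (α := Fin (n + 1))) (t := Finset.univ)
    (f := fun i c => ∑ a, ∑ b, riem g y i j c l * (inv g y i a * inv g y c b * h y a b))]
  refine Finset.sum_congr rfl fun i _ => ?_
  rw [Finset.sum_comm]
  calc _ = ∑ m, ∑ p, ∑ b, inv g y i b * (inv g y m p * riem g y p j i l * h y m b) :=
        Finset.sum_congr rfl fun m _ => Finset.sum_comm
    _ = _ := by
        rw [Finset.sum_comm]
        exact Finset.sum_congr rfl fun p _ => Finset.sum_congr rfl fun m _ =>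
          Finset.sum_congr rfl fun b _ => by rw [inv_symm (hg.symm y) m p]; ring

theorem contraction_ricci_identity (hg : IsMetricAt 2 g y) (hs : ∀ i j, h y i j = h y j i)
    (hh : ∀ i j, ContDiffAt ℝ 2 (fun z => h z i j) y) (j l : Fin (n + 1)) :
    ∑ i, ∑ b, inv g y i b * (cov3 g (cov2 g h) y i l j b - cov3 g (cov2 g h) y l i j b) =
      ∑ c, ∑ m, inv g y c m * (ricci g y l c * h y m j) - riemAct g h y j l := by
  have hRic : ∑ i, ∑ b, inv g y i b * ∑ m, curv g y m b i l * h y j m =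
      -∑ c, ∑ m, inv g y c m * (ricci g y l c * h y m j) := by
    calc ∑ i, ∑ b, inv g y i b * ∑ m, curv g y m b i l * h y j m
        = ∑ m, (∑ i, ∑ b, inv g y i b * curv g y m b i l) * h y j m := by
          simp only [Finset.mul_sum, Finset.sum_mul, mul_assoc]
          exact (Finset.sum_congr rfl fun i _ => Finset.sum_comm).trans Finset.sum_comm
      _ = -∑ c, ∑ m, inv g y c m * (ricci g y l c * h y m j) := by
          simp only [hg.sum_inv_mul_curv, neg_mul, Finset.sum_neg_distrib, Finset.sum_mul]
          rw [Finset.sum_comm]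
          refine congrArg _ (Finset.sum_congr rfl fun c _ => Finset.sum_congr rfl fun m _ => ?_)
          rw [inv_symm (hg.symm y) m c, hg.ricci_symm c l, hs j m, mul_assoc]
  simp only [hg.ricci_identity hh, mul_sub, mul_neg, Finset.sum_sub_distrib,
    Finset.sum_neg_distrib, hg.sum_inv_mul_curv_mul, hRic]
  ring

end IsMetricAt

end Riemann

section RicciVariation

variable {n : ℕ} {g h : Cov2 n ℝ} {y : Vec n}

/-- `(1/2) (∇_i h_{jl} + ∇_j h_{il} - ∇_l h_{ij})` (arguments `i j l`). Raising `l` with the metric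
`g + h` gives the difference of the Christoffel symbols of `g + h` and `g`. -/
noncomputable def christoffelVar (g h : Cov2 n ℝ) : Cov3 n ℝ := fun y i j l =>
  (1 / 2 : ℝ) * (cov2 g h y i j l + cov2 g h y j i l - cov2 g h y l i j)

/-- `G^{al} D_{ijl}` (arguments `a i j`). -/
noncomputable def raiseLast (G : Cov2 n ℝ) (D : Cov3 n ℝ) : Cov3 n ℝ := fun y a i j =>
  ∑ l, G y a l * D y i j l

/-- `∇_i C^i_{lj} - ∇_l C^i_{ij}` for the torsion-free connection with symbols `Γ`, i.e. the part of
the Ricci tensor of `Γ + C` which is linear in `C`. -/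
noncomputable def ricciPolar (Γ C : Cov3 n ℝ) : Cov2 n ℝ := fun y j l =>
  ∑ i, (pd i (fun z => C z i l j) y - pd l (fun z => C z i i j) y
    + ∑ m, (Γ y i i m * C y m l j + C y i i m * Γ y m l j
      - Γ y i l m * C y m i j - C y i l m * Γ y m i j))

/-- The derivative of the Ricci tensor at `g` in the direction `h`. -/
noncomputable def ricciVar (g h : Cov2 n ℝ) : Cov2 n ℝ :=
  ricciPolar (christoffel g) (raiseLast (inv g) (christoffelVar g h))

theorem ricci_add {C : Cov3 n ℝ} {g g' : Cov2 n ℝ}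
    (hΓ : ∀ᶠ z in 𝓝 y, ∀ a i j, christoffel g' z a i j = christoffel g z a i j + C z a i j)
    (hg : ∀ a i j, DifferentiableAt ℝ (fun z => christoffel g z a i j) y)
    (hC : ∀ a i j, DifferentiableAt ℝ (fun z => C z a i j) y) (j l : Fin (n + 1)) :
    ricci g' y j l = ricci g y j l + ricciPolar (christoffel g) C y j l
      + ∑ i, ∑ m, (C y i i m * C y m l j - C y i l m * C y m i j) := by
  have hpd : ∀ b a i j, pd b (fun z => christoffel g' z a i j) y =
      pd b (fun z => christoffel g z a i j) y + pd b (fun z => C z a i j) y := fun b a i j => by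
    rw [← pd_add (hg a i j) (hC a i j)]
    exact pd_congr (hΓ.mono fun z hz => hz a i j) b
  simp only [ricci, curv, ricciPolar, hpd, hΓ.self_of_nhds, ← Finset.sum_add_distrib]
  refine Finset.sum_congr rfl fun i _ => ?_
  simp only [add_mul, mul_add, Finset.sum_add_distrib, Finset.sum_sub_distrib]
  ring

namespace IsMetricAt

variable {k : ℕ∞ω}

theorem sum_mul_christoffel_add (hg : IsMetricAt 1 g y) (hs : ∀ i j, h y i j = h y j i)
    (hh : ∀ i j, DifferentiableAt ℝ (fun z => h z i j) y) (l i j : Fin (n + 1)) :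
    ∑ m, (g + h) y l m * christoffel g y m i j + christoffelVar g h y i j l =
      (1 / 2 : ℝ) * (pd i (fun z => (g + h) z j l) y + pd j (fun z => (g + h) z i l) y
        - pd l (fun z => (g + h) z i j) y) := by
  have hgd : ∀ i j, DifferentiableAt ℝ (fun z => g z i j) y := fun i j =>
    (hg.smooth i j).differentiableAt one_ne_zero
  simp only [Pi.add_apply, add_mul, Finset.sum_add_distrib, hg.sum_mul_christoffel,
    christoffelVar, cov2, smul_eq_mul, pd_add (hgd _ _) (hh _ _),
    christoffel_symm hg.symm y _ j i, christoffel_symm hg.symm y _ l i,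
    christoffel_symm hg.symm y _ l j, fun m => hs j m, fun m => hs l m,
    fun m => mul_comm (h y m l)]
  ring

theorem christoffel_add (hg : IsMetricAt 1 g y) (hgh : IsMetricAt 1 (g + h) y)
    (a i j : Fin (n + 1)) : christoffel (g + h) y a i j =
      christoffel g y a i j + raiseLast (inv (g + h)) (christoffelVar g h) y a i j := by
  have hs : ∀ i j, h y i j = h y j i := fun i j => by
    simpa only [Pi.add_apply, hg.symm y i j, add_right_inj] using hgh.symm y i j
  have hh : ∀ i j, DifferentiableAt ℝ (fun z => h z i j) y := fun i j => by
    simpa using ((hgh.smooth i j).differentiableAt one_ne_zero).fun_sub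
      ((hg.smooth i j).differentiableAt one_ne_zero)
  calc christoffel (g + h) y a i j
      = ∑ l, inv (g + h) y a l * ((1 / 2 : ℝ) * (pd i (fun z => (g + h) z j l) y
          + pd j (fun z => (g + h) z i l) y - pd l (fun z => (g + h) z i j) y)) := by
        simp only [christoffel, Finset.mul_sum, mul_left_comm]
    _ = ∑ l, inv (g + h) y a l * (∑ m, (g + h) y l m * christoffel g y m i j
          + christoffelVar g h y i j l) := by simp only [hg.sum_mul_christoffel_add hs hh]
    _ = christoffel g y a i j + raiseLast (inv (g + h)) (christoffelVar g h) y a i j := by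
        simp only [mul_add, Finset.sum_add_distrib, sum_inv_mul_sum_mul hgh.det_ne, raiseLast]

theorem cov1_trace (hg : IsMetricAt k g y) (hk : 1 ≤ k) {T : Cov3 n ℝ}
    (hT : ∀ a b j, DifferentiableAt ℝ (fun z => T z a b j) y) (l j : Fin (n + 1)) :
    cov1 g (fun z j => trace g (fun w i b => T w b i j) z) y l j =
      ∑ i, ∑ b, inv g y i b * cov3 g T y l b i j := by
  have hcov3 : ∀ i b, cov3 g T y l b i j = cov2 g (fun z i b => T z b i j) y l i b
      - ∑ m, christoffel g y m l j * T y b i m := fun i b => by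
    simp only [cov3, cov2, smul_eq_mul]
    ring
  have hΓ : ∑ m, christoffel g y m l j * trace g (fun w i b => T w b i m) y =
      ∑ i, ∑ b, inv g y i b * ∑ m, christoffel g y m l j * T y b i m := by
    simp only [trace, Finset.mul_sum, mul_left_comm (christoffel g y _ l j)]
    rw [Finset.sum_comm]
    exact Finset.sum_congr rfl fun _ _ => Finset.sum_comm
  simp only [cov1, hg.pd_trace hk (fun a b => hT b a j), smul_eq_mul, hΓ, hcov3, mul_sub,
    Finset.sum_sub_distrib]

theorem differentiableAt_pd_trace (hg : IsMetricAt 2 g y)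
    (hh : ∀ i j, ContDiffAt ℝ 2 (fun z => h z i j) y) (i : Fin (n + 1)) :
    DifferentiableAt ℝ (fun z => pd i (trace g h) z) y :=
  differentiableAt_pd (hg.contDiffAt_trace hh) i

theorem differentiableAt_trace_cov2 (hg : IsMetricAt 2 g y)
    (hh : ∀ i j, ContDiffAt ℝ 2 (fun z => h z i j) y) (j : Fin (n + 1)) :
    DifferentiableAt ℝ (trace g fun z i b => cov2 g h z b i j) y :=
  DifferentiableAt.fun_sum fun _ _ => DifferentiableAt.fun_sum fun _ _ =>
    (hg.differentiableAt_inv one_le_two _ _).fun_mul (hg.differentiableAt_cov2 hh _ _ _)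

theorem differentiableAt_bianchi (hg : IsMetricAt 2 g y)
    (hh : ∀ i j, ContDiffAt ℝ 2 (fun z => h z i j) y) (j : Fin (n + 1)) :
    DifferentiableAt ℝ (fun z => bianchi g h z j) y :=
  (hg.differentiableAt_trace_cov2 hh j).fun_neg.fun_add
    ((hg.differentiableAt_pd_trace hh j).const_mul _)

theorem cov1_bianchi (hg : IsMetricAt 2 g y)
    (hh : ∀ i j, ContDiffAt ℝ 2 (fun z => h z i j) y) (l j : Fin (n + 1)) :
    cov1 g (bianchi g h) y l j = -∑ i, ∑ b, inv g y i b * cov3 g (cov2 g h) y l b i j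
      + (1 / 2 : ℝ) * cov1 g (fun z m => pd m (trace g h) z) y l j := by
  have hdiv := hg.differentiableAt_trace_cov2 hh
  have htr := hg.differentiableAt_pd_trace hh
  have hbianchi : bianchi g h = (-1 : ℝ) • (fun z j => trace g (fun w i b => cov2 g h w b i j) z)
      + (1 / 2 : ℝ) • (fun z m => pd m (trace g h) z) := by
    funext z j
    simp only [bianchi, divergence, Pi.add_apply, Pi.smul_apply, smul_eq_mul, neg_one_mul, trace]
  rw [hbianchi, cov1_add (a := (-1 : ℝ) • _) (b := (1 / 2 : ℝ) • _)
    (fun i => (hdiv i).const_mul _) (fun i => (htr i).const_mul _), cov1_smul, cov1_smul]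
  simp only [Pi.smul_apply, smul_eq_mul, neg_one_mul,
    hg.cov1_trace one_le_two (hg.differentiableAt_cov2 hh)]

theorem divergence_raiseLast (hg : IsMetricAt k g y) (hk : 1 ≤ k) {D : Cov3 n ℝ}
    (hD : ∀ i j l, DifferentiableAt ℝ (fun z => D z i j l) y) (j l : Fin (n + 1)) :
    ∑ i, (pd i (fun z => raiseLast (inv g) D z i l j) y
      + ∑ m, (christoffel g y i i m * raiseLast (inv g) D y m l j
        - christoffel g y i l m * raiseLast (inv g) D y m i j
        - raiseLast (inv g) D y i l m * christoffel g y m i j)) =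
      ∑ i, ∑ b, inv g y i b * cov3 g D y i l j b := by
  have hpd : ∀ i, pd i (fun z => raiseLast (inv g) D z i l j) y =
      ∑ b, inv g y i b * cov1 g (fun z b => D z l j b) y i b
        - ∑ m, christoffel g y i i m * raiseLast (inv g) D y m l j := fun i =>
    hg.pd_sharp hk (v := fun z b => D z l j b) (hD l j) i i
  have hcov3 : ∀ i b, cov3 g D y i l j b = cov1 g (fun z b => D z l j b) y i b
      - ∑ m, christoffel g y m i l * D y m j b - ∑ m, christoffel g y m i j * D y l m b :=
    fun i b => by
      simp only [cov3, cov1, smul_eq_mul]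
      ring
  have second : ∀ i, ∑ b, inv g y i b * ∑ m, christoffel g y m i l * D y m j b =
      ∑ m, christoffel g y m i l * raiseLast (inv g) D y i m j := fun i => by
    simp only [raiseLast, Finset.mul_sum, mul_left_comm (inv g y i _)]
    exact Finset.sum_comm
  have third : ∀ i, ∑ b, inv g y i b * ∑ m, christoffel g y m i j * D y l m b =
      ∑ m, raiseLast (inv g) D y i l m * christoffel g y m i j := fun i => by
    simp only [raiseLast, Finset.mul_sum, mul_left_comm (inv g y i _),
      mul_comm _ (christoffel g y _ i j)]
    exact Finset.sum_comm
  have lower : ∑ i, ∑ m, christoffel g y i l m * raiseLast (inv g) D y m i j =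
      ∑ i, ∑ m, christoffel g y m i l * raiseLast (inv g) D y i m j := by
    rw [Finset.sum_comm]
    simp only [fun m i => christoffel_symm hg.symm y m l i]
  simp only [hpd, hcov3, mul_sub, Finset.sum_sub_distrib, Finset.sum_add_distrib, second, third,
    lower]
  ring

theorem differentiableAt_raiseLast (hg : IsMetricAt k g y) (hk : 1 ≤ k) {D : Cov3 n ℝ}
    (hD : ∀ i j l, DifferentiableAt ℝ (fun z => D z i j l) y) (a i j : Fin (n + 1)) :
    DifferentiableAt ℝ (fun z => raiseLast (inv g) D z a i j) y :=
  DifferentiableAt.fun_sum fun b _ => (hg.differentiableAt_inv hk a b).fun_mul (hD i j b)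

theorem ricciPolar_raiseLast (hg : IsMetricAt k g y) (hk : 1 ≤ k) {D : Cov3 n ℝ}
    (hD : ∀ i j l, DifferentiableAt ℝ (fun z => D z i j l) y) (j l : Fin (n + 1)) :
    ricciPolar (christoffel g) (raiseLast (inv g) D) y j l =
      ∑ i, ∑ b, inv g y i b * cov3 g D y i l j b
        - cov1 g (fun z m => ∑ i, raiseLast (inv g) D z i i m) y l j := by
  have htr : cov1 g (fun z m => ∑ i, raiseLast (inv g) D z i i m) y l j =
      ∑ i, (pd l (fun z => raiseLast (inv g) D z i i j) y
        - ∑ m, raiseLast (inv g) D y i i m * christoffel g y m l j) := by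
    simp only [cov1, smul_eq_mul, Finset.sum_sub_distrib, Finset.sum_mul, mul_comm (christoffel ..),
      pd_sum _ fun i _ => hg.differentiableAt_raiseLast hk hD i i j]
    rw [Finset.sum_comm]
  rw [← hg.divergence_raiseLast hk hD, htr, ← Finset.sum_sub_distrib]
  refine Finset.sum_congr rfl fun i _ => ?_
  simp only [Finset.sum_sub_distrib, Finset.sum_add_distrib]
  ring

theorem sum_raiseLast_christoffelVar (hg : IsMetricAt k g y) (hk : 1 ≤ k)
    (hs : ∀ z i j, h z i j = h z j i)
    (hh : ∀ i j, DifferentiableAt ℝ (fun z => h z i j) y) (j : Fin (n + 1)) :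
    ∑ i, raiseLast (inv g) (christoffelVar g h) y i i j = (1 / 2 : ℝ) * pd j (trace g h) y := by
  have hswap : ∑ i, ∑ b, inv g y i b * cov2 g h y i j b =
      ∑ i, ∑ b, inv g y i b * cov2 g h y b i j := by
    rw [Finset.sum_comm]
    exact Finset.sum_congr rfl fun i _ => Finset.sum_congr rfl fun b _ => by
      rw [inv_symm (hg.symm y) b i, cov2_symm hs g y b j i]
  simp only [hg.pd_trace hk hh, raiseLast, christoffelVar, mul_left_comm (inv g y _ _),
    ← Finset.mul_sum, mul_add, mul_sub, Finset.sum_add_distrib, Finset.sum_sub_distrib, hswap]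
  ring

theorem differentiableAt_christoffelVar (hg : IsMetricAt 2 g y)
    (hh : ∀ i j, ContDiffAt ℝ 2 (fun z => h z i j) y) (i j l : Fin (n + 1)) :
    DifferentiableAt ℝ (fun z => christoffelVar g h z i j l) y :=
  have hT := hg.differentiableAt_cov2 hh
  (((hT i j l).fun_add (hT j i l)).fun_sub (hT l i j)).const_mul _

theorem cov3_christoffelVar (hg : IsMetricAt 2 g y)
    (hh : ∀ i j, ContDiffAt ℝ 2 (fun z => h z i j) y) (i l j b : Fin (n + 1)) :
    cov3 g (christoffelVar g h) y i l j b = (1 / 2 : ℝ) * (cov3 g (cov2 g h) y i l j b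
      + cov3 g (cov2 g h) y i j l b - cov3 g (cov2 g h) y i b l j) := by
  have hT := hg.differentiableAt_cov2 hh
  have hpd : pd i (fun z => christoffelVar g h z l j b) y = (1 / 2 : ℝ) *
      (pd i (fun z => cov2 g h z l j b) y + pd i (fun z => cov2 g h z j l b) y
        - pd i (fun z => cov2 g h z b l j) y) := by
    simp only [christoffelVar]
    rw [pd_const_mul, pd_sub ((hT _ _ _).fun_add (hT _ _ _)) (hT _ _ _),
      pd_add (hT _ _ _) (hT _ _ _)]
  simp only [cov3, hpd]
  simp only [christoffelVar, mul_left_comm (christoffel ..), ← Finset.mul_sum, mul_add,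
    mul_sub, Finset.sum_add_distrib, Finset.sum_sub_distrib]
  ring

theorem sum_inv_mul_cov3_christoffelVar (hg : IsMetricAt 2 g y) (hs : ∀ z i j, h z i j = h z j i)
    (hh : ∀ i j, ContDiffAt ℝ 2 (fun z => h z i j) y) (j l : Fin (n + 1)) :
    ∑ i, ∑ b, inv g y i b * cov3 g (christoffelVar g h) y i l j b =
      (1 / 2 : ℝ) * (∑ i, ∑ b, inv g y i b * cov3 g (cov2 g h) y i l j b
        + ∑ i, ∑ b, inv g y i b * cov3 g (cov2 g h) y i j l b + bochner g h y j l) := by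
  simp only [hg.cov3_christoffelVar hh, bochner, mul_left_comm (inv g y _ _), ← Finset.mul_sum,
    mul_add, mul_sub, Finset.sum_add_distrib, Finset.sum_sub_distrib,
    fun i b => cov3_symm (fun z => cov2_symm hs g z) g y i b l j]
  ring

theorem ricciVar_eq (hg : IsMetricAt 2 g y) (hs : ∀ z i j, h z i j = h z j i)
    (hh : ∀ i j, ContDiffAt ℝ 2 (fun z => h z i j) y) (j l : Fin (n + 1)) :
    ricciVar g h y j l =
      (1 / 2 : ℝ) * lichnerowicz g h y j l - deltaStar g (bianchi g h) y j l := by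
  have htrace : cov1 g (fun z m => ∑ i, raiseLast (inv g) (christoffelVar g h) z i i m) y l j =
      (1 / 2 : ℝ) * cov1 g (fun z m => pd m (trace g h) z) y l j := by
    rw [cov1_congr (b := (1 / 2 : ℝ) • fun z m => pd m (trace g h) z), cov1_smul]
    · rfl
    filter_upwards [hg.eventually (by simp), eventually_all.2 fun a => eventually_all.2 fun b =>
      (hh a b).eventually (by simp)] with z hgz hhz
    exact funext fun m => hgz.sum_raiseLast_christoffelVar one_le_two hs
      (fun a b => (hhz a b).differentiableAt two_ne_zero) m
  have hswap : ∀ l j, ∑ i, ∑ b, inv g y i b * cov3 g (cov2 g h) y l b i j =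
      ∑ i, ∑ b, inv g y i b * cov3 g (cov2 g h) y l i j b := fun l j => by
    rw [Finset.sum_comm]
    exact Finset.sum_congr rfl fun i _ => Finset.sum_congr rfl fun b _ => by
      rw [inv_symm (hg.symm y) b i, cov3_symm (fun z => cov2_symm hs g z) g y l i b j]
  have hcomm₁ := hg.contraction_ricci_identity (hs y) hh j l
  have hcomm₂ := hg.contraction_ricci_identity (hs y) hh l j
  simp only [mul_sub, Finset.sum_sub_distrib] at hcomm₁ hcomm₂
  have hhess := cov1_pd_comm hg.symm (hg.contDiffAt_trace hh) j l
  have hriem := hg.riemAct_symm (hs y) j l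
  rw [ricciVar, hg.ricciPolar_raiseLast one_le_two (hg.differentiableAt_christoffelVar hh), htrace,
    hg.sum_inv_mul_cov3_christoffelVar hs hh]
  simp only [lichnerowicz, ricAct, deltaStar, hg.cov1_bianchi hh, hswap, hhess, mul_add,
    Finset.sum_add_distrib]
  linarith

end IsMetricAt

end RicciVariation

section Jets

/-- A family of base points `pt x` and sizes `r x ∈ [0, 1]`, for `x` in a set `S`: the parameters
with respect to which the `O`-estimates below are uniform. -/
structure JetParam (n : ℕ) (X : Type*) where
  S : Set X
  r : X → ℝ
  pt : X → Vec n
  r_nonneg : ∀ x ∈ S, 0 ≤ r x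
  r_le_one : ∀ x ∈ S, r x ≤ 1

variable {n : ℕ} {X : Type*} {F : Type*} [NormedAddCommGroup F] [NormedSpace ℝ F]
  {G : Type*} [NormedAddCommGroup G] [NormedSpace ℝ G]
  {H : Type*} [NormedAddCommGroup H] [NormedSpace ℝ H] {𝒥 : JetParam n X}

/-- The functions `f x` are of class `C^k` near `pt x`, and their partial derivatives of order at
most `k` at `pt x` are `O(r ^ p)`, uniformly in `x ∈ S`. -/
def JetO (𝒥 : JetParam n X) : ℕ → ℕ → (X → Vec n → F) → Prop
  | 0, p, f => (fun x => f x (𝒥.pt x)) =O[𝓟 𝒥.S] fun x => 𝒥.r x ^ p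
  | k + 1, p, f => ((fun x => f x (𝒥.pt x)) =O[𝓟 𝒥.S] fun x => 𝒥.r x ^ p) ∧
      (∀ x ∈ 𝒥.S, ContDiffAt ℝ ((k + 1 : ℕ) : ℕ∞ω) (f x) (𝒥.pt x)) ∧
      ∀ i, JetO 𝒥 k p fun x => pd i (f x)

namespace JetO

theorem isBigO {k p : ℕ} {f : X → Vec n → F} (hf : JetO 𝒥 k p f) :
    (fun x => f x (𝒥.pt x)) =O[𝓟 𝒥.S] fun x => 𝒥.r x ^ p := by
  cases k with
  | zero => exact hf
  | succ k => exact hf.1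

theorem contDiffAt {k p : ℕ} {f : X → Vec n → F} (hf : JetO 𝒥 (k + 1) p f) {x : X}
    (hx : x ∈ 𝒥.S) : ContDiffAt ℝ ((k + 1 : ℕ) : ℕ∞ω) (f x) (𝒥.pt x) :=
  hf.2.1 x hx

theorem differentiableAt {k p : ℕ} {f : X → Vec n → F} (hf : JetO 𝒥 (k + 1) p f) {x : X}
    (hx : x ∈ 𝒥.S) : DifferentiableAt ℝ (f x) (𝒥.pt x) :=
  (hf.contDiffAt hx).differentiableAt (by simp)

theorem eventually_differentiableAt {k p : ℕ} {f : X → Vec n → F} (hf : JetO 𝒥 (k + 1) p f)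
    {x : X} (hx : x ∈ 𝒥.S) : ∀ᶠ z in 𝓝 (𝒥.pt x), DifferentiableAt ℝ (f x) z :=
  ((hf.contDiffAt hx).eventually (by simp)).mono fun _ hz => hz.differentiableAt (by simp)

theorem pd {k p : ℕ} {f : X → Vec n → F} (hf : JetO 𝒥 (k + 1) p f) (i : Fin (n + 1)) :
    JetO 𝒥 k p fun x => EYM.pd i (f x) :=
  hf.2.2 i

theorem congr {k p : ℕ} {f f' : X → Vec n → F} (hf : JetO 𝒥 k p f)
    (h : ∀ x ∈ 𝒥.S, f x =ᶠ[𝓝 (𝒥.pt x)] f' x) : JetO 𝒥 k p f' := by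
  induction k generalizing f f' with
  | zero =>
    exact IsBigO.congr' hf (eventually_principal.2 fun x hx => (h x hx).self_of_nhds)
      EventuallyEq.rfl
  | succ k ih =>
    exact ⟨hf.1.congr' (eventually_principal.2 fun x hx => (h x hx).self_of_nhds)
      EventuallyEq.rfl, fun x hx => (hf.2.1 x hx).congr_of_eventuallyEq (h x hx).symm,
      fun i => ih (hf.2.2 i) fun x hx => pd_eventuallyEq (h x hx) i⟩

theorem pred {k p : ℕ} {f : X → Vec n → F} (hf : JetO 𝒥 (k + 1) p f) : JetO 𝒥 k p f := by
  induction k generalizing f with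
  | zero => exact hf.1
  | succ k ih =>
    exact ⟨hf.1, fun x hx => (hf.2.1 x hx).of_le (by exact_mod_cast Nat.le_succ _),
      fun i => ih (hf.2.2 i)⟩

theorem mono {k p q : ℕ} {f : X → Vec n → F} (hf : JetO 𝒥 k p f) (hq : q ≤ p) : JetO 𝒥 k q f := by
  have hr : (fun x => 𝒥.r x ^ p) =O[𝓟 𝒥.S] fun x => 𝒥.r x ^ q :=
    IsBigO.of_bound 1 <| eventually_principal.2 fun x hx => by
      have h0 := 𝒥.r_nonneg x hx
      rw [one_mul, Real.norm_of_nonneg (pow_nonneg h0 _), Real.norm_of_nonneg (pow_nonneg h0 _)]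
      exact pow_le_pow_of_le_one h0 (𝒥.r_le_one x hx) hq
  induction k generalizing f with
  | zero => exact IsBigO.trans hf hr
  | succ k ih => exact ⟨hf.1.trans hr, hf.2.1, fun i => ih (hf.2.2 i)⟩

theorem zero {k p : ℕ} : JetO 𝒥 k p (fun _ _ => (0 : F)) := by
  induction k with
  | zero => exact isBigO_zero _ _
  | succ k ih =>
    refine ⟨isBigO_zero _ _, fun x _ => contDiffAt_const, fun i => ?_⟩
    refine ih.congr fun x _ => Eventually.of_forall fun z => ?_
    exact (pd_const (0 : F) i).symm

theorem add {k p : ℕ} {f f' : X → Vec n → F} (hf : JetO 𝒥 k p f) (hf' : JetO 𝒥 k p f') :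
    JetO 𝒥 k p fun x z => f x z + f' x z := by
  induction k generalizing f f' with
  | zero => exact IsBigO.add hf hf'
  | succ k ih =>
    refine ⟨hf.1.add hf'.1, fun x hx => (hf.2.1 x hx).add (hf'.2.1 x hx), fun i => ?_⟩
    refine (ih (hf.2.2 i) (hf'.2.2 i)).congr fun x hx => ?_
    filter_upwards [hf.eventually_differentiableAt hx, hf'.eventually_differentiableAt hx]
      with z h1 h2 using (pd_add h1 h2 i).symm

theorem bilin (B : F →L[ℝ] G →L[ℝ] H) {k p q : ℕ} {f : X → Vec n → F} {f' : X → Vec n → G}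
    (hf : JetO 𝒥 k p f) (hf' : JetO 𝒥 k q f') :
    JetO 𝒥 k (p + q) fun x z => B (f x z) (f' x z) := by
  have base : ∀ {k : ℕ} {f : X → Vec n → F} {f' : X → Vec n → G}, JetO 𝒥 k p f → JetO 𝒥 k q f' →
      (fun x => B (f x (𝒥.pt x)) (f' x (𝒥.pt x))) =O[𝓟 𝒥.S] fun x => 𝒥.r x ^ (p + q) := by
    intro k f f' hf hf'
    have h1 : (fun x => B (f x (𝒥.pt x)) (f' x (𝒥.pt x))) =O[𝓟 𝒥.S]
        fun x => ‖f x (𝒥.pt x)‖ * ‖f' x (𝒥.pt x)‖ :=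
      IsBigO.of_bound ‖B‖ <| Eventually.of_forall fun x => by
        rw [Real.norm_of_nonneg (by positivity), ← mul_assoc]
        exact B.le_opNorm₂ _ _
    simp only [pow_add]
    exact h1.trans (hf.isBigO.norm_left.mul hf'.isBigO.norm_left)
  induction k generalizing f f' with
  | zero => exact base hf hf'
  | succ k ih =>
    refine ⟨base hf hf', fun x hx => ?_, fun i => ?_⟩
    · exact (B.contDiff.contDiffAt.comp _ (hf.2.1 x hx)).clm_apply (hf'.2.1 x hx)
    · refine ((ih (hf.2.2 i) hf'.pred).add (ih hf.pred (hf'.2.2 i))).congr fun x hx => ?_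
      filter_upwards [hf.eventually_differentiableAt hx, hf'.eventually_differentiableAt hx]
        with z h1 h2 using (pd_bilin B h1 h2 i).symm

theorem smul {k p q : ℕ} {f : X → Vec n → ℝ} {f' : X → Vec n → F} (hf : JetO 𝒥 k p f)
    (hf' : JetO 𝒥 k q f') : JetO 𝒥 k (p + q) fun x z => f x z • f' x z :=
  bilin (ContinuousLinearMap.lsmul ℝ ℝ) hf hf'

theorem mul {k p q : ℕ} {f f' : X → Vec n → ℝ} (hf : JetO 𝒥 k p f) (hf' : JetO 𝒥 k q f') :
    JetO 𝒥 k (p + q) fun x z => f x z * f' x z :=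
  hf.smul hf'

theorem const_smul {k p : ℕ} {f : X → Vec n → F} (hf : JetO 𝒥 k p f) (c : ℝ) :
    JetO 𝒥 k p fun x z => c • f x z := by
  induction k generalizing f with
  | zero => exact IsBigO.const_smul_left hf c
  | succ k ih =>
    refine ⟨hf.1.const_smul_left c, fun x hx => (hf.2.1 x hx).const_smul c, fun i => ?_⟩
    exact (ih (hf.2.2 i)).congr fun x _ => Eventually.of_forall fun z => (pd_const_smul c _ i).symm

theorem const_mul {k p : ℕ} {f : X → Vec n → ℝ} (hf : JetO 𝒥 k p f) (c : ℝ) :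
    JetO 𝒥 k p fun x z => c * f x z :=
  hf.const_smul c

theorem neg {k p : ℕ} {f : X → Vec n → F} (hf : JetO 𝒥 k p f) : JetO 𝒥 k p fun x z => -f x z := by
  simpa using hf.const_smul (-1)

theorem sub {k p : ℕ} {f f' : X → Vec n → F} (hf : JetO 𝒥 k p f) (hf' : JetO 𝒥 k p f') :
    JetO 𝒥 k p fun x z => f x z - f' x z := by
  simpa only [sub_eq_add_neg] using hf.add hf'.neg

theorem sum {ι : Type*} {s : Finset ι} {k p : ℕ} {f : ι → X → Vec n → F}
    (hf : ∀ a, JetO 𝒥 k p (f a)) : JetO 𝒥 k p fun x z => ∑ a ∈ s, f a x z := by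
  classical
  induction s using Finset.induction_on with
  | empty => simpa using zero
  | insert a s ha ih => simpa only [Finset.sum_insert ha] using (hf a).add ih

theorem of_contDiffAt {K : Set (Vec n)} (hK : IsCompact K) (hpt : ∀ x ∈ 𝒥.S, 𝒥.pt x ∈ K) {k : ℕ}
    {f : Vec n → F} (hf : ∀ z ∈ K, ContDiffAt ℝ (k : ℕ∞ω) f z) : JetO 𝒥 k 0 fun _ => f := by
  have hbound : ∀ f : Vec n → F, (∀ z ∈ K, ContinuousAt f z) →
      (fun x => f (𝒥.pt x)) =O[𝓟 𝒥.S] fun x => 𝒥.r x ^ 0 := fun f hf => by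
    obtain ⟨C, hC⟩ := hK.exists_bound_of_continuousOn fun z hz => (hf z hz).continuousWithinAt
    exact IsBigO.of_bound C <| eventually_principal.2 fun x hx => by simpa using hC _ (hpt x hx)
  induction k generalizing f with
  | zero => exact hbound f fun z hz => (hf z hz).continuousAt
  | succ k ih =>
    exact ⟨hbound f fun z hz => (hf z hz).continuousAt, fun x hx => hf _ (hpt x hx),
      fun i => ih fun z hz => contDiffAt_pd (hf z hz) (by simp) i⟩

theorem inv {g : X → Cov2 n ℝ} {k : ℕ} (hg : ∀ i j, JetO 𝒥 k 0 fun x z => g x z i j)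
    (hdet : ∀ x ∈ 𝒥.S, (Matrix.of (g x (𝒥.pt x))).det ≠ 0)
    (hb : ∀ i j, JetO 𝒥 0 0 fun x z => EYM.inv (g x) z i j) (i j : Fin (n + 1)) :
    JetO 𝒥 k 0 fun x z => EYM.inv (g x) z i j := by
  induction k generalizing i j with
  | zero => exact hb i j
  | succ k ih =>
    have ih' := ih fun i j => (hg i j).pred
    refine ⟨hb i j, fun x hx => contDiffAt_inv (fun i j => (hg i j).contDiffAt hx) (hdet x hx) i j,
      fun m => ?_⟩
    have h1 : JetO 𝒥 k 0 fun x z => -∑ b, ∑ a, EYM.inv (g x) z i a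
        * EYM.pd m (fun w => g x w a b) z * EYM.inv (g x) z b j :=
      (sum fun b => sum fun a => ((ih' i a).mul ((hg a b).pd m)).mul (ih' b j)).neg
    refine h1.congr fun x hx => ?_
    have h2 : ∀ᶠ z in 𝓝 (𝒥.pt x), ∀ a b, ContDiffAt ℝ ((k + 1 : ℕ) : ℕ∞ω) (fun w => g x w a b) z :=
      eventually_all.2 fun a => eventually_all.2 fun b =>
        ((hg a b).contDiffAt hx).eventually (by simp)
    filter_upwards [h2, eventually_det_ne_zero (fun a b => (hg a b).contDiffAt hx) (hdet x hx)]
      with z hz hd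
    exact (pd_inv_eq (fun a b => (hz a b).of_le (by simp)) hd m i j).symm

end JetO

/-- The jets of `f` and `f'` are `O(r ^ p)` and differ by `O(r ^ (p + 1))`. -/
structure JetClose (𝒥 : JetParam n X) (k p : ℕ) (f f' : X → Vec n → F) : Prop where
  left : JetO 𝒥 k p f
  right : JetO 𝒥 k p f'
  sub : JetO 𝒥 k (p + 1) fun x z => f x z - f' x z

namespace JetClose

variable {k p q : ℕ}

theorem refl {f : X → Vec n → F} (hf : JetO 𝒥 k p f) : JetClose 𝒥 k p f f :=
  ⟨hf, hf, by simpa using JetO.zero⟩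

theorem of_sub {f f' : X → Vec n → F} (hf : JetO 𝒥 k p f')
    (h : JetO 𝒥 k (p + 1) fun x z => f x z - f' x z) : JetClose 𝒥 k p f f' :=
  ⟨by simpa using hf.add (h.mono (Nat.le_succ p)), hf, h⟩

theorem of_add {f f' : X → Vec n → F} (hf : JetO 𝒥 k p f) (h : JetO 𝒥 k (p + 1) f') :
    JetClose 𝒥 k p (fun x z => f x z + f' x z) f :=
  of_sub hf (by simpa using h)

theorem congr_left {f f' f'' : X → Vec n → F} (h : JetClose 𝒥 k p f f')
    (he : ∀ x ∈ 𝒥.S, f x =ᶠ[𝓝 (𝒥.pt x)] f'' x) : JetClose 𝒥 k p f'' f' :=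
  ⟨h.left.congr he, h.right, h.sub.congr fun x hx => (he x hx).sub EventuallyEq.rfl⟩

theorem pred {f f' : X → Vec n → F} (h : JetClose 𝒥 (k + 1) p f f') : JetClose 𝒥 k p f f' :=
  ⟨h.left.pred, h.right.pred, h.sub.pred⟩

theorem pd {f f' : X → Vec n → F} (h : JetClose 𝒥 (k + 1) p f f') (i : Fin (n + 1)) :
    JetClose 𝒥 k p (fun x => EYM.pd i (f x)) (fun x => EYM.pd i (f' x)) :=
  ⟨h.left.pd i, h.right.pd i, (h.sub.pd i).congr fun x hx => by
    filter_upwards [h.left.eventually_differentiableAt hx, h.right.eventually_differentiableAt hx]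
      with z h1 h2 using pd_sub h1 h2 i⟩

theorem add {f f' e e' : X → Vec n → F} (h : JetClose 𝒥 k p f f') (h' : JetClose 𝒥 k p e e') :
    JetClose 𝒥 k p (fun x z => f x z + e x z) (fun x z => f' x z + e' x z) :=
  ⟨h.left.add h'.left, h.right.add h'.right, by
    simpa only [add_sub_add_comm] using h.sub.add h'.sub⟩

theorem const_smul {f f' : X → Vec n → F} (h : JetClose 𝒥 k p f f') (c : ℝ) :
    JetClose 𝒥 k p (fun x z => c • f x z) (fun x z => c • f' x z) :=
  ⟨h.left.const_smul c, h.right.const_smul c, by simpa only [smul_sub] using h.sub.const_smul c⟩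

theorem const_mul {f f' : X → Vec n → ℝ} (h : JetClose 𝒥 k p f f') (c : ℝ) :
    JetClose 𝒥 k p (fun x z => c * f x z) (fun x z => c * f' x z) :=
  h.const_smul c

theorem neg {f f' : X → Vec n → F} (h : JetClose 𝒥 k p f f') :
    JetClose 𝒥 k p (fun x z => -f x z) (fun x z => -f' x z) := by
  simpa using h.const_smul (-1)

theorem fun_sub {f f' e e' : X → Vec n → F} (h : JetClose 𝒥 k p f f')
    (h' : JetClose 𝒥 k p e e') :
    JetClose 𝒥 k p (fun x z => f x z - e x z) (fun x z => f' x z - e' x z) := by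
  simpa only [sub_eq_add_neg] using h.add h'.neg

theorem sum {ι : Type*} {s : Finset ι} {f f' : ι → X → Vec n → F}
    (h : ∀ a, JetClose 𝒥 k p (f a) (f' a)) :
    JetClose 𝒥 k p (fun x z => ∑ a ∈ s, f a x z) (fun x z => ∑ a ∈ s, f' a x z) :=
  ⟨JetO.sum fun a => (h a).left, JetO.sum fun a => (h a).right, by
    simpa only [Finset.sum_sub_distrib] using JetO.sum (s := s) fun a => (h a).sub⟩

theorem bilin (B : F →L[ℝ] G →L[ℝ] H) {f f' : X → Vec n → F} {e e' : X → Vec n → G}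
    (h : JetClose 𝒥 k p f f') (h' : JetClose 𝒥 k q e e') :
    JetClose 𝒥 k (p + q) (fun x z => B (f x z) (e x z)) (fun x z => B (f' x z) (e' x z)) := by
  refine ⟨h.left.bilin B h'.left, h.right.bilin B h'.right, ?_⟩
  have h1 := h.sub.bilin B h'.left
  have h2 := h.right.bilin B h'.sub
  rw [show p + 1 + q = p + q + 1 by ring] at h1
  refine (h1.add h2).congr fun x _ => Eventually.of_forall fun z => ?_
  simp

theorem smul {f f' : X → Vec n → ℝ} {e e' : X → Vec n → F} (h : JetClose 𝒥 k p f f')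
    (h' : JetClose 𝒥 k q e e') :
    JetClose 𝒥 k (p + q) (fun x z => f x z • e x z) (fun x z => f' x z • e' x z) :=
  bilin (ContinuousLinearMap.lsmul ℝ ℝ) h h'

end JetClose

end Jets

section JetGeometry

variable {n : ℕ} {X : Type*} {F : Type*} [NormedAddCommGroup F] [NormedSpace ℝ F]
  {𝔩 : Type*} [NormedAddCommGroup 𝔩] [NormedSpace ℝ 𝔩] {𝒥 : JetParam n X} {k p : ℕ}

theorem JetO.bounded_bilin {B : 𝔩 →L[ℝ] 𝔩 →L[ℝ] F} {f f' : X → Vec n → 𝔩} (hf : JetO 𝒥 k 0 f)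
    (hf' : JetO 𝒥 k p f') : JetO 𝒥 k p fun x z => B (f x z) (f' x z) := by
  simpa only [zero_add] using hf.bilin B hf'

theorem JetO.bounded_mul {f f' : X → Vec n → ℝ} (hf : JetO 𝒥 k 0 f) (hf' : JetO 𝒥 k p f') :
    JetO 𝒥 k p fun x z => f x z * f' x z := by
  simpa only [zero_add] using hf.mul hf'

namespace JetClose

theorem bounded_bilin (B : 𝔩 →L[ℝ] 𝔩 →L[ℝ] F) {f f' e e' : X → Vec n → 𝔩}
    (h : JetClose 𝒥 k 0 f f') (h' : JetClose 𝒥 k p e e') :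
    JetClose 𝒥 k p (fun x z => B (f x z) (e x z)) (fun x z => B (f' x z) (e' x z)) := by
  simpa only [zero_add] using h.bilin B h'

theorem bounded_smul {f f' : X → Vec n → ℝ} {e e' : X → Vec n → F} (h : JetClose 𝒥 k 0 f f')
    (h' : JetClose 𝒥 k p e e') :
    JetClose 𝒥 k p (fun x z => f x z • e x z) (fun x z => f' x z • e' x z) := by
  simpa only [zero_add] using h.smul h'

theorem bounded_mul {f f' e e' : X → Vec n → ℝ} (h : JetClose 𝒥 k 0 f f')
    (h' : JetClose 𝒥 k p e e') :
    JetClose 𝒥 k p (fun x z => f x z * e x z) (fun x z => f' x z * e' x z) :=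
  h.bounded_smul h'

theorem inv {g g' : X → Cov2 n ℝ}
    (hg : ∀ i j, JetClose 𝒥 (k + 1) 0 (fun x z => g x z i j) (fun x z => g' x z i j))
    (hdet : ∀ x ∈ 𝒥.S, (Matrix.of (g x (𝒥.pt x))).det ≠ 0)
    (hdet' : ∀ x ∈ 𝒥.S, (Matrix.of (g' x (𝒥.pt x))).det ≠ 0)
    (hb : ∀ i j, JetO 𝒥 0 0 fun x z => EYM.inv (g x) z i j)
    (hb' : ∀ i j, JetO 𝒥 0 0 fun x z => EYM.inv (g' x) z i j) (i j : Fin (n + 1)) :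
    JetClose 𝒥 (k + 1) 0 (fun x z => EYM.inv (g x) z i j) (fun x z => EYM.inv (g' x) z i j) := by
  have hG := JetO.inv (fun i j => (hg i j).left) hdet hb
  have hG' := JetO.inv (fun i j => (hg i j).right) hdet' hb'
  have hprod : JetO 𝒥 (k + 1) 1 fun x z => -∑ a, ∑ b, EYM.inv (g x) z i a
      * (g x z a b - g' x z a b) * EYM.inv (g' x) z b j :=
    (JetO.sum fun a => JetO.sum fun b => ((hG i a).mul (hg a b).sub).mul (hG' b j)).neg
  refine ⟨hG i j, hG' i j, hprod.congr fun x hx => ?_⟩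
  filter_upwards [
    eventually_det_ne_zero (fun i j => (hg i j).left.contDiffAt hx) (hdet x hx),
    eventually_det_ne_zero (fun i j => (hg i j).right.contDiffAt hx) (hdet' x hx)] with z hz hz'
  have hM : (Matrix.of (g x z))⁻¹ - (Matrix.of (g' x z))⁻¹ = -((Matrix.of (g x z))⁻¹
      * (Matrix.of (g x z) - Matrix.of (g' x z)) * (Matrix.of (g' x z))⁻¹) := by
    rw [mul_sub, sub_mul, Matrix.nonsing_inv_mul _ (isUnit_iff_ne_zero.mpr hz), one_mul,
      Matrix.mul_nonsing_inv_cancel_right _ _ (isUnit_iff_ne_zero.mpr hz')]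
    abel
  have hMij := congrFun (congrFun hM i) j
  simp only [Matrix.sub_apply, Matrix.neg_apply, Matrix.mul_apply, Matrix.of_apply,
    Finset.sum_mul] at hMij
  rw [Finset.sum_comm] at hMij
  exact hMij.symm

theorem dCov0 (B : 𝔩 →L[ℝ] 𝔩 →L[ℝ] 𝔩) {ϖ ϖ' : X → Cov1 n 𝔩} {f f' : X → Vec n → 𝔩}
    (hϖ : ∀ i, JetClose 𝒥 k 0 (fun x z => ϖ x z i) (fun x z => ϖ' x z i))
    (hf : JetClose 𝒥 (k + 1) p f f') (i : Fin (n + 1)) :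
    JetClose 𝒥 k p (fun x z => EYM.dCov0 (B · ·) (ϖ x) (f x) z i)
      (fun x z => EYM.dCov0 (B · ·) (ϖ' x) (f' x) z i) :=
  (hf.pd i).add ((hϖ i).bounded_bilin B hf.pred)

end JetClose

/-- Two families of metrics whose jets of order `k + 1`, and those of their inverses, are bounded
and differ by `O(r)`. -/
structure MetricClose (𝒥 : JetParam n X) (k : ℕ) (g g' : X → Cov2 n ℝ) : Prop where
  metric : ∀ i j, JetClose 𝒥 (k + 1) 0 (fun x z => g x z i j) (fun x z => g' x z i j)
  inv : ∀ i j, JetClose 𝒥 (k + 1) 0 (fun x z => EYM.inv (g x) z i j)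
    (fun x z => EYM.inv (g' x) z i j)

namespace MetricClose

variable {g g' : X → Cov2 n ℝ}

theorem pred (hg : MetricClose 𝒥 (k + 1) g g') : MetricClose 𝒥 k g g' :=
  ⟨fun i j => (hg.metric i j).pred, fun i j => (hg.inv i j).pred⟩

theorem right_refl (hg : MetricClose 𝒥 k g g') : MetricClose 𝒥 k g' g' :=
  ⟨fun i j => .refl (hg.metric i j).right, fun i j => .refl (hg.inv i j).right⟩

theorem christoffel (hg : MetricClose 𝒥 k g g') (a i j : Fin (n + 1)) :
    JetClose 𝒥 k 0 (fun x z => EYM.christoffel (g x) z a i j)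
      (fun x z => EYM.christoffel (g' x) z a i j) :=
  .const_mul (.sum fun l => (hg.inv a l).pred.bounded_mul
    ((((hg.metric j l).pd i).add ((hg.metric i l).pd j)).fun_sub ((hg.metric i j).pd l))) _

theorem cov1 (hg : MetricClose 𝒥 k g g') {a a' : X → Cov1 n F}
    (ha : ∀ i, JetClose 𝒥 (k + 1) p (fun x z => a x z i) (fun x z => a' x z i))
    (i j : Fin (n + 1)) : JetClose 𝒥 k p (fun x z => EYM.cov1 (g x) (a x) z i j)
      (fun x z => EYM.cov1 (g' x) (a' x) z i j) :=
  ((ha j).pd i).fun_sub (.sum fun m => (hg.christoffel m i j).bounded_smul (ha m).pred)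

theorem cov2 (hg : MetricClose 𝒥 k g g') {h h' : X → Cov2 n F}
    (hh : ∀ i j, JetClose 𝒥 (k + 1) p (fun x z => h x z i j) (fun x z => h' x z i j))
    (i j l : Fin (n + 1)) : JetClose 𝒥 k p (fun x z => EYM.cov2 (g x) (h x) z i j l)
      (fun x z => EYM.cov2 (g' x) (h' x) z i j l) :=
  (((hh j l).pd i).fun_sub
    (.sum fun m => (hg.christoffel m i j).bounded_smul (hh m l).pred)).fun_sub
    (.sum fun m => (hg.christoffel m i l).bounded_smul (hh j m).pred)

theorem deltaStar (hg : MetricClose 𝒥 k g g') {a a' : X → Cov1 n ℝ}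
    (ha : ∀ i, JetClose 𝒥 (k + 1) p (fun x z => a x z i) (fun x z => a' x z i))
    (i j : Fin (n + 1)) : JetClose 𝒥 k p (fun x z => EYM.deltaStar (g x) (a x) z i j)
      (fun x z => EYM.deltaStar (g' x) (a' x) z i j) :=
  ((hg.cov1 ha i j).add (hg.cov1 ha j i)).const_mul _

theorem dStar1 (hg : MetricClose 𝒥 k g g') (B : 𝔩 →L[ℝ] 𝔩 →L[ℝ] 𝔩) {ϖ ϖ' a a' : X → Cov1 n 𝔩}
    (hϖ : ∀ i, JetClose 𝒥 k 0 (fun x z => ϖ x z i) (fun x z => ϖ' x z i))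
    (ha : ∀ i, JetClose 𝒥 (k + 1) p (fun x z => a x z i) (fun x z => a' x z i)) :
    JetClose 𝒥 k p (fun x => EYM.dStar1 (B · ·) (g x) (ϖ x) (a x))
      (fun x => EYM.dStar1 (B · ·) (g' x) (ϖ' x) (a' x)) :=
  .neg (.sum fun i => .sum fun j => (hg.inv i j).pred.bounded_smul
    ((hg.cov1 ha i j).add ((hϖ i).bounded_bilin B (ha j).pred)))

theorem dStar2 (hg : MetricClose 𝒥 k g g') (B : 𝔩 →L[ℝ] 𝔩 →L[ℝ] 𝔩) {ϖ ϖ' : X → Cov1 n 𝔩}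
    {Φ Φ' : X → Cov2 n 𝔩}
    (hϖ : ∀ i, JetClose 𝒥 k 0 (fun x z => ϖ x z i) (fun x z => ϖ' x z i))
    (hΦ : ∀ i j, JetClose 𝒥 (k + 1) p (fun x z => Φ x z i j) (fun x z => Φ' x z i j))
    (j : Fin (n + 1)) :
    JetClose 𝒥 k p (fun x z => EYM.dStar2 (B · ·) (g x) (ϖ x) (Φ x) z j)
      (fun x z => EYM.dStar2 (B · ·) (g' x) (ϖ' x) (Φ' x) z j) :=
  .neg (.sum fun i => .sum fun m => (hg.inv i m).pred.bounded_smul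
    ((hg.cov2 hΦ i m j).add ((hϖ i).bounded_bilin B (hΦ m j).pred)))

theorem bianchi (hg : MetricClose 𝒥 k g g') {h h' : X → Cov2 n ℝ}
    (hh : ∀ i j, JetClose 𝒥 (k + 1) p (fun x z => h x z i j) (fun x z => h' x z i j))
    (j : Fin (n + 1)) : JetClose 𝒥 k p (fun x z => EYM.bianchi (g x) (h x) z j)
      (fun x z => EYM.bianchi (g' x) (h' x) z j) := by
  have htrace : JetClose 𝒥 (k + 1) p (fun x => trace (g x) (h x))
      (fun x => trace (g' x) (h' x)) :=
    .sum fun i => .sum fun l => (hg.inv i l).bounded_mul (hh i l)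
  exact (JetClose.neg (.sum fun i => .sum fun m =>
    (hg.inv i m).pred.bounded_mul (hg.cov2 hh m i j))).add ((htrace.pd j).const_mul _)

end MetricClose

theorem JetClose.ricciPolar {Γ C C' : X → Cov3 n ℝ}
    (hΓ : ∀ a i j, JetO 𝒥 k 0 fun x z => Γ x z a i j)
    (hC : ∀ a i j, JetClose 𝒥 (k + 1) p (fun x z => C x z a i j) (fun x z => C' x z a i j))
    (j l : Fin (n + 1)) : JetClose 𝒥 k p (fun x z => EYM.ricciPolar (Γ x) (C x) z j l)
      (fun x z => EYM.ricciPolar (Γ x) (C' x) z j l) := by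
  have hΓC : ∀ a b c d e f, JetClose 𝒥 k p (fun x z => Γ x z a b c * C x z d e f)
      (fun x z => Γ x z a b c * C' x z d e f) := fun a b c d e f =>
    (JetClose.refl (hΓ a b c)).bounded_mul (hC d e f).pred
  have hCΓ : ∀ a b c d e f, JetClose 𝒥 k p (fun x z => C x z d e f * Γ x z a b c)
      (fun x z => C' x z d e f * Γ x z a b c) := fun a b c d e f => by
    simpa only [mul_comm] using hΓC a b c d e f
  exact .sum fun i => (((hC i l j).pd i).fun_sub ((hC i i j).pd l)).add
    (.sum fun m => (((hΓC _ _ _ _ _ _).add (hCΓ _ _ _ _ _ _)).fun_sub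
      (hΓC _ _ _ _ _ _)).fun_sub (hCΓ _ _ _ _ _ _))

theorem JetO.ricci_add_sub {g h : X → Cov2 n ℝ}
    (hm : ∀ x ∈ 𝒥.S, IsMetricAt 2 (g x) (𝒥.pt x))
    (hm' : ∀ x ∈ 𝒥.S, IsMetricAt 2 (g x + h x) (𝒥.pt x))
    (hg : MetricClose 𝒥 1 (fun x => g x + h x) g)
    (hh : ∀ i j, JetO 𝒥 2 1 fun x z => h x z i j) (j l : Fin (n + 1)) :
    JetO 𝒥 0 2 fun x z => ricci (g x + h x) z j l - (ricci (g x) z j l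
      + ricciVar (g x) (h x) z j l) := by
  have hΓ := fun a i j => (hg.christoffel a i j).right
  have hcov := fun i j l => (hg.right_refl.cov2 (fun i j => .refl (hh i j)) i j l).left
  have hD : ∀ i j l, JetO 𝒥 1 1 fun x z => christoffelVar (g x) (h x) z i j l := fun i j l =>
    (((hcov i j l).add (hcov j i l)).sub (hcov l i j)).const_mul _
  have hC : ∀ a i j, JetClose 𝒥 1 1
      (fun x z => raiseLast (EYM.inv (g x + h x)) (christoffelVar (g x) (h x)) z a i j)
      (fun x z => raiseLast (EYM.inv (g x)) (christoffelVar (g x) (h x)) z a i j) :=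
    fun a i j => .sum fun l => (hg.inv a l).pred.bounded_mul (.refl (hD i j l))
  have hlinear := (JetClose.ricciPolar (fun a i j => (hΓ a i j).pred) hC j l).sub
  have hquadratic : JetO 𝒥 0 2 fun x z => ∑ i, ∑ m,
      (raiseLast (EYM.inv (g x + h x)) (christoffelVar (g x) (h x)) z i i m
        * raiseLast (EYM.inv (g x + h x)) (christoffelVar (g x) (h x)) z m l j
      - raiseLast (EYM.inv (g x + h x)) (christoffelVar (g x) (h x)) z i l m
        * raiseLast (EYM.inv (g x + h x)) (christoffelVar (g x) (h x)) z m i j) :=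
    JetO.sum fun i => JetO.sum fun m =>
      ((hC i i m).left.pred.mul (hC m l j).left.pred).sub
        ((hC i l m).left.pred.mul (hC m i j).left.pred)
  refine IsBigO.congr' (hlinear.add hquadratic) (eventually_principal.2 fun x hx => ?_)
    EventuallyEq.rfl
  have hev : ∀ᶠ z in 𝓝 (𝒥.pt x), ∀ a i j, christoffel (g x + h x) z a i j =
      christoffel (g x) z a i j
        + raiseLast (EYM.inv (g x + h x)) (christoffelVar (g x) (h x)) z a i j := by
    filter_upwards [(hm x hx).eventually (by simp), (hm' x hx).eventually (by simp)] with z h1 h2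
    exact (h1.of_le one_le_two).christoffel_add (h2.of_le one_le_two)
  simp only [ricci_add hev (fun a i j => (hΓ a i j).differentiableAt hx)
    (fun a i j => (hC a i j).left.differentiableAt hx) j l, ricciVar]
  ring

theorem ymCurv_add (B : 𝔩 →L[ℝ] 𝔩 →L[ℝ] 𝔩) (hB : ∀ u v, B u v = -B v u) {ϖ α : Cov1 n 𝔩} {y : Vec n}
    (hϖ : ∀ i, DifferentiableAt ℝ (fun z => ϖ z i) y)
    (hα : ∀ i, DifferentiableAt ℝ (fun z => α z i) y) (i j : Fin (n + 1)) :
    ymCurv (B · ·) (ϖ + α) y i j =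
      ymCurv (B · ·) ϖ y i j + dCov1 (B · ·) ϖ α y i j + B (α y i) (α y j) := by
  simp only [ymCurv, dCov1, Pi.add_apply, pd_add (hϖ _) (hα _), map_add, add_apply,
    hB (α y i) (ϖ y j)]
  abel

theorem JetO.dCov1 (B : 𝔩 →L[ℝ] 𝔩 →L[ℝ] 𝔩) {ϖ a : X → Cov1 n 𝔩}
    (hϖ : ∀ i, JetO 𝒥 k 0 (fun x z => ϖ x z i))
    (ha : ∀ i, JetO 𝒥 (k + 1) p (fun x z => a x z i)) (i j : Fin (n + 1)) :
    JetO 𝒥 k p (fun x z => EYM.dCov1 (B · ·) (ϖ x) (a x) z i j) :=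
  ((((ha j).pd i).sub ((ha i).pd j)).add ((hϖ i).bounded_bilin (ha j).pred)).sub
    ((hϖ j).bounded_bilin (ha i).pred)

theorem JetClose.ymCurv (B : 𝔩 →L[ℝ] 𝔩 →L[ℝ] 𝔩) (hB : ∀ u v, B u v = -B v u) {ϖ α : X → Cov1 n 𝔩}
    (hϖ : ∀ i, JetO 𝒥 (k + 1) 0 (fun x z => ϖ x z i))
    (hα : ∀ i, JetO 𝒥 (k + 1) 1 (fun x z => α x z i))
    (hflat : ∀ x ∈ 𝒥.S, ∀ᶠ z in 𝓝 (𝒥.pt x), ∀ i j, EYM.ymCurv (B · ·) (ϖ x) z i j = 0)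
    (i j : Fin (n + 1)) :
    JetClose 𝒥 k 1 (fun x z => EYM.ymCurv (B · ·) (ϖ x + α x) z i j)
      (fun x z => dCov1 (B · ·) (ϖ x) (α x) z i j) := by
  refine (JetClose.of_add (JetO.dCov1 B (fun i => (hϖ i).pred) hα i j)
    ((hα i).pred.bilin B (hα j).pred)).congr_left fun x hx => ?_
  have hϖ' : ∀ᶠ z in 𝓝 (𝒥.pt x), ∀ i, DifferentiableAt ℝ (fun z => ϖ x z i) z :=
    eventually_all.2 fun i => (hϖ i).eventually_differentiableAt hx
  have hα' : ∀ᶠ z in 𝓝 (𝒥.pt x), ∀ i, DifferentiableAt ℝ (fun z => α x z i) z :=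
    eventually_all.2 fun i => (hα i).eventually_differentiableAt hx
  filter_upwards [hflat x hx, hϖ', hα'] with z hz hϖz hαz
  rw [ymCurv_add B hB hϖz hαz, hz, zero_add]

theorem JetO.stressMod (B : 𝔩 →L[ℝ] 𝔩 →L[ℝ] 𝔩) (q : 𝔩 →L[ℝ] 𝔩 →L[ℝ] ℝ) {g : X → Cov2 n ℝ}
    {ϖ : X → Cov1 n 𝔩} (hg : ∀ i j, JetO 𝒥 k 0 fun x z => g x z i j)
    (hG : ∀ i j, JetO 𝒥 k 0 fun x z => EYM.inv (g x) z i j)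
    (hΩ : ∀ i j, JetO 𝒥 k p fun x z => EYM.ymCurv (B · ·) (ϖ x) z i j) (i j : Fin (n + 1)) :
    JetO 𝒥 k (p + p) fun x z => EYM.stressMod (B · ·) q (g x) (ϖ x) z i j := by
  have hq : ∀ a b c d, JetO 𝒥 k (p + p) fun x z => q (EYM.ymCurv (B · ·) (ϖ x) z a b)
      (EYM.ymCurv (B · ·) (ϖ x) z c d) := fun a b c d => (hΩ a b).bilin q (hΩ c d)
  have hQ : JetO 𝒥 k (p + p) fun x z => selfAction (B · ·) q (g x) (ϖ x) z :=
    const_mul (sum fun a => sum fun b => sum fun c => sum fun d =>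
      ((hG a c).mul (hG b d)).bounded_mul (hq a b c d)) _
  have hK : ∀ i j, JetO 𝒥 k (p + p) fun x z => stress (B · ·) q (g x) (ϖ x) z i j := fun i j =>
    (const_mul (sum fun a => sum fun b => (hG a b).bounded_mul (hq i a j b)) _).add
      ((hQ.const_mul _).mul (hg i j))
  have htrace : JetO 𝒥 k (p + p) fun x z =>
      trace (g x) (stress (B · ·) q (g x) (ϖ x)) z / ((n : ℝ) - 1) := by
    simpa only [trace, div_eq_inv_mul] using
      (sum fun a => sum fun b => (hG a b).bounded_mul (hK a b)).const_mul ((n : ℝ) - 1)⁻¹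
  exact (hK i j).sub (htrace.mul (hg i j))

end JetGeometry

section Linearity

variable {n : ℕ} {F : Type*} [NormedAddCommGroup F] [NormedSpace ℝ F]
  {𝔩 : Type*} [NormedAddCommGroup 𝔩] [NormedSpace ℝ 𝔩] {y : Vec n}

theorem trace_smul (g : Cov2 n ℝ) (c : ℝ) (h : Cov2 n ℝ) : trace g (c • h) = c • trace g h := by
  funext y
  simp only [trace, Pi.smul_apply, smul_eq_mul, Finset.mul_sum, mul_left_comm c]

theorem cov2_smul (g : Cov2 n ℝ) (c : ℝ) (h : Cov2 n F) : cov2 g (c • h) = c • cov2 g h := by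
  funext y i j l
  simp only [cov2, Pi.smul_apply, pd_const_smul, smul_sub, Finset.smul_sum, smul_comm c]

theorem cov2_add (g : Cov2 n ℝ) {h h' : Cov2 n F}
    (hh : ∀ i j, DifferentiableAt ℝ (fun z => h z i j) y)
    (hh' : ∀ i j, DifferentiableAt ℝ (fun z => h' z i j) y) (i j l : Fin (n + 1)) :
    cov2 g (h + h') y i j l = cov2 g h y i j l + cov2 g h' y i j l := by
  simp only [cov2, Pi.add_apply, pd_add (hh _ _) (hh' _ _), smul_add, Finset.sum_add_distrib]
  abel

theorem cov2_congr (g : Cov2 n ℝ) {h h' : Cov2 n F} (he : ∀ᶠ z in 𝓝 y, h z = h' z)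
    (i j l : Fin (n + 1)) : cov2 g h y i j l = cov2 g h' y i j l := by
  simp only [cov2, pd_congr (he.mono fun _ hz => congrFun₂ hz _ _), he.self_of_nhds]

theorem deltaStar_smul (g : Cov2 n ℝ) (c : ℝ) (η : Cov1 n ℝ) :
    deltaStar g (c • η) = c • deltaStar g η := by
  funext y i j
  simp only [deltaStar, cov1_smul, Pi.smul_apply, smul_eq_mul]
  ring

theorem bianchi_smul (g : Cov2 n ℝ) (c : ℝ) (h : Cov2 n ℝ) :
    bianchi g (c • h) = c • bianchi g h := by
  funext y j
  have hpd : pd j (c • trace g h) y = c * pd j (trace g h) y := pd_const_smul c _ j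
  simp only [bianchi, divergence, trace_smul, hpd, cov2_smul, Pi.smul_apply, smul_eq_mul,
    mul_left_comm _ c, ← Finset.mul_sum, ← mul_neg, ← mul_add]

theorem christoffelVar_smul (g : Cov2 n ℝ) (c : ℝ) (h : Cov2 n ℝ) :
    christoffelVar g (c • h) = c • christoffelVar g h := by
  funext y i j l
  simp only [christoffelVar, cov2_smul, Pi.smul_apply, smul_eq_mul]
  ring

theorem raiseLast_smul (G : Cov2 n ℝ) (c : ℝ) (D : Cov3 n ℝ) :
    raiseLast G (c • D) = c • raiseLast G D := by
  funext y a i j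
  simp only [raiseLast, Pi.smul_apply, smul_eq_mul, Finset.mul_sum, mul_left_comm c]

theorem ricciPolar_smul (Γ : Cov3 n ℝ) (c : ℝ) (C : Cov3 n ℝ) :
    ricciPolar Γ (c • C) = c • ricciPolar Γ C := by
  funext y j l
  simp only [ricciPolar, Pi.smul_apply, pd_const_mul, smul_eq_mul, mul_left_comm _ c, mul_assoc,
    ← Finset.mul_sum, ← mul_add, ← mul_sub]

theorem ricciVar_smul (g : Cov2 n ℝ) (c : ℝ) (h : Cov2 n ℝ) :
    ricciVar g (c • h) = c • ricciVar g h := by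
  rw [ricciVar, christoffelVar_smul, raiseLast_smul, ricciPolar_smul, ricciVar]

theorem ricciPolar_add (Γ : Cov3 n ℝ) {C C' : Cov3 n ℝ}
    (hC : ∀ a i j, DifferentiableAt ℝ (fun z => C z a i j) y)
    (hC' : ∀ a i j, DifferentiableAt ℝ (fun z => C' z a i j) y) (j l : Fin (n + 1)) :
    ricciPolar Γ (C + C') y j l = ricciPolar Γ C y j l + ricciPolar Γ C' y j l := by
  simp only [ricciPolar, Pi.add_apply, pd_add (hC _ _ _) (hC' _ _ _), ← Finset.sum_add_distrib]
  refine Finset.sum_congr rfl fun i _ => ?_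
  rw [add_add_add_comm, ← Finset.sum_add_distrib, add_sub_add_comm]
  congr 1
  exact Finset.sum_congr rfl fun m _ => by ring

theorem ricciPolar_congr (Γ : Cov3 n ℝ) {C C' : Cov3 n ℝ} (he : ∀ᶠ z in 𝓝 y, C z = C' z)
    (j l : Fin (n + 1)) : ricciPolar Γ C y j l = ricciPolar Γ C' y j l := by
  simp only [ricciPolar, he.self_of_nhds,
    pd_congr (he.mono fun _ hz => congrFun (congrFun₂ hz _ _) _)]

theorem IsMetricAt.ricciVar_add {g h h' : Cov2 n ℝ} (hg : IsMetricAt 2 g y)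
    (hh : ∀ i j, ContDiffAt ℝ 2 (fun z => h z i j) y)
    (hh' : ∀ i j, ContDiffAt ℝ 2 (fun z => h' z i j) y) (j l : Fin (n + 1)) :
    ricciVar g (h + h') y j l = ricciVar g h y j l + ricciVar g h' y j l := by
  have hdiff : ∀ {h : Cov2 n ℝ}, (∀ i j, ContDiffAt ℝ 2 (fun z => h z i j) y) →
      ∀ᶠ z in 𝓝 y, ∀ i j, DifferentiableAt ℝ (fun z => h z i j) z := fun hh =>
    eventually_all.2 fun i => eventually_all.2 fun j =>
      ((hh i j).eventually (by simp)).mono fun _ hz => hz.differentiableAt two_ne_zero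
  have hC : ∀ᶠ z in 𝓝 y, raiseLast (inv g) (christoffelVar g (h + h')) z =
      (raiseLast (inv g) (christoffelVar g h) + raiseLast (inv g) (christoffelVar g h')) z := by
    filter_upwards [hdiff hh, hdiff hh'] with z hz hz'
    funext a i j
    simp only [raiseLast, christoffelVar, Pi.add_apply, cov2_add g hz hz',
      ← Finset.sum_add_distrib]
    exact Finset.sum_congr rfl fun _ _ => by ring
  rw [ricciVar, ricciPolar_congr _ hC]
  exact ricciPolar_add _
    (hg.differentiableAt_raiseLast one_le_two (hg.differentiableAt_christoffelVar hh))
    (hg.differentiableAt_raiseLast one_le_two (hg.differentiableAt_christoffelVar hh')) j l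

/- The gauge term `L_{(B h)^♯} g = 2 δ^* B h` turns `(1/2) (Δ_L + 2 n) - δ^* B`, which is the
linearization of `Ric + n` by `ricciVar_eq`, into `(1/2) 𝓛`. -/
theorem IsMetricAt.half_einsteinLin_add_lichN {g Θ A : Cov2 n ℝ} (hg : IsMetricAt 2 g y)
    (hΘs : ∀ z i j, Θ z i j = Θ z j i) (hAs : ∀ z i j, A z i j = A z j i)
    (hΘ : ∀ i j, ContDiffAt ℝ 2 (fun z => Θ z i j) y)
    (hA : ∀ i j, ContDiffAt ℝ 2 (fun z => A z i j) y) (i j : Fin (n + 1)) :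
    (1 / 2 : ℝ) * (einsteinLin g Θ y i j + lichN g A y i j) =
      ricciVar g Θ y i j + ricciVar g A y i j + n * (Θ y i j + A y i j)
        + deltaStar g (bianchi g A) y i j := by
  rw [hg.ricciVar_eq hΘs hΘ, hg.ricciVar_eq hAs hA, einsteinLin,
    hg.lieDeriv_sharp one_le_two (hg.differentiableAt_bianchi hΘ), lichN, lichN]
  ring

theorem dCov0_smul (B : 𝔩 →L[ℝ] 𝔩 →L[ℝ] 𝔩) (ϖ : Cov1 n 𝔩) (c : ℝ) (f : Vec n → 𝔩) :
    dCov0 (B · ·) ϖ (c • f) = c • dCov0 (B · ·) ϖ f := by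
  funext y i
  have hpd : pd i (c • f) y = c • pd i f y := pd_const_smul c f i
  simp only [dCov0, hpd, Pi.smul_apply, map_smul, smul_add]

theorem dCov1_smul (B : 𝔩 →L[ℝ] 𝔩 →L[ℝ] 𝔩) (ϖ : Cov1 n 𝔩) (c : ℝ) (a : Cov1 n 𝔩) :
    dCov1 (B · ·) ϖ (c • a) = c • dCov1 (B · ·) ϖ a := by
  funext y i j
  simp only [dCov1, Pi.smul_apply, pd_const_smul, map_smul, smul_sub, smul_add]

theorem dCov1_add (B : 𝔩 →L[ℝ] 𝔩 →L[ℝ] 𝔩) (ϖ : Cov1 n 𝔩) {a a' : Cov1 n 𝔩}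
    (ha : ∀ i, DifferentiableAt ℝ (fun z => a z i) y)
    (ha' : ∀ i, DifferentiableAt ℝ (fun z => a' z i) y) :
    dCov1 (B · ·) ϖ (a + a') y = dCov1 (B · ·) ϖ a y + dCov1 (B · ·) ϖ a' y := by
  funext i j
  simp only [dCov1, Pi.add_apply, pd_add (ha _) (ha' _), map_add]
  abel

theorem dStar1_smul (B : 𝔩 →L[ℝ] 𝔩 →L[ℝ] 𝔩) (g : Cov2 n ℝ) (ϖ : Cov1 n 𝔩) (c : ℝ)
    (a : Cov1 n 𝔩) : dStar1 (B · ·) g ϖ (c • a) = c • dStar1 (B · ·) g ϖ a := by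
  funext y
  simp only [dStar1, cov1_smul, Pi.smul_apply, map_smul, ← smul_add, smul_comm _ c,
    ← Finset.smul_sum, smul_neg]

theorem dStar2_smul (B : 𝔩 →L[ℝ] 𝔩 →L[ℝ] 𝔩) (g : Cov2 n ℝ) (ϖ : Cov1 n 𝔩) (c : ℝ)
    (Φ : Cov2 n 𝔩) : dStar2 (B · ·) g ϖ (c • Φ) = c • dStar2 (B · ·) g ϖ Φ := by
  funext y j
  simp only [dStar2, cov2_smul, Pi.smul_apply, map_smul, ← smul_add, smul_comm _ c,
    ← Finset.smul_sum, smul_neg]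

theorem dStar2_add (B : 𝔩 →L[ℝ] 𝔩 →L[ℝ] 𝔩) (g : Cov2 n ℝ) (ϖ : Cov1 n 𝔩) {Φ Φ' : Cov2 n 𝔩}
    (hΦ : ∀ i j, DifferentiableAt ℝ (fun z => Φ z i j) y)
    (hΦ' : ∀ i j, DifferentiableAt ℝ (fun z => Φ' z i j) y) (j : Fin (n + 1)) :
    dStar2 (B · ·) g ϖ (Φ + Φ') y j = dStar2 (B · ·) g ϖ Φ y j + dStar2 (B · ·) g ϖ Φ' y j := by
  simp only [dStar2, cov2_add g hΦ hΦ', Pi.add_apply, map_add, ← neg_add,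
    ← Finset.sum_add_distrib, ← smul_add, add_add_add_comm]

theorem dStar2_congr (B : 𝔩 →L[ℝ] 𝔩 →L[ℝ] 𝔩) (g : Cov2 n ℝ) (ϖ : Cov1 n 𝔩) {Φ Φ' : Cov2 n 𝔩}
    (he : ∀ᶠ z in 𝓝 y, Φ z = Φ' z) (j : Fin (n + 1)) :
    dStar2 (B · ·) g ϖ Φ y j = dStar2 (B · ·) g ϖ Φ' y j := by
  simp only [dStar2, cov2_congr g he, he.self_of_nhds]

theorem dStar2_dCov1_add (B : 𝔩 →L[ℝ] 𝔩 →L[ℝ] 𝔩) (g : Cov2 n ℝ) {ϖ a a' : Cov1 n 𝔩}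
    (hϖ : ∀ i, DifferentiableAt ℝ (fun z => ϖ z i) y)
    (ha : ∀ i, ContDiffAt ℝ 2 (fun z => a z i) y) (ha' : ∀ i, ContDiffAt ℝ 2 (fun z => a' z i) y)
    (j : Fin (n + 1)) :
    dStar2 (B · ·) g ϖ (dCov1 (B · ·) ϖ (a + a')) y j =
      dStar2 (B · ·) g ϖ (dCov1 (B · ·) ϖ a) y j + dStar2 (B · ·) g ϖ (dCov1 (B · ·) ϖ a') y j := by
  have hdiff : ∀ {a : Cov1 n 𝔩}, (∀ i, ContDiffAt ℝ 2 (fun z => a z i) y) →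
      ∀ᶠ z in 𝓝 y, ∀ i, DifferentiableAt ℝ (fun z => a z i) z := fun ha =>
    eventually_all.2 fun i =>
      ((ha i).eventually (by simp)).mono fun _ hz => hz.differentiableAt two_ne_zero
  have hd : ∀ {a : Cov1 n 𝔩}, (∀ i, ContDiffAt ℝ 2 (fun z => a z i) y) →
      ∀ i j, DifferentiableAt ℝ (fun z => dCov1 (B · ·) ϖ a z i j) y := fun {a} ha i j => by
    have hpd : ∀ i j, DifferentiableAt ℝ (pd i fun z => a z j) y := fun i j =>
      differentiableAt_pd (ha j) i
    have hB : ∀ i j, DifferentiableAt ℝ (fun z => B (ϖ z i) (a z j)) y := fun i j =>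
      (B.differentiableAt.comp y (hϖ i)).clm_apply ((ha j).differentiableAt two_ne_zero)
    exact (((hpd i j).fun_sub (hpd j i)).fun_add (hB i j)).fun_sub (hB j i)
  have he : ∀ᶠ z in 𝓝 y, dCov1 (B · ·) ϖ (a + a') z =
      (dCov1 (B · ·) ϖ a + dCov1 (B · ·) ϖ a') z := by
    filter_upwards [hdiff ha, hdiff ha'] with z hz hz' using dCov1_add B ϖ hz hz'
  rw [dStar2_congr B g ϖ he, dStar2_add B g ϖ (hd ha) (hd ha')]

theorem hodge1_smul (B : 𝔩 →L[ℝ] 𝔩 →L[ℝ] 𝔩) (g : Cov2 n ℝ) (ϖ : Cov1 n 𝔩) (c : ℝ)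
    (a : Cov1 n 𝔩) : hodge1 (B · ·) g ϖ (c • a) = c • hodge1 (B · ·) g ϖ a := by
  funext y i
  simp only [hodge1, dStar1_smul, dCov0_smul, dCov1_smul, dStar2_smul, Pi.smul_apply, smul_add]

end Linearity

section LocalRemainder

variable {n : ℕ} {F : Type*} [NormedAddCommGroup F] [NormedSpace ℝ F]
  {𝔩 : Type*} [NormedAddCommGroup 𝔩] [NormedSpace ℝ 𝔩] {X : Type*} {𝒥 : JetParam n X}
  {y : Vec n} {r : ℝ}

/-- `f` is of class `C^2` at `y`, and its partial derivatives of order at most two there are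
bounded by `r`. -/
def JetLe (f : Vec n → F) (y : Vec n) (r : ℝ) : Prop :=
  ContDiffAt ℝ 2 f y ∧ ‖f y‖ ≤ r ∧ (∀ k, ‖pd k f y‖ ≤ r) ∧ ∀ k l, ‖pd k (pd l f) y‖ ≤ r

theorem jetLe_zero : JetLe (fun _ : Vec n => (0 : F)) y 0 := by
  have hpd : ∀ l, (pd l fun _ : Vec n => (0 : F)) = fun _ => 0 := fun l =>
    funext fun z => by simp [pd]
  simp [JetLe, hpd, contDiffAt_const]

theorem JetLe.smul {f : Vec n → F} (hf : JetLe f y r) (t : ℝ) :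
    JetLe (fun z => t • f z) y (|t| * r) := by
  have hpd : ∀ l, (pd l fun z => t • f z) = fun z => t • pd l f z := fun l =>
    funext fun _ => pd_const_smul t f l
  simp only [JetLe, hpd, pd_const_smul, norm_smul, Real.norm_eq_abs]
  exact ⟨hf.1.const_smul t, by gcongr; exact hf.2.1, fun k => by gcongr; exact hf.2.2.1 k,
    fun k l => by gcongr; exact hf.2.2.2 k l⟩

theorem eventually_jetLe {f : Vec n → F} (hf : ContDiffAt ℝ 2 f y) :
    ∀ᶠ r in atTop, JetLe f y r :=
  (Eventually.of_forall fun _ => hf).and <| (eventually_ge_atTop _).and <|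
    (eventually_all.2 fun _ => eventually_ge_atTop _).and <|
      eventually_all.2 fun _ => eventually_all.2 fun _ => eventually_ge_atTop _

theorem JetO.of_jetLe {f : X → Vec n → F} (hf : ∀ x ∈ 𝒥.S, JetLe (f x) (𝒥.pt x) (𝒥.r x)) :
    JetO 𝒥 2 1 f := by
  have hO : ∀ e : X → Vec n → F, (∀ x ∈ 𝒥.S, ‖e x (𝒥.pt x)‖ ≤ 𝒥.r x) →
      (fun x => e x (𝒥.pt x)) =O[𝓟 𝒥.S] fun x => 𝒥.r x ^ 1 := fun e he =>
    IsBigO.of_bound 1 <| eventually_principal.2 fun x hx => by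
      rw [one_mul, pow_one, Real.norm_of_nonneg (𝒥.r_nonneg x hx)]
      exact he x hx
  exact ⟨hO _ fun x hx => (hf x hx).2.1, fun x hx => (hf x hx).1, fun j =>
    ⟨hO _ fun x hx => (hf x hx).2.2.1 j, fun x hx => contDiffAt_pd (hf x hx).1 (by norm_num) j,
      fun i => hO _ fun x hx => (hf x hx).2.2.2 i j⟩⟩

theorem JetO.eventually_norm_le {p : ℕ} {f : X → Vec n → F} (hf : JetO 𝒥 0 p f) :
    ∀ᶠ C : ℝ in atTop, ∀ x ∈ 𝒥.S, ‖f x (𝒥.pt x)‖ ≤ C * 𝒥.r x ^ p := by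
  filter_upwards [isBigO_iff_eventually.1 hf.isBigO] with C hC x hx
  simpa only [Real.norm_of_nonneg (pow_nonneg (𝒥.r_nonneg x hx) p)] using
    eventually_principal.1 hC x hx

theorem exists_inv_bound {g : Cov2 n ℝ} {K : Set (Vec n)} (hK : IsCompact K)
    (hg : ∀ i j, ContinuousOn (fun z => g z i j) K)
    (hdet : ∀ z ∈ K, (Matrix.of (g z)).det ≠ 0) :
    ∃ ρ > 0, ∃ C, ∀ z ∈ K, ∀ h : Fin (n + 1) → Fin (n + 1) → ℝ, (∀ i j, |h i j| ≤ ρ) →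
      (Matrix.of (g z + h)).det ≠ 0 ∧ ∀ i j, |(Matrix.of (g z + h))⁻¹ i j| ≤ C := by
  set V : Set (Fin (n + 1) → Fin (n + 1) → ℝ) := {A | (Matrix.of A).det ≠ 0}
  have hcont : Continuous fun A : Fin (n + 1) → Fin (n + 1) → ℝ => Matrix.of A := continuous_id
  have hV : IsOpen V := isOpen_ne.preimage hcont.matrix_det
  have hK' : IsCompact (g '' K) := hK.image_of_continuousOn
    (continuousOn_pi.2 fun i => continuousOn_pi.2 fun j => hg i j)
  obtain ⟨δ, hδ, hsub⟩ := hK'.exists_cthickening_subset_open hV (by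
    rintro _ ⟨z, hz, rfl⟩; exact hdet z hz)
  have hinv : ContinuousOn (fun A : Fin (n + 1) → Fin (n + 1) → ℝ =>
      fun i j => (Matrix.of A)⁻¹ i j) V := by
    refine continuousOn_pi.2 fun i => continuousOn_pi.2 fun j => ?_
    simp only [Matrix.inv_def, Ring.inverse_eq_inv', Matrix.smul_apply, smul_eq_mul]
    exact (hcont.matrix_det.continuousOn.inv₀ fun A hA => hA).mul
      (hcont.matrix_adjugate.matrix_elem i j).continuousOn
  obtain ⟨C, hC⟩ := hK'.cthickening.exists_bound_of_continuousOn (hinv.mono hsub)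
  refine ⟨δ, hδ, C, fun z hz h hh => ?_⟩
  have hmem : g z + h ∈ Metric.cthickening δ (g '' K) := by
    refine Metric.mem_cthickening_of_dist_le _ _ _ _ ⟨z, hz, rfl⟩ ?_
    rw [dist_eq_norm, add_sub_cancel_left]
    exact (pi_norm_le_iff_of_nonneg hδ.le).2 fun i =>
      (pi_norm_le_iff_of_nonneg hδ.le).2 fun j => hh i j
  refine ⟨hsub hmem, fun i j => ?_⟩
  have h1 := norm_le_pi_norm (fun i j => (Matrix.of (g z + h))⁻¹ i j) i
  have h2 := norm_le_pi_norm (fun j => (Matrix.of (g z + h))⁻¹ i j) j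
  exact (h2.trans h1).trans (hC _ hmem)

theorem exists_metricClose_add {g : Cov2 n ℝ} {K : Set (Vec n)} (hK : IsCompact K)
    (hg : ∀ z ∈ K, IsMetricAt 2 g z) :
    ∃ ρ > 0, ∀ (𝒥 : JetParam n X) (h : X → Cov2 n ℝ), (∀ x ∈ 𝒥.S, 𝒥.pt x ∈ K) →
      (∀ x ∈ 𝒥.S, ∀ z i j, h x z i j = h x z j i) → (∀ i j, JetO 𝒥 2 1 fun x z => h x z i j) →
      (∀ x ∈ 𝒥.S, ∀ i j, |h x (𝒥.pt x) i j| ≤ ρ) →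
      (∀ x ∈ 𝒥.S, IsMetricAt 2 (g + h x) (𝒥.pt x)) ∧
        MetricClose 𝒥 1 (fun x => g + h x) fun _ => g := by
  obtain ⟨ρ, hρ, C, hC⟩ := exists_inv_bound (g := g) hK
    (fun i j z hz => ((hg z hz).smooth i j).continuousAt.continuousWithinAt)
    (fun z hz => (hg z hz).det_ne)
  refine ⟨ρ, hρ, fun 𝒥 h hpt hs hh hb => ?_⟩
  have hm : ∀ x ∈ 𝒥.S, IsMetricAt 2 (g + h x) (𝒥.pt x) := fun x hx =>
    ⟨fun z i j => congrArg₂ (· + ·) ((hg _ (hpt x hx)).symm z i j) (hs x hx z i j),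
      fun i j => ((hg _ (hpt x hx)).smooth i j).add ((hh i j).contDiffAt hx),
      (hC _ (hpt x hx) _ (hb x hx)).1⟩
  have hclose : ∀ i j, JetClose 𝒥 2 0 (fun x z => (g + h x) z i j) (fun _ z => g z i j) :=
    fun i j => .of_add (.of_contDiffAt hK hpt fun z hz => (hg z hz).smooth i j) (hh i j)
  have hbdd : ∀ e : X → Vec n → ℝ, (∀ x ∈ 𝒥.S, |e x (𝒥.pt x)| ≤ C) → JetO 𝒥 0 0 e :=
    fun e he => IsBigO.of_bound C <| eventually_principal.2 fun x hx => by simpa using he x hx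
  have hbddInv : ∀ i j, JetO 𝒥 0 0 fun x z => inv (g + h x) z i j := fun i j =>
    hbdd _ fun x hx => (hC _ (hpt x hx) _ (hb x hx)).2 i j
  have hbddInv' : ∀ i j, JetO 𝒥 0 0 fun _ z => inv g z i j := fun i j => hbdd _ fun x hx => by
    simpa [inv] using (hC _ (hpt x hx) 0 fun i j => by simpa using hρ.le).2 i j
  exact ⟨hm, hclose, JetClose.inv hclose (fun x hx => (hm x hx).det_ne)
    (fun x hx => (hg _ (hpt x hx)).det_ne) hbddInv hbddInv'⟩

/-- The metric block `(1/2) (𝓛_g Θ + (Δ_L + 2 n) A)` of the linearization, in components. -/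
noncomputable def metricLin (g Θ A : Cov2 n ℝ) : Cov2 n ℝ := fun y i j =>
  (1 / 2 : ℝ) * (einsteinLin g Θ y i j + lichN g A y i j)

/-- The connection block `d^*_ϖ d_ϖ ε + Δ^1_ϖ a` of the linearization, in components. -/
noncomputable def connLin (B : 𝔩 →L[ℝ] 𝔩 →L[ℝ] 𝔩) (g : Cov2 n ℝ) (ϖ ε a : Cov1 n 𝔩) : Cov1 n 𝔩 :=
  dStar2 (B · ·) g ϖ (dCov1 (B · ·) ϖ ε) + hodge1 (B · ·) g ϖ a

theorem IsMetricAt.metricLin_smul {g Θ A : Cov2 n ℝ} (hg : IsMetricAt 2 g y)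
    (hΘs : ∀ z i j, Θ z i j = Θ z j i) (hAs : ∀ z i j, A z i j = A z j i)
    (hΘ : ∀ i j, ContDiffAt ℝ 2 (fun z => Θ z i j) y)
    (hA : ∀ i j, ContDiffAt ℝ 2 (fun z => A z i j) y) (t : ℝ) (i j : Fin (n + 1)) :
    metricLin g (t • Θ) (t • A) y i j = t * metricLin g Θ A y i j := by
  rw [metricLin, metricLin, hg.half_einsteinLin_add_lichN hΘs hAs hΘ hA,
    hg.half_einsteinLin_add_lichN (Θ := t • Θ) (A := t • A)
      (fun z i j => congrArg (t * ·) (hΘs z i j)) (fun z i j => congrArg (t * ·) (hAs z i j))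
      (fun i j => (hΘ i j).const_smul t) (fun i j => (hA i j).const_smul t),
    ricciVar_smul, ricciVar_smul, bianchi_smul, deltaStar_smul]
  simp only [Pi.smul_apply, smul_eq_mul]
  ring

theorem connLin_smul (B : 𝔩 →L[ℝ] 𝔩 →L[ℝ] 𝔩) (g : Cov2 n ℝ) (ϖ ε a : Cov1 n 𝔩) (t : ℝ) :
    connLin B g ϖ (t • ε) (t • a) = t • connLin B g ϖ ε a := by
  rw [connLin, connLin, dCov1_smul, dStar2_smul, hodge1_smul, smul_add]

theorem JetO.opQ_sub_metricLin {B : 𝔩 →L[ℝ] 𝔩 →L[ℝ] 𝔩} {q : 𝔩 →L[ℝ] 𝔩 →L[ℝ] ℝ}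
    {g Θ A : X → Cov2 n ℝ} {ϖ ε a : X → Cov1 n 𝔩}
    (hm : ∀ x ∈ 𝒥.S, IsMetricAt 2 (g x) (𝒥.pt x))
    (hm₂ : ∀ x ∈ 𝒥.S, IsMetricAt 2 (g x + (Θ x + A x)) (𝒥.pt x))
    (hg₁ : MetricClose 𝒥 1 (fun x => g x + Θ x) g)
    (hg₂ : MetricClose 𝒥 1 (fun x => g x + (Θ x + A x)) g)
    (hΘs : ∀ x ∈ 𝒥.S, ∀ z i j, Θ x z i j = Θ x z j i)
    (hAs : ∀ x ∈ 𝒥.S, ∀ z i j, A x z i j = A x z j i)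
    (hΘ : ∀ i j, JetO 𝒥 2 1 fun x z => Θ x z i j) (hA : ∀ i j, JetO 𝒥 2 1 fun x z => A x z i j)
    (heinstein : ∀ x ∈ 𝒥.S, ∀ i j, ricci (g x) (𝒥.pt x) i j = -(n : ℝ) * g x (𝒥.pt x) i j)
    (hstress : ∀ i j, JetO 𝒥 0 2 fun x z => EYM.stressMod (B · ·) q (g x + (Θ x + A x))
      (ϖ x + (ε x + a x)) z i j) (i j : Fin (n + 1)) :
    JetO 𝒥 0 2 fun x z => opQ (B · ·) q (g x) (Θ x) (A x) (ϖ x) (ε x) (a x) z i j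
      - metricLin (g x) (Θ x) (A x) z i j := by
  have hricci := JetO.ricci_add_sub hm hm₂ hg₂ (fun i j => (hΘ i j).add (hA i j)) i j
  have hgauge := (hg₂.pred.deltaStar (hg₁.bianchi fun i j => .refl (hA i j)) i j).sub
  refine IsBigO.congr' ((hricci.sub (hstress i j)).add hgauge)
    (eventually_principal.2 fun x hx => ?_) EventuallyEq.rfl
  have hΘx := fun i j => (hΘ i j).contDiffAt hx
  have hAx := fun i j => (hA i j).contDiffAt hx
  have hadd := (hm x hx).ricciVar_add hΘx hAx i j
  simp only [metricLin, (hm x hx).half_einsteinLin_add_lichN (hΘs x hx) (hAs x hx) hΘx hAx, opQ,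
    add_assoc (g x), add_assoc (ϖ x), heinstein x hx]
  simp only [Pi.add_apply]
  linear_combination -hadd

theorem JetO.opR_sub_connLin {B : 𝔩 →L[ℝ] 𝔩 →L[ℝ] 𝔩} (hB : ∀ u v, B u v = -B v u)
    {g Θ A : X → Cov2 n ℝ} {ϖ ε a : X → Cov1 n 𝔩}
    (hg₁ : MetricClose 𝒥 1 (fun x => g x + Θ x) g)
    (hg₂ : MetricClose 𝒥 1 (fun x => g x + (Θ x + A x)) g)
    (hϖ : ∀ i, JetO 𝒥 2 0 fun x z => ϖ x z i) (hε : ∀ i, JetO 𝒥 2 1 fun x z => ε x z i)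
    (ha : ∀ i, JetO 𝒥 2 1 fun x z => a x z i)
    (hflat : ∀ x ∈ 𝒥.S, ∀ᶠ z in 𝓝 (𝒥.pt x), ∀ i j, ymCurv (B · ·) (ϖ x) z i j = 0)
    (i : Fin (n + 1)) :
    JetO 𝒥 0 2 fun x z => opR (B · ·) (g x) (Θ x) (A x) (ϖ x) (ε x) (a x) z i
      - connLin B (g x) (ϖ x) (ε x) (a x) z i := by
  have hϖ₁ : ∀ i, JetClose 𝒥 2 0 (fun x z => (ϖ x + ε x) z i) fun x z => ϖ x z i :=
    fun i => .of_add (hϖ i) (hε i)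
  have hεa : ∀ i, JetO 𝒥 2 1 fun x z => (ε x + a x) z i := fun i => (hε i).add (ha i)
  have hϖ₂ : ∀ i, JetClose 𝒥 2 0 (fun x z => (ϖ x + (ε x + a x)) z i) fun x z => ϖ x z i :=
    fun i => .of_add (hϖ i) (hεa i)
  have hdiv := (hg₂.pred.dStar2 B (fun i => (hϖ₂ i).pred.pred)
    (JetClose.ymCurv B hB hϖ hεa hflat) i).sub
  have hgauge := (JetClose.dCov0 B (fun i => (hϖ₂ i).pred.pred)
    (hg₁.dStar1 B (fun i => (hϖ₁ i).pred) fun i => .refl (ha i)) i).sub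
  refine IsBigO.congr' (hdiv.add hgauge) (eventually_principal.2 fun x hx => ?_) EventuallyEq.rfl
  have hadd := dStar2_dCov1_add B (g x) (fun i => (hϖ i).differentiableAt hx)
    (fun i => (hε i).contDiffAt hx) (fun i => (ha i).contDiffAt hx) i
  simp only [opR, connLin, hodge1, add_assoc (g x), add_assoc (ϖ x), Pi.add_apply, hadd]
  abel

end LocalRemainder

section Perturbation

variable {n : ℕ} {𝔩 : Type*} [NormedAddCommGroup 𝔩] [NormedSpace ℝ 𝔩]
  {B : 𝔩 →L[ℝ] 𝔩 →L[ℝ] 𝔩} {g : Cov2 n ℝ} {ϖ : Cov1 n 𝔩} {U : Set (Vec n)}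

/-- `(g, ϖ)` are the components, on an open set `U`, of a trivial configuration: an Einstein metric
and a flat connection, both of class `C^2`. -/
structure IsTrivialOn (B : 𝔩 →L[ℝ] 𝔩 →L[ℝ] 𝔩) (g : Cov2 n ℝ) (ϖ : Cov1 n 𝔩) (U : Set (Vec n)) :
    Prop where
  isOpen : IsOpen U
  isMetricAt : ∀ z ∈ U, IsMetricAt 2 g z
  contDiffAt : ∀ z ∈ U, ∀ i, ContDiffAt ℝ 2 (fun w => ϖ w i) z
  einstein : ∀ z ∈ U, ∀ i j, ricci g z i j = -(n : ℝ) * g z i j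
  flat : ∀ z ∈ U, ∀ i j, ymCurv (B · ·) ϖ z i j = 0

/-- A perturbation `(Θ, A; ε, a)` of a metric and a connection, with a base point `y` and a
size `r`. -/
structure Perturbation (n : ℕ) (𝔩 : Type*) where
  Θ : Cov2 n ℝ
  A : Cov2 n ℝ
  ε : Cov1 n 𝔩
  a : Cov1 n 𝔩
  y : Vec n
  r : ℝ

theorem hasDerivAt_of_norm_sub_smul_le {F : Type*} [NormedAddCommGroup F] [NormedSpace ℝ F]
    {f : ℝ → F} {f' : F} {C : ℝ} (h : ∀ᶠ t in 𝓝 0, ‖f t - t • f'‖ ≤ C * t ^ 2) :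
    HasDerivAt f f' 0 := by
  have h0 : f 0 = 0 := by simpa using h.self_of_nhds
  have hquad : (fun t => f (0 + t) - f 0 - t • f') =O[𝓝 0] fun t => t ^ 2 :=
    IsBigO.of_bound C <| h.mono fun t ht => by
      simpa only [zero_add, h0, sub_zero, Real.norm_of_nonneg (sq_nonneg t)] using ht
  rw [hasDerivAt_iff_isLittleO_nhds_zero]
  exact hquad.trans_isLittleO (by
    simpa only [pow_one] using isLittleO_pow_pow (𝕜 := ℝ) (m := 1) (n := 2) one_lt_two)

namespace Perturbation

/-- The metric perturbations are symmetric, and all 2-jets at the base point are bounded by the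
size. -/
structure IsAdmissible (x : Perturbation n 𝔩) : Prop where
  symm_Θ : ∀ z i j, x.Θ z i j = x.Θ z j i
  symm_A : ∀ z i j, x.A z i j = x.A z j i
  jet_Θ : ∀ i j, JetLe (fun z => x.Θ z i j) x.y x.r
  jet_A : ∀ i j, JetLe (fun z => x.A z i j) x.y x.r
  jet_ε : ∀ i, JetLe (fun z => x.ε z i) x.y x.r
  jet_a : ∀ i, JetLe (fun z => x.a z i) x.y x.r

/-- The admissible perturbations of size at most `min ρ 1` with base point in `K`. -/
def jetParam (n : ℕ) (𝔩 : Type*) [NormedAddCommGroup 𝔩] [NormedSpace ℝ 𝔩] (K : Set (Vec n))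
    (ρ : ℝ) : JetParam n (Perturbation n 𝔩) where
  S := {x | x.IsAdmissible ∧ x.y ∈ K ∧ x.r ≤ min ρ 1}
  r := r
  pt := y
  r_nonneg := fun _ hx => (norm_nonneg _).trans (hx.1.jet_Θ 0 0).2.1
  r_le_one := fun _ hx => hx.2.2.trans (min_le_right _ _)

/-- The gauged operator agrees with its linearization up to `C r ^ 2` at the base point, and the
modified stress-energy tensor is bounded by `C r ^ 2` there. -/
structure RemainderLe (B : 𝔩 →L[ℝ] 𝔩 →L[ℝ] 𝔩) (q : 𝔩 →L[ℝ] 𝔩 →L[ℝ] ℝ) (g : Cov2 n ℝ)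
    (ϖ : Cov1 n 𝔩) (C : ℝ) (x : Perturbation n 𝔩) : Prop where
  metric : ∀ i j, ‖opQ (B · ·) q g x.Θ x.A ϖ x.ε x.a x.y i j - metricLin g x.Θ x.A x.y i j‖
    ≤ C * x.r ^ 2
  connection : ∀ i, ‖opR (B · ·) g x.Θ x.A ϖ x.ε x.a x.y i - connLin B g ϖ x.ε x.a x.y i‖
    ≤ C * x.r ^ 2
  stress : ∀ i j, ‖stressMod (B · ·) q (g + x.Θ + x.A) (ϖ + x.ε + x.a) x.y i j‖ ≤ C * x.r ^ 2

theorem eventually_remainderLe (hB : ∀ u v, B u v = -B v u) (q : 𝔩 →L[ℝ] 𝔩 →L[ℝ] ℝ)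
    (hc : IsTrivialOn B g ϖ U) {K : Set (Vec n)} (hK : IsCompact K) (hKU : K ⊆ U) {ρ : ℝ}
    (hm₂ : ∀ x ∈ (jetParam n 𝔩 K ρ).S, IsMetricAt 2 (g + (x.Θ + x.A)) x.y)
    (hg₁ : MetricClose (jetParam n 𝔩 K ρ) 1 (fun x => g + x.Θ) fun _ => g)
    (hg₂ : MetricClose (jetParam n 𝔩 K ρ) 1 (fun x => g + (x.Θ + x.A)) fun _ => g) :
    ∀ᶠ C in atTop, ∀ x ∈ (jetParam n 𝔩 K ρ).S, x.RemainderLe B q g ϖ C := by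
  set 𝒥 := jetParam n 𝔩 K ρ
  have hU : ∀ x ∈ 𝒥.S, x.y ∈ U := fun x hx => hKU hx.2.1
  have hΘ : ∀ i j, JetO 𝒥 2 1 fun x z => x.Θ z i j := fun i j =>
    .of_jetLe fun x hx => hx.1.jet_Θ i j
  have hA : ∀ i j, JetO 𝒥 2 1 fun x z => x.A z i j := fun i j =>
    .of_jetLe fun x hx => hx.1.jet_A i j
  have hε : ∀ i, JetO 𝒥 2 1 fun x z => x.ε z i := fun i => .of_jetLe fun x hx => hx.1.jet_ε i
  have ha : ∀ i, JetO 𝒥 2 1 fun x z => x.a z i := fun i => .of_jetLe fun x hx => hx.1.jet_a i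
  have hϖ : ∀ i, JetO 𝒥 2 0 fun _ z => ϖ z i := fun i =>
    .of_contDiffAt (𝒥 := 𝒥) hK (fun x hx => hx.2.1) fun z hz => hc.contDiffAt z (hKU hz) i
  have hflat : ∀ x ∈ 𝒥.S, ∀ᶠ z in 𝓝 (𝒥.pt x), ∀ i j, ymCurv (B · ·) ϖ z i j = 0 :=
    fun x hx => eventually_of_mem (hc.isOpen.mem_nhds (hU x hx)) hc.flat
  have hΩ := JetClose.ymCurv (ϖ := fun _ => ϖ) B hB hϖ (fun i => (hε i).add (ha i)) hflat
  have hstress : ∀ i j, JetO 𝒥 0 2 fun x z =>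
      stressMod (B · ·) q (g + (x.Θ + x.A)) (ϖ + (x.ε + x.a)) z i j :=
    JetO.stressMod B q (fun i j => (hg₂.metric i j).left.pred.pred)
      (fun i j => (hg₂.inv i j).left.pred.pred) fun i j => (hΩ i j).left.pred
  have hQ := JetO.opQ_sub_metricLin (fun x hx => hc.isMetricAt _ (hU x hx)) hm₂ hg₁ hg₂
    (fun x hx => hx.1.symm_Θ) (fun x hx => hx.1.symm_A) hΘ hA
    (fun x hx => hc.einstein _ (hU x hx)) hstress
  have hR := JetO.opR_sub_connLin hB hg₁ hg₂ hϖ hε ha hflat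
  filter_upwards [eventually_all.2 fun i => eventually_all.2 fun j => (hQ i j).eventually_norm_le,
    eventually_all.2 fun i => (hR i).eventually_norm_le,
    eventually_all.2 fun i => eventually_all.2 fun j => (hstress i j).eventually_norm_le]
    with C h₁ h₂ h₃ x hx
  exact ⟨fun i j => h₁ i j x hx, fun i => h₂ i x hx, fun i j => by
    rw [add_assoc g, add_assoc ϖ]; exact h₃ i j x hx⟩

theorem exists_remainderLe (hB : ∀ u v, B u v = -B v u) (q : 𝔩 →L[ℝ] 𝔩 →L[ℝ] ℝ)
    (hc : IsTrivialOn B g ϖ U) {K : Set (Vec n)} (hK : IsCompact K) (hKU : K ⊆ U) :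
    ∃ C, ∃ ρ > 0, ∀ x : Perturbation n 𝔩, x.IsAdmissible → x.y ∈ K → x.r ≤ ρ →
      x.RemainderLe B q g ϖ C := by
  obtain ⟨ρ, hρ, hadd⟩ := exists_metricClose_add (X := Perturbation n 𝔩) hK fun z hz =>
    hc.isMetricAt z (hKU hz)
  set 𝒥 := jetParam n 𝔩 K (ρ / 2)
  have hr : ∀ x ∈ 𝒥.S, x.r ≤ ρ / 2 := fun x hx => hx.2.2.trans (min_le_left _ _)
  have hΘ : ∀ i j, JetO 𝒥 2 1 fun x z => x.Θ z i j := fun i j =>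
    .of_jetLe fun x hx => hx.1.jet_Θ i j
  have hA : ∀ i j, JetO 𝒥 2 1 fun x z => x.A z i j := fun i j =>
    .of_jetLe fun x hx => hx.1.jet_A i j
  have hΘr : ∀ x ∈ 𝒥.S, ∀ i j, |x.Θ x.y i j| ≤ ρ / 2 := fun x hx i j =>
    (hx.1.jet_Θ i j).2.1.trans (hr x hx)
  have hAr : ∀ x ∈ 𝒥.S, ∀ i j, |x.A x.y i j| ≤ ρ / 2 := fun x hx i j =>
    (hx.1.jet_A i j).2.1.trans (hr x hx)
  obtain ⟨-, hg₁⟩ := hadd 𝒥 Perturbation.Θ (fun x hx => hx.2.1) (fun x hx => hx.1.symm_Θ) hΘ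
    fun x hx i j => (hΘr x hx i j).trans (half_le_self hρ.le)
  obtain ⟨hm₂, hg₂⟩ := hadd 𝒥 (fun x => x.Θ + x.A) (fun x hx => hx.2.1)
    (fun x hx z i j => congrArg₂ (· + ·) (hx.1.symm_Θ z i j) (hx.1.symm_A z i j))
    (fun i j => (hΘ i j).add (hA i j)) fun x hx i j =>
      (abs_add_le _ _).trans ((add_le_add (hΘr x hx i j) (hAr x hx i j)).trans_eq (add_halves ρ))
  obtain ⟨C, hC⟩ := (eventually_remainderLe hB q hc hK hKU hm₂ hg₁ hg₂).exists
  exact ⟨C, min (ρ / 2) 1, by positivity, fun x hx hy hr => hC x ⟨hx, hy, hr⟩⟩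

/-- The perturbation `t x`, of size `|t| r`. -/
def scale (t : ℝ) (x : Perturbation n 𝔩) : Perturbation n 𝔩 :=
  ⟨t • x.Θ, t • x.A, t • x.ε, t • x.a, x.y, |t| * x.r⟩

theorem IsAdmissible.scale {x : Perturbation n 𝔩} (hx : x.IsAdmissible) (t : ℝ) :
    (x.scale t).IsAdmissible where
  symm_Θ z i j := congrArg (t * ·) (hx.symm_Θ z i j)
  symm_A z i j := congrArg (t * ·) (hx.symm_A z i j)
  jet_Θ i j := (hx.jet_Θ i j).smul t
  jet_A i j := (hx.jet_A i j).smul t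
  jet_ε i := (hx.jet_ε i).smul t
  jet_a i := (hx.jet_a i).smul t

theorem IsAdmissible.eventually_scale_remainderLe {x : Perturbation n 𝔩} (hx : x.IsAdmissible)
    (hB : ∀ u v, B u v = -B v u) (q : 𝔩 →L[ℝ] 𝔩 →L[ℝ] ℝ) (hc : IsTrivialOn B g ϖ U)
    (hy : x.y ∈ U) : ∃ C, ∀ᶠ t in 𝓝 0, (x.scale t).RemainderLe B q g ϖ C := by
  obtain ⟨C, ρ, hρ, hC⟩ := exists_remainderLe hB q hc isCompact_singleton
    (Set.singleton_subset_iff.2 hy)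
  have hsize : Tendsto (fun t => |t| * x.r) (𝓝 0) (𝓝 0) := by
    simpa using (continuous_abs.mul continuous_const).tendsto (0 : ℝ) (f := fun t => |t| * x.r)
  exact ⟨C, (hsize.eventually_le_const hρ).mono fun t ht => hC _ (hx.scale t) rfl ht⟩

theorem IsAdmissible.hasDerivAt {x : Perturbation n 𝔩} (hx : x.IsAdmissible)
    (hB : ∀ u v, B u v = -B v u) (q : 𝔩 →L[ℝ] 𝔩 →L[ℝ] ℝ) (hc : IsTrivialOn B g ϖ U)
    (hy : x.y ∈ U) :
    (∀ i j, HasDerivAt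
      (fun t : ℝ => opQ (B · ·) q g (t • x.Θ) (t • x.A) ϖ (t • x.ε) (t • x.a) x.y i j)
      (metricLin g x.Θ x.A x.y i j) 0) ∧
    (∀ i, HasDerivAt
      (fun t : ℝ => opR (B · ·) g (t • x.Θ) (t • x.A) ϖ (t • x.ε) (t • x.a) x.y i)
      (connLin B g ϖ x.ε x.a x.y i) 0) ∧
    ∀ i j, HasDerivAt (fun t : ℝ => stressMod (B · ·) q (g + t • x.Θ + t • x.A)
      (ϖ + t • x.ε + t • x.a) x.y i j) 0 0 := by
  obtain ⟨C, hC⟩ := hx.eventually_scale_remainderLe hB q hc hy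
  have hsize : ∀ t, C * (|t| * x.r) ^ 2 = C * x.r ^ 2 * t ^ 2 := fun t => by
    rw [mul_pow, sq_abs]; ring
  refine ⟨fun i j => hasDerivAt_of_norm_sub_smul_le (C := C * x.r ^ 2) <| hC.mono fun t ht => ?_,
    fun i => hasDerivAt_of_norm_sub_smul_le (C := C * x.r ^ 2) <| hC.mono fun t ht => ?_,
    fun i j => hasDerivAt_of_norm_sub_smul_le (C := C * x.r ^ 2) <| hC.mono fun t ht => ?_⟩
  · have hlin := (hc.isMetricAt _ hy).metricLin_smul hx.symm_Θ hx.symm_A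
      (fun i j => (hx.jet_Θ i j).1) (fun i j => (hx.jet_A i j).1) t i j
    rw [smul_eq_mul, ← hlin, ← hsize]
    exact ht.metric i j
  · have hlin : connLin B g ϖ (t • x.ε) (t • x.a) x.y i = t • connLin B g ϖ x.ε x.a x.y i :=
      congrFun₂ (connLin_smul B g ϖ x.ε x.a t) x.y i
    rw [← hlin, ← hsize]
    exact ht.connection i
  · rw [smul_zero, sub_zero, ← hsize]
    exact ht.stress i j

end Perturbation

open Perturbation in
theorem IsTrivialOn.op_zero (hB : ∀ u v, B u v = -B v u) (q : 𝔩 →L[ℝ] 𝔩 →L[ℝ] ℝ)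
    (hc : IsTrivialOn B g ϖ U) {y : Vec n} (hy : y ∈ U) :
    (∀ i j, opQ (B · ·) q g 0 0 ϖ 0 0 y i j = 0) ∧ ∀ i, opR (B · ·) g 0 0 ϖ 0 0 y i = 0 := by
  have hx : IsAdmissible (⟨0, 0, 0, 0, y, 0⟩ : Perturbation n 𝔩) :=
    ⟨fun _ _ _ => rfl, fun _ _ _ => rfl, fun _ _ => jetLe_zero, fun _ _ => jetLe_zero,
      fun _ => jetLe_zero, fun _ => jetLe_zero⟩
  obtain ⟨C, ρ, hρ, hC⟩ := exists_remainderLe hB q hc isCompact_singleton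
    (Set.singleton_subset_iff.2 hy)
  obtain ⟨hQ, hR, -⟩ := hC _ hx rfl hρ.le
  have hmetric : ∀ i j, metricLin g 0 0 y i j = 0 := fun i j => by
    simpa using (hc.isMetricAt y hy).metricLin_smul hx.symm_Θ hx.symm_A
      (fun _ _ => contDiffAt_const) (fun _ _ => contDiffAt_const) 0 i j
  have hconn : connLin B g ϖ 0 0 = 0 := by simpa using connLin_smul B g ϖ 0 0 0
  exact ⟨fun i j => by simpa [hmetric] using hQ i j, fun i => by simpa [hconn] using hR i⟩

end Perturbation

section Charts

variable {n : ℕ} {M : Type*} [TopologicalSpace M] [ChartedSpace (Vec n) M]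
  {φ : OpenPartialHomeomorph M (Vec n)} {y : Vec n} {r : ℕ∞ω}

theorem contMDiffAt_mfderiv_apply {E F N : Type*} [NormedAddCommGroup E] [NormedSpace ℝ E]
    [NormedAddCommGroup F] [NormedSpace ℝ F] [TopologicalSpace N] [ChartedSpace F N]
    [IsManifold 𝓘(ℝ, F) ∞ N] {f : E → N} {V : Set E} (hV : IsOpen V)
    (hf : ContMDiffOn 𝓘(ℝ, E) 𝓘(ℝ, F) ∞ f V) {y : E} (hy : y ∈ V) (v : E) :
    ContMDiffAt 𝓘(ℝ, E) 𝓘(ℝ, F).tangent ∞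
      (fun z => (⟨f z, mfderiv 𝓘(ℝ, E) 𝓘(ℝ, F) f z v⟩ : TangentBundle 𝓘(ℝ, F) N)) y := by
  have htangent := hf.contMDiffOn_tangentMapWithin (m := ∞) (by simp) hV.uniqueMDiffOn
  have hconst : ContMDiff 𝓘(ℝ, E) 𝓘(ℝ, E).tangent ∞
      (fun z : E => (⟨z, v⟩ : TangentBundle 𝓘(ℝ, E) E)) :=
    contMDiff_vectorSpace_iff_contDiff.2 contDiff_const
  have hcomp := (htangent.comp (s := V) hconst.contMDiffOn fun z hz => hz).contMDiffAt
    (hV.mem_nhds hy)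
  refine hcomp.congr_of_eventuallyEq ?_
  filter_upwards [hV.mem_nhds hy] with z hz
  simp only [Function.comp, tangentMapWithin, mfderivWithin_of_isOpen hV hz]

theorem contDiffAt_rep1 {EP P 𝔩 : Type*} [NormedAddCommGroup EP] [NormedSpace ℝ EP]
    [TopologicalSpace P] [ChartedSpace EP P] [IsManifold 𝓘(ℝ, EP) ∞ P] [NormedAddCommGroup 𝔩]
    [NormedSpace ℝ 𝔩] (hφ : φ ∈ IsManifold.maximalAtlas (𝓡 (n + 1)) ∞ M) {s : M → P}
    (hs : ContMDiffOn (𝓡 (n + 1)) 𝓘(ℝ, EP) ∞ s φ.source) (hr : r ≤ ∞) {α : Form1 EP P 𝔩}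
    (hα : IsCForm r α) (hy : y ∈ φ.target) (i : Fin (n + 1)) :
    ContDiffAt ℝ r (fun z => rep1 φ s α z i) y := by
  have hσ : ContMDiffOn (𝓡 (n + 1)) 𝓘(ℝ, EP) ∞ (fun z => s (φ.symm z)) φ.target :=
    hs.comp (contMDiffOn_symm_of_mem_maximalAtlas hφ) fun z hz => φ.map_target hz
  have hbase : ContMDiffAt (𝓡 (n + 1)) 𝓘(ℝ, EP) r (fun z => s (φ.symm z)) y :=
    (hσ.contMDiffAt (φ.open_target.mem_nhds hy)).of_le hr
  have hframe := (contMDiffAt_mfderiv_apply φ.open_target hσ hy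
    (EuclideanSpace.single i (1 : ℝ))).of_le hr
  have heval : ContMDiffAt (𝓡 (n + 1)) (𝓘(ℝ, EP).prod 𝓘(ℝ, 𝔩)) r
      (fun z => Bundle.TotalSpace.mk' 𝔩 (E := Bundle.Trivial P 𝔩) (s (φ.symm z))
        (rep1 φ s α z i)) y := by
    apply ContMDiffAt.clm_bundle_apply (F₁ := EP)
    · exact hα.contMDiffAt.comp y hbase
    · exact hframe
  exact contMDiffAt_iff_contDiffAt.1 (Bundle.contMDiffAt_totalSpace.1 heval).2

theorem det_rep2_ne_zero (hφ : φ ∈ IsManifold.maximalAtlas (𝓡 (n + 1)) ∞ M) {h : Tensor2 n M}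
    (hh : ∀ p v, (∀ w, h p w v = 0) → v = 0) (hy : y ∈ φ.target) :
    (Matrix.of (rep2 φ h y)).det ≠ 0 := by
  have hφd : φ.MDifferentiable (𝓡 (n + 1)) (𝓡 (n + 1)) :=
    ⟨(contMDiffOn_of_mem_maximalAtlas hφ).mdifferentiableOn (by simp),
      (contMDiffOn_symm_of_mem_maximalAtlas hφ).mdifferentiableOn (by simp)⟩
  have hsymm := hφd.symm
  set D : Vec n →L[ℝ] Vec n := mfderiv (𝓡 (n + 1)) (𝓡 (n + 1)) φ.symm y
  intro hdet
  obtain ⟨v, hv, hker⟩ := Matrix.exists_mulVec_eq_zero_iff.2 hdet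
  set w : Vec n := WithLp.toLp 2 v
  let b : Vec n →L[ℝ] Vec n →L[ℝ] ℝ := h (φ.symm y)
  have hw : w = ∑ j, v j • EuclideanSpace.single j (1 : ℝ) := by
    ext i
    simp [w, Pi.single_apply]
  have hframe : ∀ i, b (D (EuclideanSpace.single i 1)) (D w) = 0 := fun i => by
    rw [hw, map_sum, map_sum]
    refine (Finset.sum_congr rfl fun j _ => ?_).trans (congrFun hker i)
    rw [map_smul, map_smul, smul_eq_mul, mul_comm]
    rfl
  have hzero : (((b.flip (D w)).comp D : Vec n →L[ℝ] ℝ) : Vec n →ₗ[ℝ] ℝ) = 0 :=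
    (EuclideanSpace.basisFun (Fin (n + 1)) ℝ).toBasis.ext fun i => by simpa using hframe i
  have hDw : D w = 0 := hh _ _ fun u => by
    obtain ⟨u, rfl⟩ := hsymm.mfderiv_surjective hy u
    exact LinearMap.congr_fun hzero u
  have hw₀ : w = 0 := hsymm.mfderiv_injective hy (hDw.trans (map_zero D).symm)
  exact hv ((WithLp.toLp_eq_zero 2).1 hw₀)

variable [IsManifold (𝓡 (n + 1)) ∞ M]

theorem contDiffAt_rep2 (hφ : φ ∈ IsManifold.maximalAtlas (𝓡 (n + 1)) ∞ M) (hr : r ≤ ∞)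
    {h : Tensor2 n M} (hh : IsSymTensor r h) (hy : y ∈ φ.target) (i j : Fin (n + 1)) :
    ContDiffAt ℝ r (fun z => rep2 φ h z i j) y := by
  have hsymm := contMDiffOn_symm_of_mem_maximalAtlas hφ
  have hbase : ContMDiffAt (𝓡 (n + 1)) (𝓡 (n + 1)) r φ.symm y :=
    (hsymm.contMDiffAt (φ.open_target.mem_nhds hy)).of_le hr
  have hframe := fun i => (contMDiffAt_mfderiv_apply φ.open_target hsymm hy
    (EuclideanSpace.single i (1 : ℝ))).of_le hr
  have heval : ContMDiffAt (𝓡 (n + 1)) ((𝓡 (n + 1)).prod 𝓘(ℝ)) r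
      (fun z => Bundle.TotalSpace.mk' ℝ (E := Bundle.Trivial M ℝ) (φ.symm z)
        (rep2 φ h z i j)) y := by
    apply ContMDiffAt.clm_bundle_apply₂ (F₁ := Vec n) (F₂ := Vec n)
    · exact hh.contMDiff.contMDiffAt.comp y hbase
    · exact hframe i
    · exact hframe j
  exact contMDiffAt_iff_contDiffAt.1 (Bundle.contMDiffAt_totalSpace.1 heval).2

end Charts

section Bracket

variable {EL : Type*} [NormedAddCommGroup EL] [NormedSpace ℝ EL] [FiniteDimensional ℝ EL]
  {L : Type*} [TopologicalSpace L] [ChartedSpace EL L] [Group L] [LieGroup 𝓘(ℝ, EL) ∞ L]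

variable (EL L) in
theorem exists_lieBr_eq : ∃ B : EL →L[ℝ] EL →L[ℝ] EL, lieBr L = (B · ·) ∧
    ∀ u v, B u v = -B v u := by
  have hsmooth : minSmoothness ℝ 3 ≤ ∞ := by
    rw [minSmoothness_of_isRCLikeNormedField]
    norm_cast
  have : LieGroup 𝓘(ℝ, EL) (minSmoothness ℝ 3) L := LieGroup.of_le hsmooth
  have : CompleteSpace EL := FiniteDimensional.complete ℝ EL
  let 𝔤 := GroupLieAlgebra 𝓘(ℝ, EL) L
  let b : EL →ₗ[ℝ] EL →ₗ[ℝ] EL := LinearMap.mk₂ ℝ (lieBr L)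
    (fun u v w => add_lie (L := 𝔤) (M := 𝔤) u v w)
    (fun c u v => smul_lie (L := 𝔤) (M := 𝔤) c u v)
    (fun u v w => lie_add (L := 𝔤) (M := 𝔤) u v w)
    (fun c u v => lie_smul (L := 𝔤) (M := 𝔤) c u v)
  exact ⟨LinearMap.toContinuousLinearMap (LinearMap.toContinuousLinearMap.toLinearMap ∘ₗ b), rfl,
    fun u v => (lie_skew (L := 𝔤) u v).symm⟩

end Bracket

section TrivialConfiguration

variable {n : ℕ} {M : Type*} [TopologicalSpace M] [ChartedSpace (Vec n) M]
  [IsManifold (𝓡 (n + 1)) ∞ M]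
  {EL : Type*} [NormedAddCommGroup EL] [NormedSpace ℝ EL]
  {L : Type*} [TopologicalSpace L] [ChartedSpace EL L] [Group L]
  {EP : Type*} [NormedAddCommGroup EP] [NormedSpace ℝ EP]
  {P : Type*} [TopologicalSpace P] [ChartedSpace EP P] [IsManifold 𝓘(ℝ, EP) ∞ P] {π : P → M}
  {g₀ Θ A : Tensor2 n M} {ϖ₀ ε a : Form1 EP P EL}
  {φ : OpenPartialHomeomorph M (Vec n)} {s : M → P} {y : Vec n}

/-- `(g₀, ϖ₀)` is a trivial configuration of class `C^2`: a possibly indefinite Einstein metric on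
`M` and a flat `𝔩`-valued 1-form on `P`. -/
structure IsTrivialConfiguration (L : Type*) [TopologicalSpace L] [ChartedSpace EL L] [Group L]
    (π : P → M) (g₀ : Tensor2 n M) (ϖ₀ : Form1 EP P EL) : Prop where
  symTensor : IsSymTensor 2 g₀
  nondegenerate : ∀ p v, (∀ w, g₀ p w v = 0) → v = 0
  einstein : IsEinstein n g₀
  form : IsCForm 2 ϖ₀
  flat : IsFlat n L π ϖ₀

theorem IsTrivialConfiguration.of_riemannian [MulAction Lᵐᵒᵖ P]
    {g₀ : Bundle.ContMDiffRiemannianMetric (𝓡 (n + 1)) ∞ (Vec n)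
      (fun p : M => TangentSpace (𝓡 (n + 1)) p)}
    (hg₀ : IsEinstein n g₀.inner) (hϖ₀ : IsConnection L ϖ₀) (hflat : IsFlat n L π ϖ₀) :
    IsTrivialConfiguration L π g₀.inner ϖ₀ where
  symTensor := ⟨g₀.symm, g₀.contMDiff.of_le (by norm_cast)⟩
  nondegenerate p v h := by_contra fun hv => (g₀.pos p v hv).ne' (h v)
  einstein := hg₀
  form := hϖ₀.smooth.of_le (by norm_cast)
  flat := hflat

theorem IsTrivialConfiguration.isTrivialOn (h₀ : IsTrivialConfiguration L π g₀ ϖ₀)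
    (hφ : φ ∈ IsManifold.maximalAtlas (𝓡 (n + 1)) ∞ M) (hs : IsLocalSection n EP π φ.source s)
    {B : EL →L[ℝ] EL →L[ℝ] EL} (hB : lieBr L = (B · ·)) :
    IsTrivialOn B (rep2 φ g₀) (rep1 φ s ϖ₀) φ.target where
  isOpen := φ.open_target
  isMetricAt _ hz :=
    ⟨fun _ _ _ => h₀.symTensor.symm _ _ _, contDiffAt_rep2 hφ (by norm_cast) h₀.symTensor hz,
      det_rep2_ne_zero hφ h₀.nondegenerate hz⟩
  contDiffAt _ hz := contDiffAt_rep1 hφ hs.1 (by norm_cast) h₀.form hz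
  einstein := h₀.einstein φ hφ
  flat := hB ▸ h₀.flat φ hφ s hs

theorem isAdmissible_rep (hφ : φ ∈ IsManifold.maximalAtlas (𝓡 (n + 1)) ∞ M)
    (hs : ContMDiffOn (𝓡 (n + 1)) 𝓘(ℝ, EP) ∞ s φ.source) (hΘ : IsSymTensor 2 Θ)
    (hA : IsSymTensor 2 A) (hε : IsCForm 2 ε) (ha : IsCForm 2 a) (hy : y ∈ φ.target) {r : ℝ}
    (bΘ : JetBound2 (rep2 φ Θ) y r) (bA : JetBound2 (rep2 φ A) y r)
    (bε : JetBound1 (rep1 φ s ε) y r) (ba : JetBound1 (rep1 φ s a) y r) :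
    Perturbation.IsAdmissible ⟨rep2 φ Θ, rep2 φ A, rep1 φ s ε, rep1 φ s a, y, r⟩ where
  symm_Θ _ _ _ := hΘ.symm _ _ _
  symm_A _ _ _ := hA.symm _ _ _
  jet_Θ i j := ⟨contDiffAt_rep2 hφ (by norm_cast) hΘ hy i j, bΘ i j⟩
  jet_A i j := ⟨contDiffAt_rep2 hφ (by norm_cast) hA hy i j, bA i j⟩
  jet_ε i := ⟨contDiffAt_rep1 hφ hs (by norm_cast) hε hy i, bε i⟩
  jet_a i := ⟨contDiffAt_rep1 hφ hs (by norm_cast) ha hy i, ba i⟩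

theorem exists_isAdmissible_rep (hφ : φ ∈ IsManifold.maximalAtlas (𝓡 (n + 1)) ∞ M)
    (hs : ContMDiffOn (𝓡 (n + 1)) 𝓘(ℝ, EP) ∞ s φ.source) (hΘ : IsSymTensor 2 Θ)
    (hA : IsSymTensor 2 A) (hε : IsCForm 2 ε) (ha : IsCForm 2 a) (hy : y ∈ φ.target) :
    ∃ r, Perturbation.IsAdmissible ⟨rep2 φ Θ, rep2 φ A, rep1 φ s ε, rep1 φ s a, y, r⟩ := by
  have hjet2 : ∀ {T : Tensor2 n M}, IsSymTensor 2 T →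
      ∀ᶠ r in atTop, JetBound2 (rep2 φ T) y r := fun hT =>
    eventually_all.2 fun i => eventually_all.2 fun j =>
      (eventually_jetLe (contDiffAt_rep2 hφ (by norm_cast) hT hy i j)).mono fun _ h => h.2
  have hjet1 : ∀ {α : Form1 EP P EL}, IsCForm 2 α →
      ∀ᶠ r in atTop, JetBound1 (rep1 φ s α) y r := fun hα =>
    eventually_all.2 fun i =>
      (eventually_jetLe (contDiffAt_rep1 hφ hs (by norm_cast) hα hy i)).mono fun _ h => h.2
  obtain ⟨r, bΘ, bA, bε, ba⟩ :=
    ((hjet2 hΘ).and <| (hjet2 hA).and <| (hjet1 hε).and (hjet1 ha)).exists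
  exact ⟨r, isAdmissible_rep hφ hs hΘ hA hε ha hy bΘ bA bε ba⟩

variable [FiniteDimensional ℝ EL] [LieGroup 𝓘(ℝ, EL) ∞ L]

theorem IsTrivialConfiguration.gauged_zero (h₀ : IsTrivialConfiguration L π g₀ ϖ₀)
    (hφ : φ ∈ IsManifold.maximalAtlas (𝓡 (n + 1)) ∞ M) (hs : IsLocalSection n EP π φ.source s)
    (q : EL →L[ℝ] EL →L[ℝ] ℝ) (hy : y ∈ φ.target) :
    (∀ i j, gaugedQ L q φ s g₀ ϖ₀ 0 0 0 0 y i j = 0) ∧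
      ∀ i, gaugedR L φ s g₀ ϖ₀ 0 0 0 0 y i = 0 := by
  obtain ⟨B, hB, hskew⟩ := exists_lieBr_eq EL L
  simp only [gaugedQ, gaugedR, hB]
  exact (h₀.isTrivialOn hφ hs hB).op_zero hskew q hy

theorem IsTrivialConfiguration.hasDerivAt_gauged (h₀ : IsTrivialConfiguration L π g₀ ϖ₀)
    (hφ : φ ∈ IsManifold.maximalAtlas (𝓡 (n + 1)) ∞ M) (hs : IsLocalSection n EP π φ.source s)
    (q : EL →L[ℝ] EL →L[ℝ] ℝ) (hΘ : IsSymTensor 2 Θ) (hA : IsSymTensor 2 A) (hε : IsCForm 2 ε)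
    (ha : IsCForm 2 a) (hy : y ∈ φ.target) :
    (∀ i j, HasDerivAt
      (fun t : ℝ => gaugedQ L q φ s g₀ ϖ₀ (t • Θ) (t • A) (t • ε) (t • a) y i j)
      (metricBlock φ g₀ Θ A y i j) 0) ∧
    (∀ i, HasDerivAt
      (fun t : ℝ => gaugedR L φ s g₀ ϖ₀ (t • Θ) (t • A) (t • ε) (t • a) y i)
      (connectionBlock L φ s g₀ ϖ₀ ε a y i) 0) ∧
    ∀ i j, HasDerivAt
      (fun t : ℝ => stressModRep L q φ s (g₀ + t • Θ + t • A) (ϖ₀ + t • ε + t • a) y i j) 0 0 := by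
  obtain ⟨B, hB, hskew⟩ := exists_lieBr_eq EL L
  obtain ⟨r, hx⟩ := exists_isAdmissible_rep hφ hs.1 hΘ hA hε ha hy
  simp only [gaugedQ, gaugedR, stressModRep, metricBlock, connectionBlock, hB]
  exact hx.hasDerivAt hskew q (h₀.isTrivialOn hφ hs hB) hy

theorem IsTrivialConfiguration.exists_gauged_sub_le (h₀ : IsTrivialConfiguration L π g₀ ϖ₀)
    (hφ : φ ∈ IsManifold.maximalAtlas (𝓡 (n + 1)) ∞ M) (hs : IsLocalSection n EP π φ.source s)
    (q : EL →L[ℝ] EL →L[ℝ] ℝ) {K : Set (Vec n)} (hK : IsCompact K) (hKφ : K ⊆ φ.target) :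
    ∃ C : ℝ, ∃ ρ > 0, ∀ Θ A : Tensor2 n M, IsSymTensor 2 Θ → IsSymTensor 2 A →
      ∀ ε a : Form1 EP P EL, IsCForm 2 ε → IsCForm 2 a → ∀ y ∈ K, ∀ r ≤ ρ,
        JetBound2 (rep2 φ Θ) y r → JetBound2 (rep2 φ A) y r →
        JetBound1 (rep1 φ s ε) y r → JetBound1 (rep1 φ s a) y r →
          (∀ i j, |gaugedQ L q φ s g₀ ϖ₀ Θ A ε a y i j
            - metricBlock φ g₀ Θ A y i j| ≤ C * r ^ 2) ∧
          ∀ i, ‖gaugedR L φ s g₀ ϖ₀ Θ A ε a y i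
            - connectionBlock L φ s g₀ ϖ₀ ε a y i‖ ≤ C * r ^ 2 := by
  obtain ⟨B, hB, hskew⟩ := exists_lieBr_eq EL L
  obtain ⟨C, ρ, hρ, hC⟩ :=
    Perturbation.exists_remainderLe hskew q (h₀.isTrivialOn hφ hs hB) hK hKφ
  simp only [gaugedQ, gaugedR, metricBlock, connectionBlock, hB]
  refine ⟨C, ρ, hρ, fun Θ A hΘ hA ε a hε ha y hy r hr bΘ bA bε ba => ?_⟩
  have hx := isAdmissible_rep hφ hs.1 hΘ hA hε ha (hKφ hy) bΘ bA bε ba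
  exact ⟨(hC _ hx hy hr).metric, (hC _ hx hy hr).connection⟩

end TrivialConfiguration

end EYM

open EYM in
theorem lemma6p4_general (n : ℕ) (_hn : n ≠ 1)
    {M : Type*} [TopologicalSpace M] [ChartedSpace (Vec n) M] [IsManifold (𝓡 (n + 1)) ∞ M]
    {EL : Type*} [NormedAddCommGroup EL] [NormedSpace ℝ EL] [FiniteDimensional ℝ EL]
    {L : Type*} [TopologicalSpace L] [ChartedSpace EL L] [Group L] [LieGroup 𝓘(ℝ, EL) ∞ L]
    (q : EL →L[ℝ] EL →L[ℝ] ℝ)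
    {EP : Type*} [NormedAddCommGroup EP] [NormedSpace ℝ EP]
    {P : Type*} [TopologicalSpace P] [ChartedSpace EP P] [IsManifold 𝓘(ℝ, EP) ∞ P] (π : P → M)
    (g₀ : Tensor2 n M) (ϖ₀ : Form1 EP P EL) (h₀ : IsTrivialConfiguration L π g₀ ϖ₀)
    (φ : OpenPartialHomeomorph M (Vec n)) (hφ : φ ∈ IsManifold.maximalAtlas (𝓡 (n + 1)) ∞ M)
    (s : M → P) (hs : IsLocalSection n EP π φ.source s) :
    (∀ y ∈ φ.target, (∀ i j, gaugedQ L q φ s g₀ ϖ₀ 0 0 0 0 y i j = 0) ∧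
      ∀ i, gaugedR L φ s g₀ ϖ₀ 0 0 0 0 y i = 0) ∧
    (∀ Θ A : Tensor2 n M, IsSymTensor 2 Θ → IsSymTensor 2 A →
      ∀ ε a : Form1 EP P EL, IsCForm 2 ε → IsCForm 2 a → ∀ y ∈ φ.target,
        (∀ i j, HasDerivAt
          (fun t : ℝ => gaugedQ L q φ s g₀ ϖ₀ (t • Θ) (t • A) (t • ε) (t • a) y i j)
          (metricBlock φ g₀ Θ A y i j) 0) ∧
        (∀ i, HasDerivAt
          (fun t : ℝ => gaugedR L φ s g₀ ϖ₀ (t • Θ) (t • A) (t • ε) (t • a) y i)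
          (connectionBlock L φ s g₀ ϖ₀ ε a y i) 0) ∧
        ∀ i j, HasDerivAt
          (fun t : ℝ => stressModRep L q φ s (g₀ + t • Θ + t • A)
            (ϖ₀ + t • ε + t • a) y i j) 0 0) ∧
    ∀ K : Set (Vec n), IsCompact K → K ⊆ φ.target → ∃ C : ℝ, ∃ ρ > 0,
      ∀ Θ A : Tensor2 n M, IsSymTensor 2 Θ → IsSymTensor 2 A →
      ∀ ε a : Form1 EP P EL, IsCForm 2 ε → IsCForm 2 a → ∀ y ∈ K, ∀ r ≤ ρ,
        JetBound2 (rep2 φ Θ) y r → JetBound2 (rep2 φ A) y r →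
        JetBound1 (rep1 φ s ε) y r → JetBound1 (rep1 φ s a) y r →
          (∀ i j, |gaugedQ L q φ s g₀ ϖ₀ Θ A ε a y i j
            - metricBlock φ g₀ Θ A y i j| ≤ C * r ^ 2) ∧
          ∀ i, ‖gaugedR L φ s g₀ ϖ₀ Θ A ε a y i
            - connectionBlock L φ s g₀ ϖ₀ ε a y i‖ ≤ C * r ^ 2 :=
  ⟨fun _ hy => h₀.gauged_zero hφ hs q hy,
    fun _ _ hΘ hA _ _ hε ha _ hy => h₀.hasDerivAt_gauged hφ hs q hΘ hA hε ha hy,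
    fun _ hK hKφ => h₀.exists_gauged_sub_le hφ hs q hK hKφ⟩


open EYM in
theorem lemma6p4 (n : ℕ) (hn : 2 ≤ n)
    -- the manifold `M` of dimension `n + 1`
    {M : Type*} [TopologicalSpace M] [ChartedSpace (Vec n) M] [IsManifold (𝓡 (n + 1)) ∞ M]
    -- the compact Lie group `L` with an `Ad`-invariant inner product on its Lie algebra
    {EL : Type*} [NormedAddCommGroup EL] [NormedSpace ℝ EL] [FiniteDimensional ℝ EL]
    {L : Type*} [TopologicalSpace L] [ChartedSpace EL L] [Group L] [LieGroup 𝓘(ℝ, EL) ∞ L]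
    [CompactSpace L] (q : EL →L[ℝ] EL →L[ℝ] ℝ) (hq : IsAdInvariantInner L q)
    -- the principal bundle `π : P → M`
    {EP : Type*} [NormedAddCommGroup EP] [NormedSpace ℝ EP] [FiniteDimensional ℝ EP]
    {P : Type*} [TopologicalSpace P] [ChartedSpace EP P] [IsManifold 𝓘(ℝ, EP) ∞ P]
    [MulAction Lᵐᵒᵖ P] (π : P → M) (hπ : IsPrincipalBundle n EL L EP π)
    -- the trivial configuration `(g₀, ϖ₀)`
    (g₀ : Bundle.ContMDiffRiemannianMetric (𝓡 (n + 1)) ∞ (Vec n)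
      (fun p : M => TangentSpace (𝓡 (n + 1)) p))
    (hg₀ : IsEinstein n g₀.inner)
    (ϖ₀ : Form1 EP P EL) (hϖ₀ : IsConnection L ϖ₀) (hflat : IsFlat n L π ϖ₀)
    -- a chart of `M` and a local gauge over its domain
    (φ : OpenPartialHomeomorph M (Vec n)) (hφ : φ ∈ IsManifold.maximalAtlas (𝓡 (n + 1)) ∞ M)
    (s : M → P) (hs : IsLocalSection n EP π φ.source s) :
    -- `(g₀, ϖ₀)` is a zero of the gauged operator
    (∀ y ∈ φ.target, (∀ i j, gaugedQ L q φ s g₀.inner ϖ₀ 0 0 0 0 y i j = 0) ∧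
      ∀ i, gaugedR L φ s g₀.inner ϖ₀ 0 0 0 0 y i = 0) ∧
    -- directional derivatives; the modified stress-energy tensor does not contribute
    (∀ Θ A : Tensor2 n M, IsSymTensor 2 Θ → IsSymTensor 2 A →
      ∀ ε a : Form1 EP P EL, IsAdForm L 2 ε → IsAdForm L 2 a → ∀ y ∈ φ.target,
        (∀ i j, HasDerivAt
          (fun t : ℝ => gaugedQ L q φ s g₀.inner ϖ₀ (t • Θ) (t • A) (t • ε) (t • a) y i j)
          (metricBlock φ g₀.inner Θ A y i j) 0) ∧
        (∀ i, HasDerivAt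
          (fun t : ℝ => gaugedR L φ s g₀.inner ϖ₀ (t • Θ) (t • A) (t • ε) (t • a) y i)
          (connectionBlock L φ s g₀.inner ϖ₀ ε a y i) 0) ∧
        (∀ i j, HasDerivAt
          (fun t : ℝ => stressModRep L q φ s (g₀.inner + t • Θ + t • A)
            (ϖ₀ + t • ε + t • a) y i j) 0 0)) ∧
    -- Fréchet differentiability, with a quadratic remainder that is uniform on compact sets
    (∀ K : Set (Vec n), IsCompact K → K ⊆ φ.target → ∃ C : ℝ, ∃ ρ > 0,
      ∀ Θ A : Tensor2 n M, IsSymTensor 2 Θ → IsSymTensor 2 A →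
      ∀ ε a : Form1 EP P EL, IsAdForm L 2 ε → IsAdForm L 2 a → ∀ y ∈ K, ∀ r ≤ ρ,
        JetBound2 (rep2 φ Θ) y r → JetBound2 (rep2 φ A) y r →
        JetBound1 (rep1 φ s ε) y r → JetBound1 (rep1 φ s a) y r →
          (∀ i j, |gaugedQ L q φ s g₀.inner ϖ₀ Θ A ε a y i j
            - metricBlock φ g₀.inner Θ A y i j| ≤ C * r ^ 2) ∧
          ∀ i, ‖gaugedR L φ s g₀.inner ϖ₀ Θ A ε a y i
            - connectionBlock L φ s g₀.inner ϖ₀ ε a y i‖ ≤ C * r ^ 2) := by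
  obtain ⟨hzero, hderiv, hrem⟩ :=
    lemma6p4_general n (by lia) q π _ _ (.of_riemannian hg₀ hϖ₀ hflat) φ hφ s hs
  exact ⟨hzero, fun Θ A hΘ hA ε a hε ha => hderiv Θ A hΘ hA ε a hε.contMDiff ha.contMDiff,
    fun K hK hKφ => (hrem K hK hKφ).imp fun C => Exists.imp fun ρ => And.imp_right
      fun h Θ A hΘ hA ε a hε ha => h Θ A hΘ hA ε a hε.contMDiff ha.contMDiff⟩
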